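/- Let $k$ be a field of characteristic $0$ and $n \ge 0$ an integer. A *2-rig* is a symmetric monoidal $k$-linear category (with $\otimes$ $k$-bilinear on morphisms) that is Cauchy complete, i.e. has finite biproducts and split idempotents. A *map of 2-rigs* is a symmetric (strong) monoidal $k$-linear functor, and a *2-morphism* is a monoidal natural transformation; write $\mathbf{2Rig}(R,R')$ for the category of maps $R \to R'$. For an object $r$ of a 2-rig, $\Lambda^m(r)$ is the object splitting the idempotent $\frac{1}{m!}\sum_{\sigma \in S_m} \mathrm{sgn}(\sigma)\,\sigma$ on $r^{\otimes m}$, and $r$ has *subdimension $n$* if $\Lambda^{n+1}(r) \cong 0$. Maps of 2-rigs preserve exterior powers, so sending $R$ to its full subcategory $\mathrm{Subdim}_n(R)$ of objects of subdimension $n$ is a 2-functor $\mathrm{Subdim}_n$ from 2-rigs to categories. Let $\overline{k\mathsf{S}}$ be the free 2-rig on one object: the Cauchy completion (under finite biproducts and splitting of idempotents) of the free $k$-linear category on the groupoid $\mathsf{S}$ of finite sets and bijections, with tensor product induced by disjoint union. Let $x$ be its generating object, the one-element set. A *2-ideal* of a 2-rig is a full subcategory closed under isomorphisms, finite biproducts,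 retracts, and tensoring with arbitrary objects. Let $\langle \Lambda^{n+1} \rangle$ be the smallest 2-ideal of $\overline{k\mathsf{S}}$ containing $\Lambda^{n+1}(x)$, and let $Q_n = \overline{k\mathsf{S}}/\langle \Lambda^{n+1} \rangle$ be the symmetric monoidal $k$-linear category with the same objects as $\overline{k\mathsf{S}}$, in which two parallel morphisms are identified when their difference factors through an object of $\langle \Lambda^{n+1} \rangle$. Then $Q_n$ is a 2-rig, its object $x$ has subdimension $n$, and $(Q_n, x)$ is the free 2-rig on an object of subdimension $n$: for every 2-rig $R$, evaluation at $x$, $$\mathrm{ev}\colon \mathbf{2Rig}(Q_n, R) \longrightarrow \mathrm{Subdim}_n(R), \qquad F \mapsto F(x),$$ is an equivalence of categories, 2-natural in $R$; that is, $Q_n$ represents $\mathrm{Subdim}_n$. In particular, for every object $r$ of subdimension $n$ in a 2-rig $R$ there is a map of 2-rigs $F\colon Q_n \to R$ with $F(x) = r$, and for any two such maps $F, G$ there is a unique monoidal natural isomorphism $\alpha\colon F \Rightarrow G$ with $\alpha_x = 1_r$. -/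

import Mathlib

open CategoryTheory MonoidalCategory

universe w v u v' u' v'' u''

noncomputable section

/-- A finite set, as an object of the groupoid of finite sets and bijections. -/
structure FinBij : Type 1 where
  carrier : Type
  [fintype : Fintype carrier]

attribute [instance] FinBij.fintype

namespace FinBij

/-- A morphism of `FinBij` is a bijection. -/
@[ext]
structure Hom (A B : FinBij) : Type where
  toEquiv : A.carrier ≃ B.carrier

/-- The groupoid of finite sets and bijections. -/
instance : Category FinBij where
  Hom := Hom
  id A := ⟨Equiv.refl _⟩
  comp f g := ⟨f.toEquiv.trans g.toEquiv⟩

theorem hom_ext {A B : FinBij} {f g : A ⟶ B}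
    (h : ∀ a, f.toEquiv a = g.toEquiv a) : f = g :=
  Hom.ext (Equiv.ext h)

/-- A bijection as an isomorphism of `FinBij`. -/
def mkIso {A B : FinBij} (e : A.carrier ≃ B.carrier) : A ≅ B where
  hom := ⟨e⟩
  inv := ⟨e.symm⟩
  hom_inv_id := hom_ext fun a => e.symm_apply_apply a
  inv_hom_id := hom_ext fun a => e.apply_symm_apply a

/-- The monoidal structure on `FinBij` given by disjoint union. -/
instance : MonoidalCategory FinBij where
  tensorObj A B := ⟨A.carrier ⊕ B.carrier⟩
  whiskerLeft A _ _ f := ⟨Equiv.sumCongr (Equiv.refl A.carrier) f.toEquiv⟩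
  whiskerRight f B := ⟨Equiv.sumCongr f.toEquiv (Equiv.refl B.carrier)⟩
  tensorUnit := ⟨Empty⟩
  associator A B C := mkIso (Equiv.sumAssoc A.carrier B.carrier C.carrier)
  leftUnitor A := mkIso (Equiv.emptySum Empty A.carrier)
  rightUnitor A := mkIso (Equiv.sumEmpty A.carrier Empty)
  tensorHom_def _ _ := rfl
  id_tensorHom_id _ _ := hom_ext (by rintro (_ | _) <;> rfl)
  tensorHom_comp_tensorHom _ _ _ _ := hom_ext (by rintro (_ | _) <;> rfl)
  whiskerLeft_id _ _ := hom_ext (by rintro (_ | _) <;> rfl)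
  id_whiskerRight _ _ := hom_ext (by rintro (_ | _) <;> rfl)
  associator_naturality _ _ _ := hom_ext (by rintro ((_ | _) | _) <;> rfl)
  leftUnitor_naturality _ := hom_ext (by rintro (x | _); exacts [x.elim, rfl])
  rightUnitor_naturality _ := hom_ext (by rintro (_ | x); exacts [rfl, x.elim])
  pentagon _ _ _ _ := hom_ext (by rintro (((_ | _) | _) | _) <;> rfl)
  triangle _ _ := hom_ext (by rintro ((_ | x) | _); exacts [rfl, x.elim, rfl])

/-- The symmetry of `FinBij` swaps the two summands of a disjoint union. -/
instance : SymmetricCategory FinBij where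
  braiding A B := mkIso (Equiv.sumComm A.carrier B.carrier)
  braiding_naturality_right _ _ _ _ := hom_ext (by rintro (_ | _) <;> rfl)
  braiding_naturality_left _ _ := hom_ext (by rintro (_ | _) <;> rfl)
  hexagon_forward _ _ _ := hom_ext (by rintro ((_ | _) | _) <;> rfl)
  hexagon_reverse _ _ _ := hom_ext (by rintro (_ | (_ | _)) <;> rfl)
  symmetry _ _ := hom_ext (by rintro (_ | _) <;> rfl)

end FinBij

/-- A constructor for monoidal categories from identities between whiskerings. -/
abbrev monoidalOfWhisker {C : Type u} [Category.{v} C] [MonoidalCategoryStruct C]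
    (tensorHom_def : ∀ {X₁ Y₁ X₂ Y₂ : C} (f : X₁ ⟶ Y₁) (g : X₂ ⟶ Y₂),
      f ⊗ₘ g = f ▷ X₂ ≫ Y₁ ◁ g)
    (whiskerLeft_id : ∀ X Y : C, X ◁ 𝟙 Y = 𝟙 (X ⊗ Y))
    (id_whiskerRight : ∀ X Y : C, 𝟙 X ▷ Y = 𝟙 (X ⊗ Y))
    (whiskerLeft_comp : ∀ (X : C) {Y Z W : C} (f : Y ⟶ Z) (g : Z ⟶ W),
      X ◁ (f ≫ g) = X ◁ f ≫ X ◁ g)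
    (comp_whiskerRight : ∀ (X : C) {Y Z W : C} (f : Y ⟶ Z) (g : Z ⟶ W),
      (f ≫ g) ▷ X = f ▷ X ≫ g ▷ X)
    (exchange : ∀ {X Y Z W : C} (f : X ⟶ Y) (g : Z ⟶ W), f ▷ Z ≫ Y ◁ g = X ◁ g ≫ f ▷ W)
    (assoc_left : ∀ {X X' : C} (Y Z : C) (f : X ⟶ X'),
      f ▷ Y ▷ Z ≫ (α_ X' Y Z).hom = (α_ X Y Z).hom ≫ f ▷ (Y ⊗ Z))
    (assoc_mid : ∀ (X : C) {Y Y' : C} (Z : C) (f : Y ⟶ Y'),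
      (X ◁ f) ▷ Z ≫ (α_ X Y' Z).hom = (α_ X Y Z).hom ≫ X ◁ f ▷ Z)
    (assoc_right : ∀ (X Y : C) {Z Z' : C} (f : Z ⟶ Z'),
      (X ⊗ Y) ◁ f ≫ (α_ X Y Z').hom = (α_ X Y Z).hom ≫ X ◁ Y ◁ f)
    (leftUnitor_naturality : ∀ {X Y : C} (f : X ⟶ Y),
      𝟙_ C ◁ f ≫ (λ_ Y).hom = (λ_ X).hom ≫ f)
    (rightUnitor_naturality : ∀ {X Y : C} (f : X ⟶ Y),
      f ▷ 𝟙_ C ≫ (ρ_ Y).hom = (ρ_ X).hom ≫ f)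
    (pentagon : ∀ W X Y Z : C,
      (α_ W X Y).hom ▷ Z ≫ (α_ W (X ⊗ Y) Z).hom ≫ W ◁ (α_ X Y Z).hom =
        (α_ (W ⊗ X) Y Z).hom ≫ (α_ W X (Y ⊗ Z)).hom)
    (triangle : ∀ X Y : C, (α_ X (𝟙_ C) Y).hom ≫ X ◁ (λ_ Y).hom = (ρ_ X).hom ▷ Y) :
    MonoidalCategory C where
  tensorHom_def := tensorHom_def
  id_tensorHom_id X Y := by
    rw [tensorHom_def, whiskerLeft_id, id_whiskerRight, Category.id_comp]
  tensorHom_comp_tensorHom f₁ f₂ g₁ g₂ := by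
    rw [tensorHom_def, tensorHom_def, tensorHom_def, whiskerLeft_comp, comp_whiskerRight,
      Category.assoc, Category.assoc, ← Category.assoc (_ ◁ f₂), ← exchange, Category.assoc]
  whiskerLeft_id := whiskerLeft_id
  id_whiskerRight := id_whiskerRight
  associator_naturality f₁ f₂ f₃ := by
    simp only [tensorHom_def, whiskerLeft_comp, comp_whiskerRight, Category.assoc, assoc_right]
    rw [← Category.assoc ((_ ◁ f₂) ▷ _), assoc_mid, Category.assoc,
      ← Category.assoc (f₁ ▷ _ ▷ _), assoc_left, Category.assoc]
  leftUnitor_naturality := leftUnitor_naturality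
  rightUnitor_naturality := rightUnitor_naturality
  pentagon := pentagon
  triangle := triangle

/-- A constructor for symmetric monoidal categories which only requires one hexagon identity. -/
abbrev symmetricOfHexagon {C : Type u} [Category.{v} C] [MonoidalCategory C]
    (braiding : ∀ X Y : C, X ⊗ Y ≅ Y ⊗ X)
    (naturality_right : ∀ (X : C) {Y Z : C} (f : Y ⟶ Z),
      X ◁ f ≫ (braiding X Z).hom = (braiding X Y).hom ≫ f ▷ X)
    (naturality_left : ∀ {X Y : C} (f : X ⟶ Y) (Z : C),
      f ▷ Z ≫ (braiding Y Z).hom = (braiding X Z).hom ≫ Z ◁ f)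
    (hexagon : ∀ X Y Z : C,
      (α_ X Y Z).hom ≫ (braiding X (Y ⊗ Z)).hom ≫ (α_ Y Z X).hom =
        (braiding X Y).hom ▷ Z ≫ (α_ Y X Z).hom ≫ Y ◁ (braiding X Z).hom)
    (symmetry : ∀ X Y : C, (braiding X Y).hom ≫ (braiding Y X).hom = 𝟙 (X ⊗ Y)) :
    SymmetricCategory C where
  braiding := braiding
  braiding_naturality_right := naturality_right
  braiding_naturality_left := naturality_left
  hexagon_forward := hexagon
  hexagon_reverse X Y Z := by
    have inv : ∀ X Y : C, (braiding X Y).inv = (braiding Y X).hom := fun X Y =>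
      ((Iso.inv_comp_eq _).2 (symmetry X Y).symm |> fun h => by simpa using h)
    have h : (α_ Z X Y ≪≫ braiding Z (X ⊗ Y) ≪≫ α_ X Y Z) =
        whiskerRightIso (braiding Z X) Y ≪≫ α_ X Z Y ≪≫ whiskerLeftIso X (braiding Z Y) :=
      Iso.ext (hexagon Z X Y)
    have h' := congrArg Iso.inv h
    simpa [inv] using h'
  symmetry := symmetry

/-! ### Free linear categories on symmetric monoidal categories -/

namespace FreeLinear

variable {k : Type w} [CommRing k] {C : Type u} [Category.{v} C]

/-- A morphism of `C`, as a basis vector of a morphism space of the free `k`-linear category. -/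
def basis {X Y : C} (f : X ⟶ Y) : Free.of k X ⟶ Free.of k Y :=
  (Free.embedding k C).map f

/-- The linear map on a morphism space of the free `k`-linear category which extends
a given map on basis vectors. -/
def extend {X Y : C} {M : Type*} [AddCommGroup M] [Module k M] (φ : (X ⟶ Y) → M) :
    (Free.of k X ⟶ Free.of k Y) →ₗ[k] M :=
  Finsupp.lift M k (X ⟶ Y) φ

@[simp]
theorem extend_basis {X Y : C} {M : Type*} [AddCommGroup M] [Module k M] (φ : (X ⟶ Y) → M)
    (f : X ⟶ Y) : extend (k := k) φ (basis f) = φ f :=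
  (Finsupp.sum_single_index (zero_smul k (φ f))).trans (one_smul k (φ f))

theorem basis_comp {X Y Z : C} (f : X ⟶ Y) (g : Y ⟶ Z) :
    basis (k := k) f ≫ basis g = basis (f ≫ g) :=
  ((Free.embedding k C).map_comp f g).symm

theorem basis_id (X : C) : basis (k := k) (𝟙 X) = 𝟙 (Free.of k X) := rfl

theorem hom_induction {X Y : C} {P : (Free.of k X ⟶ Free.of k Y) → Prop}
    (f : Free.of k X ⟶ Free.of k Y) (zero : P 0)
    (add : ∀ f g, P f → P g → P (f + g)) (smul : ∀ (a : k) f, P f → P (a • f))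
    (bas : ∀ f, P (basis f)) : P f := by
  refine Finsupp.induction_linear (motive := P) f zero add fun f a => ?_
  have h : ∀ f : X ⟶ Y, a • (Finsupp.single f 1 : (X ⟶ Y) →₀ k) = Finsupp.single f a := fun f => by
    rw [Finsupp.smul_single, smul_eq_mul, mul_one]
  exact (congrArg P (h f)).mp (smul a _ (bas f))

/-- An isomorphism of `C`, as an isomorphism of the free linear category. -/
def basisIso {X Y : C} (e : X ≅ Y) : Free.of k X ≅ Free.of k Y :=
  (Free.embedding k C).mapIso e

@[simp] theorem basisIso_hom {X Y : C} (e : X ≅ Y) :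
    (basisIso (k := k) e).hom = basis e.hom := rfl

@[simp] theorem basisIso_inv {X Y : C} (e : X ≅ Y) :
    (basisIso (k := k) e).inv = basis e.inv := rfl

variable [MonoidalCategory C]

/-- Whiskering in the free linear category is the linear extension of whiskering. -/
def whiskerL (X : C) {Y Z : C} :
    (Free.of k Y ⟶ Free.of k Z) →ₗ[k] (Free.of k (X ⊗ Y) ⟶ Free.of k (X ⊗ Z)) :=
  extend fun f => basis (X ◁ f)

/-- Whiskering in the free linear category is the linear extension of whiskering. -/
def whiskerR (X : C) {Y Z : C} :
    (Free.of k Y ⟶ Free.of k Z) →ₗ[k] (Free.of k (Y ⊗ X) ⟶ Free.of k (Z ⊗ X)) :=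
  extend fun f => basis (f ▷ X)

@[simp] theorem whiskerL_basis (X : C) {Y Z : C} (f : Y ⟶ Z) :
    whiskerL (k := k) X (basis f) = basis (X ◁ f) := extend_basis _ _

@[simp] theorem whiskerR_basis (X : C) {Y Z : C} (f : Y ⟶ Z) :
    whiskerR (k := k) X (basis f) = basis (f ▷ X) := extend_basis _ _

theorem whiskerL_comp (X : C) {Y Z W : C} (f : Free.of k Y ⟶ Free.of k Z)
    (g : Free.of k Z ⟶ Free.of k W) :
    whiskerL X (f ≫ g) = whiskerL X f ≫ whiskerL X g := by
  induction f using hom_induction with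
  | zero => simp
  | add _ _ h h' => simp [h, h']
  | smul _ _ h => simp [h]
  | bas f =>
    induction g using hom_induction with
    | zero => simp
    | add _ _ h h' => simp [h, h']
    | smul _ _ h => simp [h]
    | bas g => simp [basis_comp]

theorem whiskerR_comp (X : C) {Y Z W : C} (f : Free.of k Y ⟶ Free.of k Z)
    (g : Free.of k Z ⟶ Free.of k W) :
    whiskerR X (f ≫ g) = whiskerR X f ≫ whiskerR X g := by
  induction f using hom_induction with
  | zero => simp
  | add _ _ h h' => simp [h, h']
  | smul _ _ h => simp [h]
  | bas f =>
    induction g using hom_induction with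
    | zero => simp
    | add _ _ h h' => simp [h, h']
    | smul _ _ h => simp [h]
    | bas g => simp [basis_comp]

theorem whisker_exchange {X Y Z W : C} (f : Free.of k X ⟶ Free.of k Y)
    (g : Free.of k Z ⟶ Free.of k W) :
    whiskerR Z f ≫ whiskerL Y g = whiskerL X g ≫ whiskerR W f := by
  induction f using hom_induction with
  | zero => simp
  | add _ _ h h' => simp only [map_add, Preadditive.comp_add, Preadditive.add_comp, h, h']
  | smul _ _ h => simp only [map_smul, Linear.comp_smul, Linear.smul_comp, h]
  | bas f =>
    induction g using hom_induction with
    | zero => simp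
    | add _ _ h h' => simp only [map_add, Preadditive.comp_add, Preadditive.add_comp, h, h']
    | smul _ _ h => simp only [map_smul, Linear.comp_smul, Linear.smul_comp, h]
    | bas g => simp [basis_comp, MonoidalCategory.whisker_exchange]

theorem assoc_nat_left {X X' : C} (Y Z : C) (f : Free.of k X ⟶ Free.of k X') :
    whiskerR Z (whiskerR Y f) ≫ basis (α_ X' Y Z).hom =
      basis (α_ X Y Z).hom ≫ whiskerR (Y ⊗ Z) f := by
  induction f using hom_induction with
  | zero => simp
  | add _ _ h h' => simp [h, h']
  | smul _ _ h => simp [h]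
  | bas f => simp [basis_comp]

theorem assoc_nat_mid (X : C) {Y Y' : C} (Z : C) (f : Free.of k Y ⟶ Free.of k Y') :
    whiskerR Z (whiskerL X f) ≫ basis (α_ X Y' Z).hom =
      basis (α_ X Y Z).hom ≫ whiskerL X (whiskerR Z f) := by
  induction f using hom_induction with
  | zero => simp
  | add _ _ h h' => simp [h, h']
  | smul _ _ h => simp [h]
  | bas f => simp [basis_comp]

theorem assoc_nat_right (X Y : C) {Z Z' : C} (f : Free.of k Z ⟶ Free.of k Z') :
    whiskerL (X ⊗ Y) f ≫ basis (α_ X Y Z').hom =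
      basis (α_ X Y Z).hom ≫ whiskerL X (whiskerL Y f) := by
  induction f using hom_induction with
  | zero => simp
  | add _ _ h h' => simp [h, h']
  | smul _ _ h => simp [h]
  | bas f => simp [basis_comp]

theorem leftUnitor_nat {X Y : C} (f : Free.of k X ⟶ Free.of k Y) :
    whiskerL (𝟙_ C) f ≫ basis (λ_ Y).hom = basis (λ_ X).hom ≫ f := by
  induction f using hom_induction with
  | zero => simp
  | add _ _ h h' => simp [h, h']
  | smul _ _ h => simp [h]
  | bas f => simp [basis_comp]

theorem rightUnitor_nat {X Y : C} (f : Free.of k X ⟶ Free.of k Y) :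
    whiskerR (𝟙_ C) f ≫ basis (ρ_ Y).hom = basis (ρ_ X).hom ≫ f := by
  induction f using hom_induction with
  | zero => simp
  | add _ _ h h' => simp [h, h']
  | smul _ _ h => simp [h]
  | bas f => simp [basis_comp]

theorem free_pentagon (W X Y Z : C) :
    whiskerR (k := k) Z (basis (α_ W X Y).hom) ≫ basis (α_ W (X ⊗ Y) Z).hom ≫
      whiskerL W (basis (α_ X Y Z).hom) =
    basis (α_ (W ⊗ X) Y Z).hom ≫ basis (α_ W X (Y ⊗ Z)).hom := by
  simp [basis_comp]

theorem free_triangle (X Y : C) :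
    basis (α_ X (𝟙_ C) Y).hom ≫ whiskerL X (basis (λ_ Y).hom) =
      whiskerR (k := k) Y (basis (ρ_ X).hom) := by
  simp [basis_comp]

instance : MonoidalCategoryStruct (Free k C) where
  tensorObj X Y := Free.of k (MonoidalCategoryStruct.tensorObj (C := C) X Y)
  whiskerLeft X _ _ f := whiskerL (C := C) X f
  whiskerRight f X := whiskerR (C := C) X f
  tensorUnit := Free.of k (𝟙_ C)
  associator X Y Z := basisIso (MonoidalCategoryStruct.associator (C := C) X Y Z)
  leftUnitor X := basisIso (MonoidalCategoryStruct.leftUnitor (C := C) X)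
  rightUnitor X := basisIso (MonoidalCategoryStruct.rightUnitor (C := C) X)

/-- The tensor product of the free linear category is the bilinear extension of that of `C`. -/
instance : MonoidalCategory (Free k C) :=
  monoidalOfWhisker
    (tensorHom_def := fun _ _ => rfl)
    (whiskerLeft_id := fun X Y => (whiskerL_basis (C := C) X (𝟙 _)).trans <|
      congrArg basis (MonoidalCategory.whiskerLeft_id (C := C) X Y))
    (id_whiskerRight := fun X Y => (whiskerR_basis (C := C) Y (𝟙 _)).trans <|
      congrArg basis (MonoidalCategory.id_whiskerRight (C := C) X Y))
    (whiskerLeft_comp := fun X _ _ _ => whiskerL_comp (C := C) X)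
    (comp_whiskerRight := fun X _ _ _ => whiskerR_comp (C := C) X)
    (exchange := whisker_exchange (C := C))
    (assoc_left := fun Y Z => assoc_nat_left (C := C) Y Z)
    (assoc_mid := fun X _ _ Z => assoc_nat_mid (C := C) X Z)
    (assoc_right := fun X Y _ _ => assoc_nat_right (C := C) X Y)
    (leftUnitor_naturality := leftUnitor_nat (C := C))
    (rightUnitor_naturality := rightUnitor_nat (C := C))
    (pentagon := free_pentagon (C := C))
    (triangle := free_triangle (C := C))

instance : MonoidalPreadditive (Free k C) where
  whiskerLeft_zero {X Y Z} := map_zero (whiskerL (k := k) (C := C) X (Y := Y) (Z := Z))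
  zero_whiskerRight {X Y Z} := map_zero (whiskerR (k := k) (C := C) X (Y := Y) (Z := Z))
  whiskerLeft_add {X Y Z} := map_add (whiskerL (k := k) (C := C) X (Y := Y) (Z := Z))
  add_whiskerRight {X Y Z} := map_add (whiskerR (k := k) (C := C) X (Y := Y) (Z := Z))

instance : MonoidalLinear k (Free k C) where
  whiskerLeft_smul X Y Z := map_smul (whiskerL (k := k) (C := C) X (Y := Y) (Z := Z))
  smul_whiskerRight a Y Z f X := map_smul (whiskerR (k := k) (C := C) X (Y := Y) (Z := Z)) a f

variable [SymmetricCategory C]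

theorem braiding_nat_right (X : C) {Y Z : C} (f : Free.of k Y ⟶ Free.of k Z) :
    whiskerL X f ≫ basis (β_ X Z).hom = basis (β_ X Y).hom ≫ whiskerR X f := by
  induction f using hom_induction with
  | zero => simp
  | add _ _ h h' => simp [h, h']
  | smul _ _ h => simp [h]
  | bas f => simp [basis_comp]

theorem braiding_nat_left {X Y : C} (f : Free.of k X ⟶ Free.of k Y) (Z : C) :
    whiskerR Z f ≫ basis (β_ Y Z).hom = basis (β_ X Z).hom ≫ whiskerL Z f := by
  induction f using hom_induction with
  | zero => simp
  | add _ _ h h' => simp [h, h']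
  | smul _ _ h => simp [h]
  | bas f => simp [basis_comp]

theorem free_hexagon_forward (X Y Z : C) :
    basis (k := k) (α_ X Y Z).hom ≫ basis (β_ X (Y ⊗ Z)).hom ≫ basis (α_ Y Z X).hom =
      whiskerR Z (basis (β_ X Y).hom) ≫ basis (α_ Y X Z).hom ≫
        whiskerL Y (basis (β_ X Z).hom) := by
  simp [basis_comp]

theorem free_symmetry (X Y : C) :
    basis (k := k) (β_ X Y).hom ≫ basis (β_ Y X).hom = 𝟙 (Free.of k (X ⊗ Y)) := by
  rw [basis_comp, SymmetricCategory.symmetry, basis_id]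

instance : SymmetricCategory (Free k C) :=
  symmetricOfHexagon (fun X Y => basisIso (BraidedCategory.braiding (C := C) X Y))
    (fun X _ _ f => braiding_nat_right (C := C) X f)
    (fun f Z => braiding_nat_left (C := C) f Z)
    (free_hexagon_forward (C := C)) (free_symmetry (C := C))

end FreeLinear

/-! ### Additive completions -/

namespace AddCompletion

variable {C : Type u} [Category.{v} C] [Preadditive C]

instance (k : Type w) [CommRing k] [Linear k C] : Linear k (Mat_ C) where
  homModule M N := inferInstanceAs (Module k (∀ (i : M.ι) (j : N.ι), M.X i ⟶ N.X j))
  smul_comp M N K a f g := by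
    ext i j
    change ∑ l, (a • f i l) ≫ g l j = a • ∑ l, f i l ≫ g l j
    simp [Finset.smul_sum]
  comp_smul M N K f a g := by
    ext i j
    change ∑ l, f i l ≫ (a • g l j) = a • ∑ l, f i l ≫ g l j
    simp [Finset.smul_sum]

/-- A matrix of morphisms, as a morphism of the additive completion. -/
def ofEntries {M N : Mat_ C} (f : ∀ i j, M.X i ⟶ N.X j) : M ⟶ N := f

theorem ofEntries_apply {M N : Mat_ C} (f : ∀ i j, M.X i ⟶ N.X j) (i j) :
    ofEntries f i j = f i j := rfl

open scoped Classical in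
/-- The matrix whose only nonzero entries are the given morphisms `M.X i ⟶ N.X (e i)`. -/
def graph {M N : Mat_ C} (e : M.ι → N.ι) (φ : ∀ i, M.X i ⟶ N.X (e i)) : M ⟶ N :=
  ofEntries fun i j => if h : e i = j then φ i ≫ eqToHom (congrArg N.X h) else 0

theorem graph_apply_self {M N : Mat_ C} (e : M.ι → N.ι) (φ : ∀ i, M.X i ⟶ N.X (e i)) (i) :
    graph e φ i (e i) = φ i := by
  simp [graph, ofEntries_apply]

theorem graph_apply_ne {M N : Mat_ C} (e : M.ι → N.ι) (φ : ∀ i, M.X i ⟶ N.X (e i)) {i j}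
    (h : e i ≠ j) : graph e φ i j = 0 := by
  simp [graph, ofEntries_apply, h]

theorem graph_comp_apply {M N K : Mat_ C} (e : M.ι → N.ι) (φ : ∀ i, M.X i ⟶ N.X (e i))
    (f : N ⟶ K) (i j) : (graph e φ ≫ f) i j = φ i ≫ f (e i) j := by
  rw [Mat_.comp_apply, Finset.sum_eq_single (e i), graph_apply_self]
  · intro l _ h
    rw [graph_apply_ne e φ (Ne.symm h), Limits.zero_comp]
  · simp

theorem comp_graph_apply {M N K : Mat_ C} (e : N.ι → K.ι) (he : Function.Injective e)
    (φ : ∀ i, N.X i ⟶ K.X (e i)) (f : M ⟶ N) (i j) :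
    (f ≫ graph e φ) i (e j) = f i j ≫ φ j := by
  rw [Mat_.comp_apply, Finset.sum_eq_single j, graph_apply_self]
  · intro l _ h
    rw [graph_apply_ne e φ (fun h' => h (he h')), Limits.comp_zero]
  · simp

theorem id_eq_graph (M : Mat_ C) : 𝟙 M = graph (M := M) (N := M) id (fun _ => 𝟙 _) := by
  ext i j
  rw [Mat_.id_apply]
  simp [graph, ofEntries_apply]

theorem graph_comp_graph {M N K : Mat_ C} (e : M.ι → N.ι) (φ : ∀ i, M.X i ⟶ N.X (e i))
    (e' : N.ι → K.ι) (φ' : ∀ i, N.X i ⟶ K.X (e' i)) :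
    graph e φ ≫ graph e' φ' =
      graph (M := M) (N := K) (fun i => e' (e i)) (fun i => φ i ≫ φ' (e i)) := by
  ext i j
  rw [graph_comp_apply]
  by_cases h : e' (e i) = j
  · subst h
    rw [graph_apply_self, graph_apply_self (M := M) (N := K) (fun i => e' (e i))]
  · rw [graph_apply_ne _ _ h, graph_apply_ne (M := M) (N := K) (fun i => e' (e i)) _ h,
      Limits.comp_zero]

theorem graph_congr {M N : Mat_ C} {e : M.ι → N.ι} {φ ψ : ∀ i, M.X i ⟶ N.X (e i)}
    (h : ∀ i, φ i = ψ i) : graph e φ = graph e ψ := by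
  rw [funext h]

open scoped Classical in
/-- A bijection of index sets and isomorphisms of the entries give an isomorphism. -/
def graphIso {M N : Mat_ C} (e : M.ι ≃ N.ι) (φ : ∀ i, M.X i ≅ N.X (e i)) : M ≅ N where
  hom := graph e fun i => (φ i).hom
  inv := ofEntries fun j i => if h : e i = j then eqToHom (congrArg N.X h.symm) ≫ (φ i).inv else 0
  hom_inv_id := by
    ext i j
    rw [graph_comp_apply, Mat_.id_apply, ofEntries_apply]
    by_cases h : i = j
    · subst h
      simp
    · have h' : e j ≠ e i := fun h' => h (e.injective h').symm
      simp [h, h']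
  inv_hom_id := by
    ext j j'
    obtain ⟨i, rfl⟩ := e.surjective j
    obtain ⟨i', rfl⟩ := e.surjective j'
    rw [comp_graph_apply _ e.injective, Mat_.id_apply, ofEntries_apply]
    by_cases h : i = i'
    · subst h
      simp
    · have h' : e i' ≠ e i := fun h' => h (e.injective h').symm
      have h'' : e i ≠ e i' := fun h' => h (e.injective h')
      simp [h', h'']

variable [MonoidalCategory C]

/-- The tensor product of two finite families of objects. -/
abbrev tens (M N : Mat_ C) : Mat_ C := ⟨M.ι × N.ι, fun p => M.X p.1 ⊗ N.X p.2⟩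

/-- The Kronecker product of two matrices of morphisms. -/
def kron {M N M' N' : Mat_ C} (f : M ⟶ M') (g : N ⟶ N') : tens M N ⟶ tens M' N' :=
  ofEntries fun p q => f p.1 q.1 ⊗ₘ g p.2 q.2

theorem kron_apply {M N M' N' : Mat_ C} (f : M ⟶ M') (g : N ⟶ N') (i j i' j') :
    kron f g (i, j) (i', j') = f i i' ⊗ₘ g j j' := rfl

variable [MonoidalPreadditive C]

theorem kron_comp {M N K M' N' K' : Mat_ C} (f : M ⟶ N) (g : N ⟶ K) (f' : M' ⟶ N')
    (g' : N' ⟶ K') : kron f f' ≫ kron g g' = kron (f ≫ g) (f' ≫ g') := by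
  ext ⟨i, i'⟩ ⟨j, j'⟩
  refine Eq.trans (b := ∑ p : N.ι × N'.ι, (f i p.1 ⊗ₘ f' i' p.2) ≫ (g p.1 j ⊗ₘ g' p.2 j')) rfl ?_
  refine Eq.trans ?_ (b := (∑ l, f i l ≫ g l j) ⊗ₘ (∑ l, f' i' l ≫ g' l j')) rfl
  rw [sum_tensor, Fintype.sum_prod_type]
  simp only [tensor_sum, tensorHom_comp_tensorHom]

theorem kron_graph {M N M' N' : Mat_ C} (e : M.ι → N.ι) (φ : ∀ i, M.X i ⟶ N.X (e i))
    (e' : M'.ι → N'.ι) (φ' : ∀ i, M'.X i ⟶ N'.X (e' i)) :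
    kron (graph e φ) (graph e' φ') = graph (M := tens M M') (N := tens N N')
      (fun p => (e p.1, e' p.2)) (fun p => φ p.1 ⊗ₘ φ' p.2) := by
  ext ⟨i, i'⟩ ⟨j, j'⟩
  refine Eq.trans (b := graph e φ i j ⊗ₘ graph e' φ' i' j') rfl ?_
  by_cases h : e i = j
  · by_cases h' : e' i' = j'
    · subst h h'
      rw [graph_apply_self, graph_apply_self]
      exact (graph_apply_self (M := tens M M') (N := tens N N') (fun p => (e p.1, e' p.2))
        (fun p => φ p.1 ⊗ₘ φ' p.2) (i, i')).symm
    · rw [graph_apply_ne e' φ' h', MonoidalPreadditive.tensor_zero]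
      exact (graph_apply_ne (M := tens M M') (N := tens N N') (fun p => (e p.1, e' p.2))
        (fun p => φ p.1 ⊗ₘ φ' p.2) (i := (i, i')) (j := (j, j'))
        (fun H => h' (congrArg Prod.snd H))).symm
  · rw [graph_apply_ne e φ h, MonoidalPreadditive.zero_tensor]
    exact (graph_apply_ne (M := tens M M') (N := tens N N') (fun p => (e p.1, e' p.2))
        (fun p => φ p.1 ⊗ₘ φ' p.2) (i := (i, i')) (j := (j, j'))
        (fun H => h (congrArg Prod.fst H))).symm

theorem kron_id (M N : Mat_ C) : kron (𝟙 M) (𝟙 N) = 𝟙 (tens M N) := by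
  rw [id_eq_graph, id_eq_graph, id_eq_graph, kron_graph]
  simp only [id_tensorHom_id]
  rfl

/-- The unit of the additive completion. -/
abbrev unit : Mat_ C := ⟨Unit, fun _ => 𝟙_ C⟩

/-- The associator of the additive completion. -/
def assoc (M N K : Mat_ C) : tens (tens M N) K ≅ tens M (tens N K) :=
  graphIso (M := tens (tens M N) K) (N := tens M (tens N K))
    (Equiv.prodAssoc M.ι N.ι K.ι) fun p => α_ (M.X p.1.1) (N.X p.1.2) (K.X p.2)

/-- The left unitor of the additive completion. -/
def leftU (M : Mat_ C) : tens unit M ≅ M :=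
  graphIso (M := tens unit M) (N := M) (Equiv.punitProd M.ι) fun p => λ_ (M.X p.2)

/-- The right unitor of the additive completion. -/
def rightU (M : Mat_ C) : tens M unit ≅ M :=
  graphIso (M := tens M unit) (N := M) (Equiv.prodPUnit M.ι) fun p => ρ_ (M.X p.1)

theorem assoc_hom (M N K : Mat_ C) : (assoc M N K).hom =
    graph (M := tens (tens M N) K) (N := tens M (tens N K))
      (fun p => (p.1.1, (p.1.2, p.2))) (fun p => (α_ (M.X p.1.1) (N.X p.1.2) (K.X p.2)).hom) :=
  rfl

theorem leftU_hom (M : Mat_ C) : (leftU M).hom =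
    graph (M := tens unit M) (N := M) (fun p => p.2) (fun p => (λ_ (M.X p.2)).hom) := rfl

theorem rightU_hom (M : Mat_ C) : (rightU M).hom =
    graph (M := tens M unit) (N := M) (fun p => p.1) (fun p => (ρ_ (M.X p.1)).hom) := rfl

theorem assoc_nat {X₁ X₂ X₃ Y₁ Y₂ Y₃ : Mat_ C} (f₁ : X₁ ⟶ Y₁) (f₂ : X₂ ⟶ Y₂) (f₃ : X₃ ⟶ Y₃) :
    kron (kron f₁ f₂) f₃ ≫ (assoc Y₁ Y₂ Y₃).hom =
      (assoc X₁ X₂ X₃).hom ≫ kron f₁ (kron f₂ f₃) := by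
  rw [assoc_hom, assoc_hom]
  ext ⟨⟨i₁, i₂⟩, i₃⟩ ⟨j₁, j₂, j₃⟩
  refine Eq.trans ?_ (graph_comp_apply _ _ _ _ _).symm
  refine (comp_graph_apply (M := tens (tens X₁ X₂) X₃) (N := tens (tens Y₁ Y₂) Y₃) (K := tens Y₁ (tens Y₂ Y₃))
    (fun p => (p.1.1, (p.1.2, p.2))) (Equiv.prodAssoc Y₁.ι Y₂.ι Y₃.ι).injective
    (fun p => (α_ (Y₁.X p.1.1) (Y₂.X p.1.2) (Y₃.X p.2)).hom) _ ((i₁, i₂), i₃)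
    ((j₁, j₂), j₃)).trans ?_
  exact MonoidalCategory.associator_naturality _ _ _

theorem leftU_nat {X Y : Mat_ C} (f : X ⟶ Y) :
    kron (𝟙 unit) f ≫ (leftU Y).hom = (leftU X).hom ≫ f := by
  rw [leftU_hom, leftU_hom]
  ext ⟨u, i⟩ j
  refine Eq.trans ?_ (graph_comp_apply _ _ _ _ _).symm
  refine (comp_graph_apply (M := tens unit X) (N := tens unit Y) (K := Y)
    (fun p => p.2) (Equiv.punitProd Y.ι).injective
    (fun p => (λ_ (Y.X p.2)).hom) _ (u, i) (u, j)).trans ?_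
  change ((𝟙 (unit : Mat_ C) : _) u u ⊗ₘ f i j) ≫ (λ_ (Y.X j)).hom = (λ_ (X.X i)).hom ≫ f i j
  rw [Mat_.id_apply_self, id_tensorHom, MonoidalCategory.leftUnitor_naturality]

theorem rightU_nat {X Y : Mat_ C} (f : X ⟶ Y) :
    kron f (𝟙 unit) ≫ (rightU Y).hom = (rightU X).hom ≫ f := by
  rw [rightU_hom, rightU_hom]
  ext ⟨i, u⟩ j
  refine Eq.trans ?_ (graph_comp_apply _ _ _ _ _).symm
  refine (comp_graph_apply (M := tens X unit) (N := tens Y unit) (K := Y)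
    (fun p => p.1) (Equiv.prodPUnit Y.ι).injective
    (fun p => (ρ_ (Y.X p.1)).hom) _ (i, u) (j, u)).trans ?_
  change (f i j ⊗ₘ (𝟙 (unit : Mat_ C) : _) u u) ≫ (ρ_ (Y.X j)).hom = (ρ_ (X.X i)).hom ≫ f i j
  rw [Mat_.id_apply_self, tensorHom_id, MonoidalCategory.rightUnitor_naturality]

theorem mat_pentagon (W X Y Z : Mat_ C) :
    kron (assoc W X Y).hom (𝟙 Z) ≫ (assoc W (tens X Y) Z).hom ≫ kron (𝟙 W) (assoc X Y Z).hom =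
      (assoc (tens W X) Y Z).hom ≫ (assoc W X (tens Y Z)).hom := by
  simp only [assoc_hom, id_eq_graph, kron_graph, graph_comp_graph]
  refine graph_congr fun p => ?_
  simp

theorem mat_triangle (X Y : Mat_ C) :
    (assoc X unit Y).hom ≫ kron (𝟙 X) (leftU Y).hom = kron (rightU X).hom (𝟙 Y) := by
  simp only [assoc_hom, leftU_hom, rightU_hom, id_eq_graph, kron_graph, graph_comp_graph]
  refine graph_congr fun p => ?_
  simp

instance : MonoidalCategoryStruct (Mat_ C) where
  tensorObj := tens
  tensorHom := kron
  whiskerLeft M _ _ f := kron (𝟙 M) f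
  whiskerRight f M := kron f (𝟙 M)
  tensorUnit := unit
  associator := assoc
  leftUnitor := leftU
  rightUnitor := rightU

/-- The tensor product of two families of objects is the family of all tensor products. -/
instance : MonoidalCategory (Mat_ C) :=
  MonoidalCategory.ofTensorHom
    (id_tensorHom_id := kron_id)
    (id_tensorHom := fun _ _ _ _ => rfl)
    (tensorHom_id := fun _ _ => rfl)
    (tensorHom_comp_tensorHom := fun _ _ _ _ => kron_comp _ _ _ _)
    (associator_naturality := assoc_nat)
    (leftUnitor_naturality := leftU_nat)
    (rightUnitor_naturality := rightU_nat)
    (pentagon := mat_pentagon)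
    (triangle := mat_triangle)

theorem kron_add {M N M' N' : Mat_ C} (f : M ⟶ N) (g g' : M' ⟶ N') :
    kron f (g + g') = kron f g + kron f g' := by
  ext i j
  exact MonoidalPreadditive.tensor_add _ _ _

theorem add_kron {M N M' N' : Mat_ C} (f f' : M ⟶ N) (g : M' ⟶ N') :
    kron (f + f') g = kron f g + kron f' g := by
  ext i j
  exact MonoidalPreadditive.add_tensor _ _ _

theorem kron_zero {M N M' N' : Mat_ C} (f : M ⟶ N) :
    kron f (0 : M' ⟶ N') = 0 := by
  ext i j
  exact MonoidalPreadditive.tensor_zero _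

theorem zero_kron {M N M' N' : Mat_ C} (g : M' ⟶ N') :
    kron (0 : M ⟶ N) g = 0 := by
  ext i j
  exact MonoidalPreadditive.zero_tensor _

instance : MonoidalPreadditive (Mat_ C) where
  whiskerLeft_zero := kron_zero _
  zero_whiskerRight := zero_kron _
  whiskerLeft_add _ _ := kron_add _ _ _
  add_whiskerRight _ _ := add_kron _ _ _

instance (k : Type w) [CommRing k] [Linear k C] [MonoidalLinear k C] :
    MonoidalLinear k (Mat_ C) where
  whiskerLeft_smul M N K a f := by
    ext i j
    change (𝟙 M : M ⟶ M) i.1 j.1 ⊗ₘ (a • f i.2 j.2) = a • ((𝟙 M : M ⟶ M) i.1 j.1 ⊗ₘ f i.2 j.2)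
    simp [MonoidalCategory.tensorHom_def]
  smul_whiskerRight a N K f M := by
    ext i j
    change (a • f i.1 j.1) ⊗ₘ (𝟙 M : M ⟶ M) i.2 j.2 = a • (f i.1 j.1 ⊗ₘ (𝟙 M : M ⟶ M) i.2 j.2)
    simp [MonoidalCategory.tensorHom_def]

variable [SymmetricCategory C]

/-- The symmetry of the additive completion. -/
def braid (M N : Mat_ C) : tens M N ≅ tens N M :=
  graphIso (M := tens M N) (N := tens N M) (Equiv.prodComm M.ι N.ι)
    fun p => β_ (M.X p.1) (N.X p.2)

theorem braid_hom (M N : Mat_ C) : (braid M N).hom =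
    graph (M := tens M N) (N := tens N M) (fun p => (p.2, p.1))
      (fun p => (β_ (M.X p.1) (N.X p.2)).hom) := rfl

theorem braid_nat {M N M' N' : Mat_ C} (f : M ⟶ M') (g : N ⟶ N') :
    kron f g ≫ (braid M' N').hom = (braid M N).hom ≫ kron g f := by
  rw [braid_hom, braid_hom]
  ext ⟨i, i'⟩ ⟨j', j⟩
  refine Eq.trans ?_ (graph_comp_apply _ _ _ _ _).symm
  refine (comp_graph_apply (M := tens M N) (N := tens M' N') (K := tens N' M')
    (fun p => (p.2, p.1)) (Equiv.prodComm M'.ι N'.ι).injective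
    (fun p => (β_ (M'.X p.1) (N'.X p.2)).hom) _ (i, i') (j, j')).trans ?_
  exact BraidedCategory.braiding_naturality _ _

theorem mat_symmetry (M N : Mat_ C) : (braid M N).hom ≫ (braid N M).hom = 𝟙 (tens M N) := by
  simp only [braid_hom, id_eq_graph, graph_comp_graph]
  exact graph_congr fun p => SymmetricCategory.symmetry _ _

theorem mat_hexagon (X Y Z : Mat_ C) :
    (assoc X Y Z).hom ≫ (braid X (tens Y Z)).hom ≫ (assoc Y Z X).hom =
      kron (braid X Y).hom (𝟙 Z) ≫ (assoc Y X Z).hom ≫ kron (𝟙 Y) (braid X Z).hom := by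
  simp only [assoc_hom, braid_hom, id_eq_graph, kron_graph, graph_comp_graph]
  refine graph_congr fun p => ?_
  simp

/-- The symmetry of the additive completion is given by the symmetries of the entries. -/
instance : SymmetricCategory (Mat_ C) :=
  symmetricOfHexagon braid (fun M _ _ g => braid_nat (𝟙 M) g)
    (fun f N => braid_nat f (𝟙 N)) mat_hexagon mat_symmetry

end AddCompletion

/-! ### Idempotent completions -/

namespace IdemCompletion

open Idempotents

variable {C : Type u} [Category.{v} C]

instance [Preadditive C] (k : Type w) [CommRing k] [Linear k C] : Linear k (Karoubi C) where
  homModule P Q :=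
    { smul a f := ⟨a • f.f, by
        rw [Linear.smul_comp, Linear.comp_smul, f.comm]⟩
      one_smul f := Karoubi.hom_ext _ _ (one_smul k f.f)
      mul_smul a b f := Karoubi.hom_ext _ _ (mul_smul a b f.f)
      smul_zero a := Karoubi.hom_ext _ _ (smul_zero a)
      smul_add a f g := Karoubi.hom_ext _ _ (smul_add a f.f g.f)
      add_smul a b f := Karoubi.hom_ext _ _ (add_smul a b f.f)
      zero_smul f := Karoubi.hom_ext _ _ (zero_smul k f.f) }
  smul_comp _ _ _ a f g := Karoubi.hom_ext _ _ (Linear.smul_comp _ _ _ a f.f g.f)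
  comp_smul _ _ _ f a g := Karoubi.hom_ext _ _ (Linear.comp_smul _ _ _ f.f a g.f)

variable [MonoidalCategory C]

/-- The tensor product of two idempotents. -/
abbrev tens (P Q : Karoubi C) : Karoubi C where
  X := P.X ⊗ Q.X
  p := P.p ⊗ₘ Q.p
  idem := by rw [tensorHom_comp_tensorHom, P.idem, Q.idem]

/-- The tensor product of two morphisms of idempotents. -/
def tensHom {P Q P' Q' : Karoubi C} (f : P ⟶ P') (g : Q ⟶ Q') : tens P Q ⟶ tens P' Q' where
  f := f.f ⊗ₘ g.f
  comm := by simp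

/-- The unit of the idempotent completion. -/
abbrev unit : Karoubi C where
  X := 𝟙_ C
  p := 𝟙 _
  idem := Category.comp_id _

/-- An isomorphism of underlying objects which is compatible with given idempotents. -/
@[simps]
def isoOf {P Q : Karoubi C} (e : P.X ≅ Q.X) (h : P.p ≫ e.hom = e.hom ≫ Q.p) : P ≅ Q where
  hom := ⟨P.p ≫ e.hom, by rw [Category.assoc, ← h]; simp⟩
  inv := ⟨Q.p ≫ e.inv, by
    have h' : Q.p ≫ e.inv = e.inv ≫ P.p := by rw [Iso.comp_inv_eq, Category.assoc, h]; simp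
    rw [Category.assoc, ← h']; simp⟩
  hom_inv_id := by
    ext
    have h' : Q.p ≫ e.inv = e.inv ≫ P.p := by rw [Iso.comp_inv_eq, Category.assoc, h]; simp
    simp [h']
  inv_hom_id := by
    ext
    simp [h]

theorem assoc_comm (P Q R : Karoubi C) :
    ((P.p ⊗ₘ Q.p) ⊗ₘ R.p) ≫ (α_ P.X Q.X R.X).hom =
      (α_ P.X Q.X R.X).hom ≫ (P.p ⊗ₘ Q.p ⊗ₘ R.p) :=
  MonoidalCategory.associator_naturality _ _ _

theorem leftU_comm (P : Karoubi C) : (𝟙 (𝟙_ C) ⊗ₘ P.p) ≫ (λ_ P.X).hom = (λ_ P.X).hom ≫ P.p := by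
  simp

theorem rightU_comm (P : Karoubi C) : (P.p ⊗ₘ 𝟙 (𝟙_ C)) ≫ (ρ_ P.X).hom = (ρ_ P.X).hom ≫ P.p := by
  simp

theorem idem_assoc_nat {P Q R P' Q' R' : Karoubi C} (f : P ⟶ P') (g : Q ⟶ Q') (h : R ⟶ R') :
    ((f.f ⊗ₘ g.f) ⊗ₘ h.f) ≫ ((P'.p ⊗ₘ Q'.p) ⊗ₘ R'.p) ≫ (α_ P'.X Q'.X R'.X).hom =
      (((P.p ⊗ₘ Q.p) ⊗ₘ R.p) ≫ (α_ P.X Q.X R.X).hom) ≫ (f.f ⊗ₘ g.f ⊗ₘ h.f) := by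
  rw [Category.assoc, ← MonoidalCategory.associator_naturality, tensorHom_comp_tensorHom_assoc,
    tensorHom_comp_tensorHom_assoc, tensorHom_comp_tensorHom, tensorHom_comp_tensorHom]
  simp only [Karoubi.comp_p, Karoubi.p_comp]

theorem idem_leftU_nat {P Q : Karoubi C} (f : P ⟶ Q) :
    (𝟙 (𝟙_ C) ⊗ₘ f.f) ≫ (𝟙 (𝟙_ C) ⊗ₘ Q.p) ≫ (λ_ Q.X).hom =
      ((𝟙 (𝟙_ C) ⊗ₘ P.p) ≫ (λ_ P.X).hom) ≫ f.f := by
  simp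

theorem idem_rightU_nat {P Q : Karoubi C} (f : P ⟶ Q) :
    (f.f ⊗ₘ 𝟙 (𝟙_ C)) ≫ (Q.p ⊗ₘ 𝟙 (𝟙_ C)) ≫ (ρ_ Q.X).hom =
      ((P.p ⊗ₘ 𝟙 (𝟙_ C)) ≫ (ρ_ P.X).hom) ≫ f.f := by
  simp

theorem comp_aux {X Y Z : C} {p : X ⟶ X} {q : Y ⟶ Y} {e : X ⟶ Y} (h : p ≫ e = e ≫ q)
    (hp : p ≫ p = p) (g : Y ⟶ Z) : (p ≫ e) ≫ q ≫ g = p ≫ e ≫ g := by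
  rw [Category.assoc, ← Category.assoc e q g, ← h, Category.assoc, ← Category.assoc p p, hp]

theorem comp_tensor (X Y Z : C) {W : C} (p : X ⟶ Y) (e : Y ⟶ Z) (q : W ⟶ W) :
    (p ≫ e) ⊗ₘ q = (p ⊗ₘ q) ≫ e ▷ W := by
  rw [← tensorHom_id, tensorHom_comp_tensorHom, Category.comp_id]

theorem tensor_comp' (X Y Z : C) {W : C} (p : X ⟶ Y) (e : Y ⟶ Z) (q : W ⟶ W) :
    q ⊗ₘ (p ≫ e) = (q ⊗ₘ p) ≫ W ◁ e := by
  rw [← id_tensorHom, tensorHom_comp_tensorHom, Category.comp_id]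

theorem tensor_idem {X Y : C} {p : X ⟶ X} {q : Y ⟶ Y} (hp : p ≫ p = p) (hq : q ≫ q = q) :
    (p ⊗ₘ q) ≫ (p ⊗ₘ q) = p ⊗ₘ q := by
  rw [tensorHom_comp_tensorHom, hp, hq]

theorem comm_whiskerRight {X Y Z : C} {p : X ⟶ X} {q : Y ⟶ Y} {e : X ⟶ Y}
    (h : p ≫ e = e ≫ q) (r : Z ⟶ Z) : (p ⊗ₘ r) ≫ e ▷ Z = e ▷ Z ≫ (q ⊗ₘ r) := by
  rw [← tensorHom_id, tensorHom_comp_tensorHom, tensorHom_comp_tensorHom, h, Category.comp_id,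
    Category.id_comp]

theorem idem_pentagon (W X Y Z : Karoubi C) :
    ((((W.p ⊗ₘ X.p) ⊗ₘ Y.p) ≫ (α_ W.X X.X Y.X).hom) ⊗ₘ Z.p) ≫
      (((W.p ⊗ₘ (X.p ⊗ₘ Y.p)) ⊗ₘ Z.p) ≫ (α_ W.X (X.X ⊗ Y.X) Z.X).hom) ≫
        (W.p ⊗ₘ (((X.p ⊗ₘ Y.p) ⊗ₘ Z.p) ≫ (α_ X.X Y.X Z.X).hom)) =
      ((((W.p ⊗ₘ X.p) ⊗ₘ Y.p) ⊗ₘ Z.p) ≫ (α_ (W.X ⊗ X.X) Y.X Z.X).hom) ≫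
        (((W.p ⊗ₘ X.p) ⊗ₘ (Y.p ⊗ₘ Z.p)) ≫ (α_ W.X X.X (Y.X ⊗ Z.X)).hom) := by
  have hWX := tensor_idem W.idem X.idem
  have hXY := tensor_idem X.idem Y.idem
  rw [comp_tensor, tensor_comp',
    comp_aux (MonoidalCategory.associator_naturality W.p (X.p ⊗ₘ Y.p) Z.p)
      (tensor_idem (tensor_idem W.idem hXY) Z.idem),
    comp_aux (comm_whiskerRight (assoc_comm W X Y) Z.p)
      (tensor_idem (tensor_idem hWX Y.idem) Z.idem),
    comp_aux (MonoidalCategory.associator_naturality (W.p ⊗ₘ X.p) Y.p Z.p)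
      (tensor_idem (tensor_idem hWX Y.idem) Z.idem),
    MonoidalCategory.pentagon]

theorem idem_triangle (X Y : Karoubi C) :
    (((X.p ⊗ₘ 𝟙 (𝟙_ C)) ⊗ₘ Y.p) ≫ (α_ X.X (𝟙_ C) Y.X).hom) ≫
        (X.p ⊗ₘ ((𝟙 (𝟙_ C) ⊗ₘ Y.p) ≫ (λ_ Y.X).hom)) =
      ((X.p ⊗ₘ 𝟙 (𝟙_ C)) ≫ (ρ_ X.X).hom) ⊗ₘ Y.p := by
  rw [comp_tensor, tensor_comp',
    comp_aux (MonoidalCategory.associator_naturality X.p (𝟙 (𝟙_ C)) Y.p)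
      (tensor_idem (tensor_idem X.idem (Category.id_comp _)) Y.idem),
    MonoidalCategory.triangle]

instance : MonoidalCategoryStruct (Karoubi C) where
  tensorObj := tens
  tensorHom := tensHom
  whiskerLeft P _ _ f := tensHom (𝟙 P) f
  whiskerRight f P := tensHom f (𝟙 P)
  tensorUnit := unit
  associator P Q R := isoOf (α_ P.X Q.X R.X) (assoc_comm P Q R)
  leftUnitor P := isoOf (λ_ P.X) (leftU_comm P)
  rightUnitor P := isoOf (ρ_ P.X) (rightU_comm P)

/-- The tensor product of idempotents makes the idempotent completion a monoidal category. -/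
instance : MonoidalCategory (Karoubi C) :=
  MonoidalCategory.ofTensorHom
    (id_tensorHom_id := fun _ _ => rfl)
    (id_tensorHom := fun _ _ _ _ => rfl)
    (tensorHom_id := fun _ _ => rfl)
    (tensorHom_comp_tensorHom := fun f g f' g' =>
      Karoubi.hom_ext _ _ (MonoidalCategory.tensorHom_comp_tensorHom f.f g.f f'.f g'.f))
    (associator_naturality := fun f g h => Karoubi.hom_ext _ _ (idem_assoc_nat f g h))
    (leftUnitor_naturality := fun f => Karoubi.hom_ext _ _ (idem_leftU_nat f))
    (rightUnitor_naturality := fun f => Karoubi.hom_ext _ _ (idem_rightU_nat f))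
    (pentagon := fun W X Y Z => Karoubi.hom_ext _ _ (idem_pentagon W X Y Z))
    (triangle := fun X Y => Karoubi.hom_ext _ _ (idem_triangle X Y))

theorem whiskerLeft_f (P : Karoubi C) {Q R : Karoubi C} (f : Q ⟶ R) :
    (P ◁ f).f = P.p ⊗ₘ f.f := rfl

theorem whiskerRight_f (P : Karoubi C) {Q R : Karoubi C} (f : Q ⟶ R) :
    (f ▷ P).f = f.f ⊗ₘ P.p := rfl

instance [Preadditive C] [MonoidalPreadditive C] : MonoidalPreadditive (Karoubi C) where
  whiskerLeft_zero := Karoubi.hom_ext _ _ (MonoidalPreadditive.tensor_zero _)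
  zero_whiskerRight := Karoubi.hom_ext _ _ (MonoidalPreadditive.zero_tensor _)
  whiskerLeft_add _ _ := Karoubi.hom_ext _ _ (MonoidalPreadditive.tensor_add _ _ _)
  add_whiskerRight _ _ := Karoubi.hom_ext _ _ (MonoidalPreadditive.add_tensor _ _ _)

instance [Preadditive C] [MonoidalPreadditive C] (k : Type w) [CommRing k] [Linear k C]
    [MonoidalLinear k C] : MonoidalLinear k (Karoubi C) where
  whiskerLeft_smul P _ _ a f := Karoubi.hom_ext _ _ (by
    change P.p ⊗ₘ (a • f.f) = a • (P.p ⊗ₘ f.f)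
    simp [MonoidalCategory.tensorHom_def])
  smul_whiskerRight a _ _ f P := Karoubi.hom_ext _ _ (by
    change (a • f.f) ⊗ₘ P.p = a • (f.f ⊗ₘ P.p)
    simp [MonoidalCategory.tensorHom_def])

variable [SymmetricCategory C]

theorem idem_braid_nat {P Q P' Q' : Karoubi C} (f : P ⟶ P') (g : Q ⟶ Q') :
    (f.f ⊗ₘ g.f) ≫ (P'.p ⊗ₘ Q'.p) ≫ (β_ P'.X Q'.X).hom =
      ((P.p ⊗ₘ Q.p) ≫ (β_ P.X Q.X).hom) ≫ (g.f ⊗ₘ f.f) := by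
  rw [Category.assoc, ← BraidedCategory.braiding_naturality, tensorHom_comp_tensorHom_assoc,
    tensorHom_comp_tensorHom_assoc]
  simp

theorem idem_hexagon (P Q R : Karoubi C) :
    (((P.p ⊗ₘ Q.p) ⊗ₘ R.p) ≫ (α_ P.X Q.X R.X).hom) ≫
      ((P.p ⊗ₘ Q.p ⊗ₘ R.p) ≫ (β_ P.X (Q.X ⊗ R.X)).hom) ≫
        (((Q.p ⊗ₘ R.p) ⊗ₘ P.p) ≫ (α_ Q.X R.X P.X).hom) =
      (((P.p ⊗ₘ Q.p) ≫ (β_ P.X Q.X).hom) ⊗ₘ R.p) ≫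
        (((Q.p ⊗ₘ P.p) ⊗ₘ R.p) ≫ (α_ Q.X P.X R.X).hom) ≫
          (Q.p ⊗ₘ ((P.p ⊗ₘ R.p) ≫ (β_ P.X R.X).hom)) := by
  have hQR := tensor_idem Q.idem R.idem
  have hPQ := tensor_idem P.idem Q.idem
  have hQP := tensor_idem Q.idem P.idem
  rw [comp_tensor, tensor_comp',
    comp_aux (BraidedCategory.braiding_naturality P.p (Q.p ⊗ₘ R.p)) (tensor_idem P.idem hQR),
    comp_aux (assoc_comm P Q R) (tensor_idem hPQ R.idem),
    comp_aux (assoc_comm Q P R) (tensor_idem hQP R.idem),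
    comp_aux (comm_whiskerRight (BraidedCategory.braiding_naturality P.p Q.p) R.p)
      (tensor_idem hPQ R.idem),
    BraidedCategory.hexagon_forward]

theorem idem_symmetry (P Q : Karoubi C) :
    ((P.p ⊗ₘ Q.p) ≫ (β_ P.X Q.X).hom) ≫ (Q.p ⊗ₘ P.p) ≫ (β_ Q.X P.X).hom = P.p ⊗ₘ Q.p := by
  rw [comp_aux (BraidedCategory.braiding_naturality P.p Q.p) (tensor_idem P.idem Q.idem),
    SymmetricCategory.symmetry, Category.comp_id]

instance : SymmetricCategory (Karoubi C) :=
  symmetricOfHexagon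
    (fun P Q => isoOf (β_ P.X Q.X) (BraidedCategory.braiding_naturality P.p Q.p))
    (fun P _ _ f => Karoubi.hom_ext _ _ (idem_braid_nat (𝟙 P) f))
    (fun f P => Karoubi.hom_ext _ _ (idem_braid_nat f (𝟙 P)))
    (fun P Q R => Karoubi.hom_ext _ _ (idem_hexagon P Q R))
    (fun P Q => Karoubi.hom_ext _ _ (idem_symmetry P Q))

end IdemCompletion

/-! ### 2-ideals and quotients -/

open Limits

attribute [local instance] hasBinaryBiproducts_of_finite_biproducts

/-- A 2-ideal: a full subcategory which is closed under finite biproducts (including the empty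
one), isomorphisms, retracts, and tensoring with arbitrary objects. -/
structure TwoIdeal (R : Type u) [Category.{v} R] [Preadditive R] [HasFiniteBiproducts R]
    [MonoidalCategory R] where
  mem : ObjectProperty R
  zero_mem : ∀ Z : R, IsZero Z → mem Z
  biprod_mem : ∀ X Y : R, mem X → mem Y → mem (X ⊞ Y)
  iso_mem : ∀ X Y : R, (X ≅ Y) → mem X → mem Y
  retract_mem : ∀ X Y : R, Retract X Y → mem Y → mem X
  tensor_mem : ∀ X Y : R, mem X → mem (X ⊗ Y)

namespace TwoIdeal

variable {R : Type u} [Category.{v} R] [Preadditive R] [HasFiniteBiproducts R]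
  [MonoidalCategory R]

/-- The 2-ideal generated by a class of objects: the smallest 2-ideal containing them. -/
def span (P : ObjectProperty R) : TwoIdeal R where
  mem X := ∀ I : TwoIdeal R, (∀ Y, P Y → I.mem Y) → I.mem X
  zero_mem Z hZ I _ := I.zero_mem Z hZ
  biprod_mem X Y hX hY I hI := I.biprod_mem X Y (hX I hI) (hY I hI)
  iso_mem X Y e hX I hI := I.iso_mem X Y e (hX I hI)
  retract_mem X Y r hY I hI := I.retract_mem X Y r (hY I hI)
  tensor_mem X Y hX I hI := I.tensor_mem X Y (hX I hI)

variable (I : TwoIdeal R)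

/-- Two parallel morphisms are equivalent if their difference factors through an object of
the 2-ideal. -/
def rel : HomRel R := fun X Y f g =>
  ∃ J : R, I.mem J ∧ ∃ (a : X ⟶ J) (b : J ⟶ Y), a ≫ b = f - g

variable {I}

theorem rel_refl {X Y : R} (f : X ⟶ Y) : I.rel f f :=
  ⟨_, I.zero_mem _ (isZero_zero R), 0, 0, by simp⟩

theorem rel_add {X Y : R} {f f' g g' : X ⟶ Y} (h : I.rel f f') (h' : I.rel g g') :
    I.rel (f + g) (f' + g') := by
  obtain ⟨J, hJ, a, b, e⟩ := h
  obtain ⟨J', hJ', a', b', e'⟩ := h'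
  refine ⟨J ⊞ J', I.biprod_mem J J' hJ hJ', biprod.lift a a', biprod.desc b b', ?_⟩
  rw [biprod.lift_desc, e, e']
  abel

theorem rel_symm {X Y : R} {f g : X ⟶ Y} (h : I.rel f g) : I.rel g f := by
  obtain ⟨J, hJ, a, b, e⟩ := h
  exact ⟨J, hJ, -a, b, by rw [Preadditive.neg_comp, e, neg_sub]⟩

theorem rel_trans {X Y : R} {f g h : X ⟶ Y} (h₁ : I.rel f g) (h₂ : I.rel g h) : I.rel f h := by
  obtain ⟨J, hJ, a, b, e⟩ := h₁
  obtain ⟨J', hJ', a', b', e'⟩ := h₂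
  refine ⟨J ⊞ J', I.biprod_mem J J' hJ hJ', biprod.lift a a', biprod.desc b b', ?_⟩
  rw [biprod.lift_desc, e, e']
  abel

theorem rel_smul {k : Type w} [CommRing k] [Linear k R] (c : k) {X Y : R} {f g : X ⟶ Y}
    (h : I.rel f g) : I.rel (c • f) (c • g) := by
  obtain ⟨J, hJ, a, b, e⟩ := h
  exact ⟨J, hJ, c • a, b, by rw [Linear.smul_comp, e, smul_sub]⟩

instance : Congruence I.rel where
  comp_left := by
    rintro X Y Z f g g' ⟨J, hJ, a, b, e⟩
    exact ⟨J, hJ, f ≫ a, b, by rw [Category.assoc, e, Preadditive.comp_sub]⟩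
  comp_right := by
    rintro X Y Z f f' g ⟨J, hJ, a, b, e⟩
    exact ⟨J, hJ, a, b ≫ g, by rw [← Category.assoc, e, Preadditive.sub_comp]⟩
  equivalence := ⟨rel_refl, rel_symm, rel_trans⟩

instance : Preadditive (CategoryTheory.Quotient I.rel) :=
  CategoryTheory.Quotient.preadditive I.rel fun _ _ _ _ _ _ => rel_add

instance : (CategoryTheory.Quotient.functor I.rel).Additive := CategoryTheory.Quotient.functor_additive I.rel _

instance (k : Type w) [CommRing k] [Linear k R] : Linear k (CategoryTheory.Quotient I.rel) :=
  CategoryTheory.Quotient.linear k I.rel fun c _ _ _ _ => rel_smul c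

instance (k : Type w) [CommRing k] [Linear k R] : (CategoryTheory.Quotient.functor I.rel).Linear k :=
  CategoryTheory.Quotient.linear_functor k I.rel _

variable [MonoidalPreadditive R]

theorem rel_whiskerRight {X Y : R} {f g : X ⟶ Y} (h : I.rel f g) (Z : R) :
    I.rel (f ▷ Z) (g ▷ Z) := by
  obtain ⟨J, hJ, a, b, e⟩ := h
  refine ⟨J ⊗ Z, I.tensor_mem J Z hJ, a ▷ Z, b ▷ Z, ?_⟩
  rw [← comp_whiskerRight, e]
  exact ((tensorRight Z).map_sub)

variable [SymmetricCategory R]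

theorem rel_whiskerLeft (Z : R) {X Y : R} {f g : X ⟶ Y} (h : I.rel f g) :
    I.rel (Z ◁ f) (Z ◁ g) := by
  obtain ⟨J, hJ, a, b, e⟩ := h
  refine ⟨Z ⊗ J, I.iso_mem _ _ (β_ J Z) (I.tensor_mem J Z hJ), Z ◁ a, Z ◁ b, ?_⟩
  rw [← whiskerLeft_comp, e]
  exact ((tensorLeft Z).map_sub)

/-- Whiskering on the quotient by a 2-ideal. -/
def whiskL (Z : R) {X Y : R} :
    ((CategoryTheory.Quotient.functor I.rel).obj X ⟶ (CategoryTheory.Quotient.functor I.rel).obj Y) →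
      ((CategoryTheory.Quotient.functor I.rel).obj (Z ⊗ X) ⟶ (CategoryTheory.Quotient.functor I.rel).obj (Z ⊗ Y)) :=
  (CategoryTheory.Quotient.lift I.rel (tensorLeft Z ⋙ CategoryTheory.Quotient.functor I.rel)
    fun _ _ _ _ h => CategoryTheory.Quotient.sound _ (rel_whiskerLeft Z h)).map

/-- Whiskering on the quotient by a 2-ideal. -/
def whiskR (Z : R) {X Y : R} :
    ((CategoryTheory.Quotient.functor I.rel).obj X ⟶ (CategoryTheory.Quotient.functor I.rel).obj Y) →
      ((CategoryTheory.Quotient.functor I.rel).obj (X ⊗ Z) ⟶ (CategoryTheory.Quotient.functor I.rel).obj (Y ⊗ Z)) :=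
  (CategoryTheory.Quotient.lift I.rel (tensorRight Z ⋙ CategoryTheory.Quotient.functor I.rel)
    fun _ _ _ _ h => CategoryTheory.Quotient.sound _ (rel_whiskerRight h Z)).map

instance : MonoidalCategoryStruct (CategoryTheory.Quotient I.rel) where
  tensorObj X Y := (CategoryTheory.Quotient.functor I.rel).obj (X.as ⊗ Y.as)
  whiskerLeft Z _ _ f := whiskL Z.as f
  whiskerRight f Z := whiskR Z.as f
  tensorUnit := (CategoryTheory.Quotient.functor I.rel).obj (𝟙_ R)
  associator X Y Z := (CategoryTheory.Quotient.functor I.rel).mapIso (α_ X.as Y.as Z.as)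
  leftUnitor X := (CategoryTheory.Quotient.functor I.rel).mapIso (λ_ X.as)
  rightUnitor X := (CategoryTheory.Quotient.functor I.rel).mapIso (ρ_ X.as)

/-- The tensor product of the quotient by a 2-ideal is induced by the one of the given
category. -/
instance : MonoidalCategory (CategoryTheory.Quotient I.rel) :=
  monoidalOfWhisker
    (tensorHom_def := fun _ _ => rfl)
    (whiskerLeft_id := fun X Y =>
      congrArg (CategoryTheory.Quotient.functor I.rel).map (MonoidalCategory.whiskerLeft_id X.as Y.as))
    (id_whiskerRight := fun X Y =>
      congrArg (CategoryTheory.Quotient.functor I.rel).map (MonoidalCategory.id_whiskerRight X.as Y.as))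
    (whiskerLeft_comp := by
      rintro X Y Z W ⟨f⟩ ⟨g⟩
      exact congrArg (CategoryTheory.Quotient.functor I.rel).map (MonoidalCategory.whiskerLeft_comp X.as f g))
    (comp_whiskerRight := by
      rintro X Y Z W ⟨f⟩ ⟨g⟩
      exact congrArg (CategoryTheory.Quotient.functor I.rel).map (MonoidalCategory.comp_whiskerRight f g X.as))
    (exchange := by
      rintro X Y Z W ⟨f⟩ ⟨g⟩
      exact congrArg (CategoryTheory.Quotient.functor I.rel).map (MonoidalCategory.whisker_exchange f g).symm)
    (assoc_left := by
      rintro X X' Y Z ⟨f⟩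
      exact congrArg (CategoryTheory.Quotient.functor I.rel).map
        (MonoidalCategory.associator_naturality_left f Y.as Z.as))
    (assoc_mid := by
      rintro X Y Y' Z ⟨f⟩
      exact congrArg (CategoryTheory.Quotient.functor I.rel).map
        (MonoidalCategory.associator_naturality_middle X.as f Z.as))
    (assoc_right := by
      rintro X Y Z Z' ⟨f⟩
      exact congrArg (CategoryTheory.Quotient.functor I.rel).map
        (MonoidalCategory.associator_naturality_right X.as Y.as f))
    (leftUnitor_naturality := by
      rintro X Y ⟨f⟩
      exact congrArg (CategoryTheory.Quotient.functor I.rel).map (MonoidalCategory.leftUnitor_naturality f))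
    (rightUnitor_naturality := by
      rintro X Y ⟨f⟩
      exact congrArg (CategoryTheory.Quotient.functor I.rel).map (MonoidalCategory.rightUnitor_naturality f))
    (pentagon := fun W X Y Z =>
      congrArg (CategoryTheory.Quotient.functor I.rel).map (MonoidalCategory.pentagon W.as X.as Y.as Z.as))
    (triangle := fun X Y =>
      congrArg (CategoryTheory.Quotient.functor I.rel).map (MonoidalCategory.triangle X.as Y.as))

instance : MonoidalPreadditive (CategoryTheory.Quotient I.rel) where
  whiskerLeft_zero {X Y Z} :=
    congrArg (CategoryTheory.Quotient.functor I.rel).map (MonoidalPreadditive.whiskerLeft_zero (X := X.as))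
  zero_whiskerRight {X Y Z} :=
    congrArg (CategoryTheory.Quotient.functor I.rel).map (MonoidalPreadditive.zero_whiskerRight (X := X.as))
  whiskerLeft_add := by
    rintro X Y Z ⟨f⟩ ⟨g⟩
    exact congrArg (CategoryTheory.Quotient.functor I.rel).map (MonoidalPreadditive.whiskerLeft_add f g)
  add_whiskerRight := by
    rintro X Y Z ⟨f⟩ ⟨g⟩
    exact congrArg (CategoryTheory.Quotient.functor I.rel).map (MonoidalPreadditive.add_whiskerRight f g)

instance (k : Type w) [CommRing k] [Linear k R] [MonoidalLinear k R] :
    MonoidalLinear k (CategoryTheory.Quotient I.rel) where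
  whiskerLeft_smul := by
    rintro X Y Z a ⟨f⟩
    exact congrArg (CategoryTheory.Quotient.functor I.rel).map (MonoidalLinear.whiskerLeft_smul X.as a f)
  smul_whiskerRight := by
    rintro a Y Z ⟨f⟩ X
    exact congrArg (CategoryTheory.Quotient.functor I.rel).map (MonoidalLinear.smul_whiskerRight a f X.as)

instance : SymmetricCategory (CategoryTheory.Quotient I.rel) :=
  symmetricOfHexagon (fun X Y => (CategoryTheory.Quotient.functor I.rel).mapIso (β_ X.as Y.as))
    (by
      rintro X Y Z ⟨f⟩
      exact congrArg (CategoryTheory.Quotient.functor I.rel).map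
        (BraidedCategory.braiding_naturality_right X.as f))
    (by
      rintro X Y ⟨f⟩ Z
      exact congrArg (CategoryTheory.Quotient.functor I.rel).map
        (BraidedCategory.braiding_naturality_left f Z.as))
    (fun X Y Z => congrArg (CategoryTheory.Quotient.functor I.rel).map
      (BraidedCategory.hexagon_forward X.as Y.as Z.as))
    (fun X Y => congrArg (CategoryTheory.Quotient.functor I.rel).map
      (SymmetricCategory.symmetry X.as Y.as))

end TwoIdeal

/-! ### Exterior powers -/

section TensorPower

variable {R : Type u} [Category.{v} R] [MonoidalCategory R]

/-- The tensor power `r ⊗ (r ⊗ (⋯ ⊗ 𝟙))`. -/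
@[reducible] def tensorPow (r : R) : ℕ → R
  | 0 => 𝟙_ R
  | m + 1 => r ⊗ tensorPow r m

variable [SymmetricCategory R]

/-- The symmetry of `r`, acting on the first two factors of `r ⊗ (r ⊗ W)`. -/
def swapHead (r W : R) : r ⊗ (r ⊗ W) ⟶ r ⊗ (r ⊗ W) :=
  (α_ r r W).inv ≫ (β_ r r).hom ▷ W ≫ (α_ r r W).hom

/-- The endomorphism of `r ⊗ r ^ ⊗ m` which moves the first factor to position `p`, past `p`
other factors. -/
def moveHead (r : R) : (m : ℕ) → Fin (m + 1) → (tensorPow r (m + 1) ⟶ tensorPow r (m + 1))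
  | 0, _ => 𝟙 _
  | m + 1, p => Fin.cases (𝟙 _) (fun q => swapHead r (tensorPow r m) ≫ r ◁ moveHead r m q) p

/-- The permutation of `Fin m` which remains when `0` is removed from the source and `σ 0` is
removed from the target of a permutation `σ` of `Fin (m + 1)`. -/
def permTail {m : ℕ} (σ : Equiv.Perm (Fin (m + 1))) : Equiv.Perm (Fin m) :=
  (Equiv.Perm.decomposeFin ((σ 0).cycleRange * σ)).2

/-- The action of a permutation on a tensor power: the factor in position `i` is moved to
position `σ i`. -/
def permAct (r : R) : (m : ℕ) → Equiv.Perm (Fin m) → (tensorPow r m ⟶ tensorPow r m)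
  | 0, _ => 𝟙 _
  | m + 1, σ => r ◁ permAct r m (permTail σ) ≫ moveHead r m (σ 0)

/-- The symmetry acting on the factors in positions `i` and `i + 1`. -/
def adjSwap (r : R) : (m : ℕ) → Fin m → (tensorPow r (m + 1) ⟶ tensorPow r (m + 1))
  | 0, _ => 𝟙 _
  | m + 1, i => Fin.cases (swapHead r (tensorPow r m)) (fun j => r ◁ adjSwap r m j) i

theorem swapHead_sq (r W : R) : swapHead r W ≫ swapHead r W = 𝟙 _ := by
  simp only [swapHead, Category.assoc, Iso.hom_inv_id_assoc]
  rw [← comp_whiskerRight_assoc, SymmetricCategory.symmetry]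
  simp

theorem swapHead_nat (r : R) {W W' : R} (f : W ⟶ W') :
    swapHead r W ≫ r ◁ r ◁ f = r ◁ r ◁ f ≫ swapHead r W' := by
  simp only [swapHead, Category.assoc]
  rw [← associator_naturality_right, ← whisker_exchange_assoc, associator_inv_naturality_right_assoc]

theorem swapHead_braid (r W : R) :
    swapHead r (r ⊗ W) ≫ r ◁ swapHead r W ≫ swapHead r (r ⊗ W) =
      r ◁ swapHead r W ≫ swapHead r (r ⊗ W) ≫ r ◁ swapHead r W := by
  have h := congrArg (fun f => f ▷ W) (BraidedCategory.yang_baxter' r r r)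
  calc
    _ = 𝟙 _ ⊗≫ (((β_ r r).hom ▷ r ⊗≫ r ◁ (β_ r r).hom ⊗≫ (β_ r r).hom ▷ r) ▷ W) ⊗≫ 𝟙 _ := by
      simp only [swapHead]
      monoidal
    _ = _ := by
      rw [h]
      simp only [swapHead]
      monoidal

theorem moveHead_zero (r : R) (m : ℕ) : moveHead r m 0 = 𝟙 _ := by
  cases m <;> rfl

theorem moveHead_succ (r : R) (m : ℕ) (p : Fin (m + 1)) :
    moveHead r (m + 1) p.succ = swapHead r (tensorPow r m) ≫ r ◁ moveHead r m p := rfl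

theorem adjSwap_zero (r : R) (m : ℕ) :
    adjSwap r (m + 1) 0 = swapHead r (tensorPow r m) := rfl

theorem adjSwap_succ (r : R) (m : ℕ) (i : Fin m) :
    adjSwap r (m + 1) i.succ = r ◁ adjSwap r m i := rfl

theorem adjSwap_sq (r : R) (m : ℕ) (i : Fin m) : adjSwap r m i ≫ adjSwap r m i = 𝟙 _ := by
  induction m with
  | zero => exact i.elim0
  | succ m ih =>
    cases i using Fin.cases with
    | zero => exact swapHead_sq _ _
    | succ i =>
      rw [adjSwap_succ, ← whiskerLeft_comp, ih]
      exact whiskerLeft_id _ _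

/-- Moving the head one step further. -/
theorem moveHead_adjSwap_eq (r : R) (m : ℕ) (i : Fin m) :
    moveHead r m i.castSucc ≫ adjSwap r m i = moveHead r m i.succ := by
  induction m with
  | zero => exact i.elim0
  | succ m ih =>
    cases i using Fin.cases with
    | zero =>
      rw [Fin.castSucc_zero, moveHead_zero, Category.id_comp, adjSwap_zero, moveHead_succ,
        moveHead_zero]
      simp
    | succ i =>
      rw [← Fin.succ_castSucc, moveHead_succ, adjSwap_succ, moveHead_succ, Category.assoc,
        ← whiskerLeft_comp, ih]

theorem moveHead_adjSwap_eq' (r : R) (m : ℕ) (i : Fin m) :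
    moveHead r m i.succ ≫ adjSwap r m i = moveHead r m i.castSucc := by
  rw [← moveHead_adjSwap_eq, Category.assoc, adjSwap_sq, Category.comp_id]

/-- Adjacent transpositions behind the new position of the head. -/
theorem moveHead_adjSwap_lt (r : R) (m : ℕ) (p : Fin (m + 2)) (i : Fin m)
    (h : p.val < i.val + 1) :
    moveHead r (m + 1) p ≫ adjSwap r (m + 1) i.succ =
      r ◁ adjSwap r m i ≫ moveHead r (m + 1) p := by
  induction m with
  | zero => exact i.elim0
  | succ m ih =>
    cases p using Fin.cases with
    | zero => rw [moveHead_zero, Category.id_comp, adjSwap_succ]; exact (Category.comp_id _).symm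
    | succ p =>
      cases i using Fin.cases with
      | zero => simp at h
      | succ i =>
        rw [moveHead_succ, adjSwap_succ, Category.assoc, ← whiskerLeft_comp,
          ih p i (by simpa using h), whiskerLeft_comp, adjSwap_succ, ← Category.assoc,
          ← Category.assoc]
        congr 1
        exact swapHead_nat r _

/-- Adjacent transpositions before the new position of the head. -/
theorem moveHead_adjSwap_gt (r : R) (m : ℕ) (p : Fin (m + 2)) (i : Fin m)
    (h : i.val + 1 < p.val) :
    moveHead r (m + 1) p ≫ adjSwap r (m + 1) i.castSucc =
      r ◁ adjSwap r m i ≫ moveHead r (m + 1) p := by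
  induction m with
  | zero => exact i.elim0
  | succ m ih =>
    cases p using Fin.cases with
    | zero => simp at h
    | succ p =>
      cases i using Fin.cases with
      | zero =>
        cases p using Fin.cases with
        | zero => simp at h
        | succ p =>
          rw [Fin.castSucc_zero, moveHead_succ, moveHead_succ, adjSwap_zero, adjSwap_zero]
          simp only [whiskerLeft_comp, Category.assoc]
          have h1 := swapHead_nat r (moveHead r m p)
          have h2 := swapHead_braid r (tensorPow r m)
          rw [← h1]
          simp only [← Category.assoc] at h2 ⊢
          rw [h2]
      | succ i =>
        rw [← Fin.succ_castSucc, moveHead_succ, adjSwap_succ, Category.assoc, ← whiskerLeft_comp,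
          ih p i (by simpa using h), whiskerLeft_comp, adjSwap_succ, ← Category.assoc,
          ← Category.assoc]
        congr 1
        exact swapHead_nat r _

/-- The permutation which moves `0` to position `p` and keeps the order of all other elements. -/
def movePerm {m : ℕ} (p : Fin (m + 1)) : Equiv.Perm (Fin (m + 1)) := p.cycleRange⁻¹

/-- A permutation of `Fin m`, acting on the successors in `Fin (m + 1)`. -/
def succPerm {m : ℕ} (τ : Equiv.Perm (Fin m)) : Equiv.Perm (Fin (m + 1)) :=
  Equiv.Perm.decomposeFin.symm (0, τ)

theorem movePerm_zero {m : ℕ} (p : Fin (m + 1)) : movePerm p 0 = p := Fin.cycleRange_symm_zero p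

theorem movePerm_succ {m : ℕ} (p : Fin (m + 1)) (i : Fin m) :
    movePerm p i.succ = p.succAbove i := by
  cases m with
  | zero => exact i.elim0
  | succ m => exact Fin.cycleRange_symm_succ p i

theorem succPerm_zero {m : ℕ} (τ : Equiv.Perm (Fin m)) : succPerm τ 0 = 0 := by
  simp [succPerm]

theorem succPerm_succ {m : ℕ} (τ : Equiv.Perm (Fin m)) (i : Fin m) :
    succPerm τ i.succ = (τ i).succ := by
  simp [succPerm]

theorem eq_movePerm_mul {m : ℕ} (σ : Equiv.Perm (Fin (m + 1))) :
    σ = movePerm (σ 0) * succPerm (permTail σ) := by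
  have h : (Equiv.Perm.decomposeFin ((σ 0).cycleRange * σ)).1 = 0 := by
    have h' := Equiv.Perm.decomposeFin_symm_apply_zero
      (Equiv.Perm.decomposeFin ((σ 0).cycleRange * σ)).1
      (Equiv.Perm.decomposeFin ((σ 0).cycleRange * σ)).2
    rw [Prod.mk.eta, Equiv.symm_apply_apply] at h'
    rw [← h', Equiv.Perm.mul_apply, Fin.cycleRange_self]
  have h2 : succPerm (permTail σ) = (σ 0).cycleRange * σ := by
    rw [succPerm, permTail, Equiv.symm_apply_eq]
    exact Prod.ext h.symm rfl
  rw [h2, movePerm, inv_mul_cancel_left]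

theorem movePerm_mul_zero {m : ℕ} (p : Fin (m + 1)) (τ : Equiv.Perm (Fin m)) :
    (movePerm p * succPerm τ) 0 = p := by
  rw [Equiv.Perm.mul_apply, succPerm_zero, movePerm_zero]

theorem permTail_movePerm_mul {m : ℕ} (p : Fin (m + 1)) (τ : Equiv.Perm (Fin m)) :
    permTail (movePerm p * succPerm τ) = τ := by
  rw [permTail, movePerm_mul_zero, movePerm, mul_inv_cancel_left, succPerm,
    Equiv.apply_symm_apply]

theorem permAct_move (r : R) (m : ℕ) (p : Fin (m + 1)) (τ : Equiv.Perm (Fin m)) :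
    permAct r (m + 1) (movePerm p * succPerm τ) = r ◁ permAct r m τ ≫ moveHead r m p := by
  rw [permAct, permTail_movePerm_mul, movePerm_mul_zero]

theorem swap_movePerm_eq {m : ℕ} (i : Fin m) :
    Equiv.swap i.castSucc i.succ * movePerm i.castSucc = movePerm i.succ := by
  ext j
  cases j using Fin.cases with
  | zero => simp [movePerm_zero]
  | succ j =>
    rw [Equiv.Perm.mul_apply, movePerm_succ, movePerm_succ, Equiv.swap_apply_def]
    simp only [Fin.succAbove, Fin.lt_def, Fin.ext_iff, Fin.val_castSucc, Fin.val_succ]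
    split_ifs <;> simp only [Fin.val_castSucc, Fin.val_succ] at * <;> omega

theorem swap_movePerm_lt {m : ℕ} (p : Fin (m + 2)) (i : Fin m) (h : p.val < i.val + 1) :
    Equiv.swap i.succ.castSucc i.succ.succ * movePerm p =
      movePerm p * succPerm (Equiv.swap i.castSucc i.succ) := by
  ext j
  cases j using Fin.cases with
  | zero =>
    rw [movePerm_mul_zero, Equiv.Perm.mul_apply, movePerm_zero, Equiv.swap_apply_of_ne_of_ne]
    · simp only [ne_eq, Fin.ext_iff, Fin.val_castSucc, Fin.val_succ]; omega
    · simp only [ne_eq, Fin.ext_iff, Fin.val_succ]; omega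
  | succ j =>
    rw [Equiv.Perm.mul_apply, Equiv.Perm.mul_apply, succPerm_succ, movePerm_succ, movePerm_succ,
      Equiv.swap_apply_def, Equiv.swap_apply_def]
    simp only [Fin.succAbove, Fin.lt_def, Fin.ext_iff, Fin.val_castSucc, Fin.val_succ]
    split_ifs <;> simp only [Fin.val_castSucc, Fin.val_succ] at * <;> omega

theorem swap_movePerm_gt {m : ℕ} (p : Fin (m + 2)) (i : Fin m) (h : i.val + 1 < p.val) :
    Equiv.swap i.castSucc.castSucc i.castSucc.succ * movePerm p =
      movePerm p * succPerm (Equiv.swap i.castSucc i.succ) := by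
  ext j
  cases j using Fin.cases with
  | zero =>
    rw [movePerm_mul_zero, Equiv.Perm.mul_apply, movePerm_zero, Equiv.swap_apply_of_ne_of_ne]
    · simp only [ne_eq, Fin.ext_iff, Fin.val_castSucc]; omega
    · simp only [ne_eq, Fin.ext_iff, Fin.val_castSucc, Fin.val_succ]; omega
  | succ j =>
    rw [Equiv.Perm.mul_apply, Equiv.Perm.mul_apply, succPerm_succ, movePerm_succ, movePerm_succ,
      Equiv.swap_apply_def, Equiv.swap_apply_def]
    simp only [Fin.succAbove, Fin.lt_def, Fin.ext_iff, Fin.val_castSucc, Fin.val_succ]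
    split_ifs <;> simp only [Fin.val_castSucc, Fin.val_succ] at * <;> omega

theorem succPerm_mul {m : ℕ} (σ τ : Equiv.Perm (Fin m)) :
    succPerm (σ * τ) = succPerm σ * succPerm τ := by
  ext j
  cases j using Fin.cases with
  | zero => simp [succPerm_zero]
  | succ j => simp [succPerm_succ]

theorem permAct_swap_mul (r : R) (m : ℕ) (i : Fin m) (σ : Equiv.Perm (Fin (m + 1))) :
    permAct r (m + 1) (Equiv.swap i.castSucc i.succ * σ) = permAct r (m + 1) σ ≫ adjSwap r m i := by
  induction m with
  | zero => exact i.elim0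
  | succ m ih =>
    rw [eq_movePerm_mul σ]
    generalize σ 0 = p
    generalize permTail σ = τ
    rw [permAct_move]
    rcases lt_trichotomy p.val i.val with h | h | h
    · obtain ⟨i, rfl⟩ : ∃ i', i = Fin.succ i' := ⟨i.pred (by rintro rfl; simp at h), by simp⟩
      rw [← mul_assoc, swap_movePerm_lt p i (by simpa using h), mul_assoc, ← succPerm_mul,
        permAct_move, ih, Category.assoc, moveHead_adjSwap_lt r m p i (by simpa using h),
        whiskerLeft_comp, Category.assoc]
    · obtain rfl : p = i.castSucc := Fin.ext h
      rw [← mul_assoc, swap_movePerm_eq, permAct_move, Category.assoc, moveHead_adjSwap_eq]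
    · by_cases h' : p.val = i.val + 1
      · obtain rfl : p = i.succ := Fin.ext h'
        rw [← swap_movePerm_eq, ← mul_assoc, ← mul_assoc, Equiv.swap_mul_self, one_mul,
          permAct_move, Category.assoc, moveHead_adjSwap_eq']
      · have hi : i.val < m := by omega
        obtain ⟨i, rfl⟩ : ∃ i', i = Fin.castSucc i' := ⟨⟨i, hi⟩, rfl⟩
        have h2 : i.val + 1 < p.val := by simp at h h'; omega
        rw [← mul_assoc, swap_movePerm_gt p i h2, mul_assoc, ← succPerm_mul,
          permAct_move, ih, Category.assoc, moveHead_adjSwap_gt r m p i h2,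
          whiskerLeft_comp, Category.assoc]

theorem permAct_one (r : R) (m : ℕ) : permAct r m 1 = 𝟙 _ := by
  induction m with
  | zero => rfl
  | succ m ih =>
    have h : (1 : Equiv.Perm (Fin (m + 1))) = movePerm 0 * succPerm 1 := by
      ext j
      cases j using Fin.cases with
      | zero => simp [movePerm_zero, succPerm_zero]
      | succ j => simp [movePerm_succ, succPerm_succ]
    rw [h, permAct_move, ih, moveHead_zero]
    simp

/-- Permutations act on tensor powers. -/
theorem permAct_mul (r : R) (m : ℕ) (σ τ : Equiv.Perm (Fin m)) :
    permAct r m (σ * τ) = permAct r m τ ≫ permAct r m σ := by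
  cases m with
  | zero => exact (Category.comp_id _).symm
  | succ m =>
    have hσ : σ ∈ Submonoid.closure
        (Set.range fun i : Fin m => Equiv.swap i.castSucc i.succ) := by
      rw [Equiv.Perm.mclosure_swap_castSucc_succ]; trivial
    induction hσ using Submonoid.closure_induction_left with
    | one => rw [one_mul, permAct_one, Category.comp_id]
    | mul_left x hx y _ ih =>
      obtain ⟨i, rfl⟩ := hx
      rw [mul_assoc, permAct_swap_mul, permAct_swap_mul, ih, Category.assoc]

end TensorPower

open Idempotents

section ExteriorPower

variable (k : Type w) [Field k] {R : Type u} [Category.{v} R] [Preadditive R] [Linear k R]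
  [MonoidalCategory R] [SymmetricCategory R]

/-- The antisymmetrizer `(1 / m!) ∑ sign(σ) σ` of the tensor power `r ^ ⊗ m`. -/
def antisymmetrizer (m : ℕ) (r : R) : tensorPow r m ⟶ tensorPow r m :=
  ((m.factorial : k)⁻¹) •
    ∑ σ : Equiv.Perm (Fin m), (((Equiv.Perm.sign σ : ℤˣ) : ℤ) : k) • permAct r m σ

theorem antisymmetrizer_idem [CharZero k] (m : ℕ) (r : R) :
    antisymmetrizer k m r ≫ antisymmetrizer k m r = antisymmetrizer k m r := by
  have h : ∀ τ : Equiv.Perm (Fin m),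
      ((((Equiv.Perm.sign τ : ℤˣ) : ℤ) : k) • permAct r m τ) ≫
        (∑ σ : Equiv.Perm (Fin m), (((Equiv.Perm.sign σ : ℤˣ) : ℤ) : k) • permAct r m σ) =
      ∑ σ : Equiv.Perm (Fin m), (((Equiv.Perm.sign σ : ℤˣ) : ℤ) : k) • permAct r m σ := by
    intro τ
    rw [Preadditive.comp_sum]
    conv_rhs => rw [← Equiv.sum_comp (Equiv.mulRight τ)]
    refine Finset.sum_congr rfl fun σ _ => ?_
    rw [Linear.smul_comp, Linear.comp_smul, Equiv.coe_mulRight, smul_smul, ← permAct_mul,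
      Equiv.Perm.sign_mul, mul_comm]
    push_cast
    rfl
  have h2 : (m.factorial : k) ≠ 0 := Nat.cast_ne_zero.2 m.factorial_ne_zero
  simp only [antisymmetrizer]
  rw [Linear.smul_comp, Linear.comp_smul, Preadditive.sum_comp, Finset.sum_congr rfl fun τ _ => h τ,
    Finset.sum_const, Finset.card_univ, Fintype.card_perm, Fintype.card_fin,
    ← Nat.cast_smul_eq_nsmul k, smul_smul, smul_smul, inv_mul_cancel_right₀ h2]

/-- `L` is an `m`-th exterior power of `r`: it splits the antisymmetrizer of `r ^ ⊗ m`. -/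
def IsExteriorPower (m : ℕ) (r L : R) : Prop :=
  ∃ (i : L ⟶ tensorPow r m) (p : tensorPow r m ⟶ L),
    i ≫ p = 𝟙 L ∧ p ≫ i = antisymmetrizer k m r

/-- Exterior powers exist if idempotents split. -/
theorem exists_isExteriorPower [CharZero k] [IsIdempotentComplete R] (m : ℕ) (r : R) :
    ∃ L : R, IsExteriorPower k m r L := by
  obtain ⟨L, i, p, h, h'⟩ := IsIdempotentComplete.idempotents_split (tensorPow r m)
    (antisymmetrizer k m r) (antisymmetrizer_idem k m r)
  exact ⟨L, i, p, h, h'⟩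

variable {k}

/-- Exterior powers are unique up to isomorphism. -/
theorem IsExteriorPower.nonempty_iso {m : ℕ} {r L L' : R} (h : IsExteriorPower k m r L)
    (h' : IsExteriorPower k m r L') : Nonempty (L ≅ L') := by
  obtain ⟨i, p, h₁, h₂⟩ := h
  obtain ⟨i', p', h₁', h₂'⟩ := h'
  refine ⟨⟨i ≫ p', i' ≫ p, ?_, ?_⟩⟩
  · rw [Category.assoc, ← Category.assoc p', h₂', ← h₂, Category.assoc, ← Category.assoc, h₁,
      Category.id_comp]
  · rw [Category.assoc, ← Category.assoc p, h₂, ← h₂', Category.assoc, ← Category.assoc, h₁',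
      Category.id_comp]

theorem IsExteriorPower.of_iso {m : ℕ} {r L L' : R} (h : IsExteriorPower k m r L)
    (e : L ≅ L') : IsExteriorPower k m r L' := by
  obtain ⟨i, p, h₁, h₂⟩ := h
  exact ⟨e.inv ≫ i, p ≫ e.hom, by simp [reassoc_of% h₁], by simp [h₂]⟩

variable (k)

/-- An object `r` has subdimension `n` if its exterior power `Λ^(n+1) r` is a zero object. -/
def HasSubdimension (n : ℕ) : ObjectProperty R := fun r =>
  ∃ L : R, IsExteriorPower k (n + 1) r L ∧ IsZero L

end ExteriorPower

/-- A 2-rig over `k`: a symmetric monoidal `k`-linear category (the tensor product being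
`k`-bilinear on morphisms) which is Cauchy complete, in that it has finite biproducts and all
idempotents split. -/
class IsTwoRig (k : Type w) [Field k] (R : Type u) [Category.{v} R] [Preadditive R] [Linear k R]
    [MonoidalCategory R] [SymmetricCategory R] : Prop where
  monoidalPreadditive : MonoidalPreadditive R
  monoidalLinear : MonoidalLinear k R
  hasFiniteBiproducts : HasFiniteBiproducts R
  isIdempotentComplete : IsIdempotentComplete R

section FreeTwoRig

variable (k : Type w) [Field k]

/-- The Cauchy completion of a preadditive category: the idempotent completion of its completion
under finite biproducts. -/
abbrev CauchyCompletion (C : Type u) [Category.{v} C] [Preadditive C] := Karoubi (Mat_ C)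

/-- The free 2-rig on one object: the Cauchy completion of the free `k`-linear category on the
groupoid of finite sets and bijections. -/
abbrev FreeTwoRig := CauchyCompletion (Free k FinBij)

/-- The generating object of the free 2-rig: the one-element set. -/
def FreeTwoRig.gen : FreeTwoRig k :=
  (toKaroubi _).obj ((Mat_.embedding _).obj (Free.of k ⟨Unit⟩))

instance : IsTwoRig k (FreeTwoRig k) where
  monoidalPreadditive := inferInstance
  monoidalLinear := inferInstance
  hasFiniteBiproducts := inferInstance
  isIdempotentComplete := inferInstance

/-- The 2-ideal `⟨Λ^(n+1)⟩` of the free 2-rig which is generated by the exterior power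
`Λ^(n+1) x` of the generating object `x`. -/
def exteriorIdeal (n : ℕ) : TwoIdeal (FreeTwoRig k) :=
  TwoIdeal.span fun L => IsExteriorPower k (n + 1) (FreeTwoRig.gen k) L

/-- The quotient of the free 2-rig on one object by the 2-ideal `⟨Λ^(n+1)⟩`. -/
abbrev FreeSubdim (n : ℕ) := CategoryTheory.Quotient (exteriorIdeal k n).rel

/-- The image of the generating object in the quotient. -/
def FreeSubdim.gen (n : ℕ) : FreeSubdim k n :=
  (CategoryTheory.Quotient.functor (exteriorIdeal k n).rel).obj (FreeTwoRig.gen k)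

end FreeTwoRig

section Preservation

variable {R : Type u} [Category.{v} R] [MonoidalCategory R] [SymmetricCategory R]
  {R' : Type u'} [Category.{v'} R'] [MonoidalCategory R'] [SymmetricCategory R']
  (F : R ⥤ R') [F.Braided]

open Functor.LaxMonoidal

/-- A strong monoidal functor preserves tensor powers. -/
def tensorPowIso (r : R) : (m : ℕ) → (tensorPow (F.obj r) m ≅ F.obj (tensorPow r m))
  | 0 => Functor.Monoidal.εIso F
  | m + 1 => whiskerLeftIso (F.obj r) (tensorPowIso r m) ≪≫ Functor.Monoidal.μIso F _ _

theorem tensorPowIso_succ_hom (r : R) (m : ℕ) : (tensorPowIso F r (m + 1)).hom =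
    F.obj r ◁ (tensorPowIso F r m).hom ≫ μ F r (tensorPow r m) := rfl

theorem map_swapHead (r W : R) :
    F.obj r ◁ μ F r W ≫ μ F r (r ⊗ W) ≫ F.map (swapHead r W) =
      swapHead (F.obj r) (F.obj W) ≫ F.obj r ◁ μ F r W ≫ μ F r (r ⊗ W) := by
  simp only [swapHead, Functor.map_comp, Category.assoc]
  rw [associativity_inv_assoc, ← μ_natural_left_assoc, ← comp_whiskerRight_assoc,
    Functor.LaxBraided.braided, comp_whiskerRight_assoc, associativity]

theorem map_moveHead (r : R) (m : ℕ) (p : Fin (m + 1)) :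
    (tensorPowIso F r (m + 1)).hom ≫ F.map (moveHead r m p) =
      moveHead (F.obj r) m p ≫ (tensorPowIso F r (m + 1)).hom := by
  induction m with
  | zero => simp [moveHead]
  | succ m ih =>
    cases p using Fin.cases with
    | zero => simp [moveHead_zero]
    | succ p =>
      have h := swapHead_nat (F.obj r) (tensorPowIso F r m).hom
      rw [moveHead_succ, moveHead_succ, Functor.map_comp, Category.assoc,
        tensorPowIso_succ_hom F r (m + 1), ← whiskerLeft_comp_assoc (f := moveHead _ _ _), ← ih,
        tensorPowIso_succ_hom F r m]
      simp only [whiskerLeft_comp, Category.assoc]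
      have h₂ : F.obj r ◁ μ F r (tensorPow r m) ≫ μ F r (tensorPow r (m + 1)) ≫
          F.map (swapHead r (tensorPow r m)) = _ := map_swapHead F r (tensorPow r m)
      rw [reassoc_of% h, reassoc_of% h₂, μ_natural_right]

theorem map_permAct (r : R) (m : ℕ) (σ : Equiv.Perm (Fin m)) :
    (tensorPowIso F r m).hom ≫ F.map (permAct r m σ) =
      permAct (F.obj r) m σ ≫ (tensorPowIso F r m).hom := by
  induction m with
  | zero => simp [permAct]
  | succ m ih =>
    simp only [permAct, Functor.map_comp, Category.assoc]
    rw [← map_moveHead, tensorPowIso_succ_hom, Category.assoc, ← μ_natural_right_assoc,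
      ← whiskerLeft_comp_assoc, ih, whiskerLeft_comp_assoc, Category.assoc]

variable (k : Type w) [Field k] [Preadditive R] [Linear k R] [Preadditive R'] [Linear k R']
  [F.Additive] [F.Linear k]

theorem map_antisymmetrizer (r : R) (m : ℕ) :
    (tensorPowIso F r m).hom ≫ F.map (antisymmetrizer k m r) =
      antisymmetrizer k m (F.obj r) ≫ (tensorPowIso F r m).hom := by
  simp only [antisymmetrizer, Functor.map_smul, Functor.map_sum, Linear.comp_smul,
    Linear.smul_comp, Preadditive.comp_sum, Preadditive.sum_comp, map_permAct]

variable {k}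

/-- Maps of 2-rigs preserve exterior powers. -/
theorem IsExteriorPower.map {m : ℕ} {r L : R} (h : IsExteriorPower k m r L) :
    IsExteriorPower k m (F.obj r) (F.obj L) := by
  obtain ⟨i, p, h₁, h₂⟩ := h
  refine ⟨F.map i ≫ (tensorPowIso F r m).inv, (tensorPowIso F r m).hom ≫ F.map p, ?_, ?_⟩
  · simp [← Functor.map_comp, h₁]
  · have h₃ : F.map p ≫ F.map i = F.map (antisymmetrizer k m r) := by
      rw [← Functor.map_comp, h₂]
    rw [Category.assoc, reassoc_of% h₃, reassoc_of% (map_antisymmetrizer F k r m),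
      Iso.hom_inv_id, Category.comp_id]

theorem HasSubdimension.map {n : ℕ} {r : R} (h : HasSubdimension k n r) :
    HasSubdimension k n (F.obj r) := by
  obtain ⟨L, hL, h₀⟩ := h
  exact ⟨F.obj L, hL.map F, F.map_isZero h₀⟩

end Preservation

/-- A map of 2-rigs: a `k`-linear symmetric strong monoidal functor. -/
structure TwoRigMap (k : Type w) [Field k]
    (R : Type u) [Category.{v} R] [Preadditive R] [Linear k R] [MonoidalCategory R]
    [SymmetricCategory R]
    (R' : Type u') [Category.{v'} R'] [Preadditive R'] [Linear k R'] [MonoidalCategory R']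
    [SymmetricCategory R'] where
  toFunctor : R ⥤ R'
  [braided : toFunctor.Braided]
  [additive : toFunctor.Additive]
  [linear : toFunctor.Linear k]

attribute [instance] TwoRigMap.braided TwoRigMap.additive TwoRigMap.linear

namespace TwoRigMap

variable {k : Type w} [Field k]
  {R : Type u} [Category.{v} R] [Preadditive R] [Linear k R] [MonoidalCategory R]
  [SymmetricCategory R]
  {R' : Type u'} [Category.{v'} R'] [Preadditive R'] [Linear k R'] [MonoidalCategory R']
  [SymmetricCategory R']
  {R'' : Type u''} [Category.{v''} R''] [Preadditive R''] [Linear k R''] [MonoidalCategory R'']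
  [SymmetricCategory R'']

/-- A 2-cell between maps of 2-rigs: a monoidal natural transformation. -/
@[ext]
structure Hom (F G : TwoRigMap k R R') where
  toNatTrans : F.toFunctor ⟶ G.toFunctor
  isMonoidal : NatTrans.IsMonoidal toNatTrans

/-- The category of maps from one 2-rig to another, and of monoidal natural transformations
between them. -/
instance : Category (TwoRigMap k R R') where
  Hom := Hom
  id F := ⟨𝟙 F.toFunctor, inferInstance⟩
  comp α β := ⟨α.toNatTrans ≫ β.toNatTrans, by
    have := α.isMonoidal
    have := β.isMonoidal
    infer_instance⟩

/-- The identity of a 2-rig. -/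
def id : TwoRigMap k R R := ⟨𝟭 R⟩

/-- Composition of maps of 2-rigs. -/
def comp (F : TwoRigMap k R R') (G : TwoRigMap k R' R'') : TwoRigMap k R R'' :=
  ⟨F.toFunctor ⋙ G.toFunctor⟩

/-- Composition with a fixed map of 2-rigs, as a functor. -/
def postcomp (A : TwoRigMap k R' R'') : TwoRigMap k R R' ⥤ TwoRigMap k R R'' where
  obj F := F.comp A
  map α := ⟨Functor.whiskerRight α.toNatTrans A.toFunctor, by
    have := α.isMonoidal
    exact NatTrans.IsMonoidal.whiskerRight _⟩
  map_id F := Hom.ext (Functor.whiskerRight_id' A.toFunctor)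
  map_comp α β := Hom.ext (Functor.whiskerRight_comp α.toNatTrans β.toNatTrans A.toFunctor)

/-- The natural transformation between composition functors that is induced by a 2-cell. -/
def postcompMap {A A' : TwoRigMap k R' R''} (α : A ⟶ A') :
    (postcomp A : TwoRigMap k R R' ⥤ _) ⟶ postcomp A' where
  app F := ⟨Functor.whiskerLeft F.toFunctor α.toNatTrans, by
    have := α.isMonoidal
    exact NatTrans.IsMonoidal.whiskerLeft _⟩
  naturality F G φ := Hom.ext (by
    ext X
    exact (α.toNatTrans.naturality (φ.toNatTrans.app X)))

end TwoRigMap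

/-- The full subcategory of the objects of subdimension `n`. -/
abbrev Subdim (k : Type w) [Field k] (n : ℕ)
    (R : Type u) [Category.{v} R] [Preadditive R] [Linear k R] [MonoidalCategory R]
    [SymmetricCategory R] :=
  ObjectProperty.FullSubcategory (HasSubdimension k n : ObjectProperty R)

namespace Subdim

variable {k : Type w} [Field k]
  {R : Type u} [Category.{v} R] [Preadditive R] [Linear k R] [MonoidalCategory R]
  [SymmetricCategory R]
  {R' : Type u'} [Category.{v'} R'] [Preadditive R'] [Linear k R'] [MonoidalCategory R']
  [SymmetricCategory R']
  {R'' : Type u''} [Category.{v''} R''] [Preadditive R''] [Linear k R''] [MonoidalCategory R'']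
  [SymmetricCategory R'']

/-- The action of `Subdim` on maps of 2-rigs. -/
def map (n : ℕ) (A : TwoRigMap k R R') : Subdim k n R ⥤ Subdim k n R' :=
  ObjectProperty.lift _ (ObjectProperty.ι _ ⋙ A.toFunctor) fun r => r.property.map A.toFunctor

/-- The action of `Subdim` on 2-cells. -/
def map₂ (n : ℕ) {A A' : TwoRigMap k R R'} (α : A ⟶ A') : map n A ⟶ map n A' where
  app r := ObjectProperty.homMk (α.toNatTrans.app r.obj)
  naturality _ _ f := ObjectProperty.hom_ext _ (α.toNatTrans.naturality f.hom)

theorem map_id (n : ℕ) : map n (TwoRigMap.id (k := k) (R := R)) = 𝟭 _ := rfl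

theorem map_comp (n : ℕ) (A : TwoRigMap k R R') (B : TwoRigMap k R' R'') :
    map n (A.comp B) = map n A ⋙ map n B := rfl

theorem map₂_id (n : ℕ) (A : TwoRigMap k R R') : map₂ n (𝟙 A) = 𝟙 (map n A) := rfl

theorem map₂_comp (n : ℕ) {A A' A'' : TwoRigMap k R R'} (α : A ⟶ A') (β : A' ⟶ A'') :
    map₂ n (α ≫ β) = map₂ n α ≫ map₂ n β := rfl

/-- Evaluation at an object of subdimension `n`, on the category of maps of 2-rigs. -/
def evalAt {n : ℕ} {x : R} (hx : HasSubdimension k n x)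
    (R' : Type u') [Category.{v'} R'] [Preadditive R'] [Linear k R'] [MonoidalCategory R']
    [SymmetricCategory R'] : TwoRigMap k R R' ⥤ Subdim k n R' where
  obj F := ⟨F.toFunctor.obj x, hx.map F.toFunctor⟩
  map α := ObjectProperty.homMk (α.toNatTrans.app x)

end Subdim

end

set_option linter.unusedSectionVars false

/-! Existence of maps. Since `S` is the free symmetric monoidal category on one object, an object
`r` of a 2-rig `R` gives a symmetric monoidal functor that sends a finite set `A` to the tensor
power of `r` with `|A|` factors (`TensorPower.functor`). Free linear categories, completions under
finite biproducts and idempotent completions are all functorial for symmetric monoidal functors. As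
`R` is Cauchy complete, it is equivalent to its own Cauchy completion, and composing with an inverse
of that equivalence gives `FreeTwoRig.lift`. The objects annihilated by a map of 2-rigs form a
2-ideal (`TwoIdeal.ker`). Maps of 2-rigs preserve exterior powers, so if `r` has subdimension `n`,
this 2-ideal contains `Λ^(n+1) x`, hence all of `⟨Λ^(n+1)⟩`, and the map descends to the quotient
(`FreeSubdim.exists_map`).

Full faithfulness of evaluation. A monoidal transformation must be `f ⊗ ⋯ ⊗ f` on the powers of `x`,
where `f` is its value at `x`; conversely every `f` occurs. Indeed each bijection of a power of the
point is a permutation of the factors, and `f ⊗ ⋯ ⊗ f` commutes with permutations (`FinBij.extend`,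
`FinBij.natTrans_ext`). Every object of the quotient is a retract of a finite sum of powers of `x`,
and morphisms between powers come from linear combinations of bijections, so additivity and
linearity extend the transformation uniquely to the whole quotient (`IsAdditivelyDense`,
`FreeSubdim.exists_hom`, `FreeSubdim.hom_ext`).

The quotient is a 2-rig. The delicate point is the splitting of idempotents, which can fail in a
quotient category. Here endomorphism algebras are finite-dimensional, so an endomorphism that is
idempotent modulo the 2-ideal can be replaced by a polynomial in itself that is truly idempotent and
has the same class (`exists_idempotent_polynomial`, `TwoIdeal.exists_idempotent_lift`). The
2-naturality of evaluation holds by definition. -/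

noncomputable section

/-! ### Products of tensor powers and the block action of permutations -/

namespace TensorPower

variable {R : Type u} [Category.{v} R] [MonoidalCategory R]

/-- The isomorphism of a product of two tensor powers with a tensor power. -/
def mulIso (r : R) : (m m' : ℕ) → (tensorPow r m ⊗ tensorPow r m' ≅ tensorPow r (m' + m))
  | 0, m' => λ_ (tensorPow r m')
  -- The exponent is `m' + m` rather than `m + m'` because `m' + (m + 1)` unfolds to `(m' + m) + 1`;
  -- the recursion on the first exponent then needs no cast.
  | m + 1, m' => α_ r (tensorPow r m) (tensorPow r m') ≪≫ whiskerLeftIso r (mulIso r m m')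

theorem mulIso_zero (r : R) (m' : ℕ) : (mulIso r 0 m').hom = (λ_ (tensorPow r m')).hom := rfl

theorem mulIso_succ (r : R) (m m' : ℕ) : (mulIso r (m + 1) m').hom =
    (α_ r (tensorPow r m) (tensorPow r m')).hom ≫ r ◁ (mulIso r m m').hom := rfl

/-- The identification of tensor powers with equal exponents. -/
def castHom (r : R) {m m' : ℕ} (h : m = m') : tensorPow r m ⟶ tensorPow r m' :=
  eqToHom (congrArg (tensorPow r) h)

@[simp] theorem castHom_rfl (r : R) {m : ℕ} (h : m = m) : castHom r h = 𝟙 _ := rfl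

theorem whiskerLeft_castHom (r : R) {m m' : ℕ} (h : m = m') :
    r ◁ castHom r h = castHom r (congrArg (· + 1) h) := by
  subst h
  simp [castHom]

theorem mulIso_zero_right (r : R) (m : ℕ) : (mulIso r m 0).hom =
    (ρ_ (tensorPow r m)).hom ≫ castHom r (Nat.zero_add m).symm := by
  induction m with
  | zero => simp [mulIso_zero, unitors_equal]
  | succ m ih =>
    rw [mulIso_succ, ih, whiskerLeft_comp, whiskerLeft_castHom]
    simp

/-- Induction on `a`, where the pentagon peels off one factor `r`. The exponents on the two sides
agree only after reassociating a sum, which accounts for the cast. -/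
theorem mulIso_assoc (r : R) (a b c : ℕ) :
    (mulIso r a b).hom ▷ tensorPow r c ≫ (mulIso r (b + a) c).hom =
      (α_ (tensorPow r a) (tensorPow r b) (tensorPow r c)).hom ≫
        tensorPow r a ◁ (mulIso r b c).hom ≫ (mulIso r a (c + b)).hom ≫
          castHom r (Nat.add_assoc c b a) := by
  induction a with
  | zero => simp [mulIso_zero]
  | succ a ih =>
    have h : (mulIso r (b + (a + 1)) c).hom = (α_ r (tensorPow r (b + a)) (tensorPow r c)).hom ≫
      r ◁ (mulIso r (b + a) c).hom := mulIso_succ r (b + a) c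
    rw [h, mulIso_succ, mulIso_succ, comp_whiskerRight, Category.assoc,
      associator_naturality_middle_assoc, ← whiskerLeft_comp, ih]
    simp only [whiskerLeft_comp, whiskerLeft_castHom, Category.assoc]
    rw [pentagon_assoc, ← associator_naturality_right_assoc]

variable [SymmetricCategory R]

/-- The action of a bijection between finite ordinals on tensor powers. -/
def powMap (r : R) {m m' : ℕ} (e : Fin m ≃ Fin m') : tensorPow r m ⟶ tensorPow r m' :=
  permAct r m (e.trans (finCongr (Fin.equiv_iff_eq.1 ⟨e⟩).symm)) ≫
    castHom r (Fin.equiv_iff_eq.1 ⟨e⟩)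

theorem powMap_perm (r : R) {m : ℕ} (e : Equiv.Perm (Fin m)) : powMap r e = permAct r m e := by
  simp [powMap]

theorem powMap_refl (r : R) (m : ℕ) : powMap r (Equiv.refl (Fin m)) = 𝟙 _ := by
  rw [powMap_perm]
  exact permAct_one r m

theorem powMap_cast (r : R) {m m' : ℕ} (h : m = m') : powMap r (finCongr h) = castHom r h := by
  subst h
  exact powMap_refl r m

/-- A bijection of ordinals forces the exponents to be equal; after identifying them this is the
multiplicativity `permAct_mul`. -/
theorem powMap_trans (r : R) {m m' m'' : ℕ} (e : Fin m ≃ Fin m') (e' : Fin m' ≃ Fin m'') :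
    powMap r e ≫ powMap r e' = powMap r (e.trans e') := by
  obtain rfl := Fin.equiv_iff_eq.1 ⟨e⟩
  obtain rfl := Fin.equiv_iff_eq.1 ⟨e'⟩
  rw [powMap_perm, powMap_perm, powMap_perm]
  exact (permAct_mul r m e' e).symm

/-- Extension of a bijection between finite ordinals by a new least element. -/
def consEquiv {m m' : ℕ} (e : Fin m ≃ Fin m') : Fin (m + 1) ≃ Fin (m' + 1) :=
  (finSuccEquiv m).trans ((Equiv.optionCongr e).trans (finSuccEquiv m').symm)

@[simp] theorem consEquiv_zero {m m' : ℕ} (e : Fin m ≃ Fin m') : consEquiv e 0 = 0 := by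
  simp [consEquiv]

@[simp] theorem consEquiv_succ {m m' : ℕ} (e : Fin m ≃ Fin m') (i : Fin m) :
    consEquiv e i.succ = (e i).succ := by
  simp [consEquiv]

/-- The case of `permAct_move` in which the head stays at position `0`. -/
theorem whiskerLeft_powMap (r : R) {m m' : ℕ} (e : Fin m ≃ Fin m') :
    r ◁ powMap r e = powMap r (consEquiv e) := by
  obtain rfl := Fin.equiv_iff_eq.1 ⟨e⟩
  rw [powMap_perm, powMap_perm]
  have h := permAct_move r m 0 e
  rw [moveHead_zero] at h
  rw [← Category.comp_id (r ◁ permAct r m e)]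
  refine h.symm.trans (congrArg (permAct r (m + 1)) ?_)
  ext j
  cases j using Fin.cases with
  | zero => rw [movePerm_mul_zero]; simp
  | succ j => rw [Equiv.Perm.mul_apply, succPerm_succ, movePerm_succ]; simp

/-- The case of `permAct_move` in which the tail is not permuted. -/
theorem moveHead_eq_powMap (r : R) (m : ℕ) (p : Fin (m + 1)) :
    moveHead r m p = powMap r (movePerm p) := by
  have h := permAct_move r m p 1
  rw [permAct_one, whiskerLeft_id] at h
  rw [powMap_perm, ← Category.id_comp (moveHead r m p)]
  refine h.symm.trans (congrArg (permAct r (m + 1)) ?_)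
  ext j
  cases j using Fin.cases with
  | zero => rw [movePerm_mul_zero, movePerm_zero]
  | succ j => rw [Equiv.Perm.mul_apply, succPerm_succ, Equiv.Perm.one_apply]

/-- The first summand is placed before the second one. -/
def sumFin (m m' : ℕ) : Fin m ⊕ Fin m' ≃ Fin (m' + m) :=
  finSumFinEquiv.trans (finCongr (Nat.add_comm m m'))

@[simp] theorem sumFin_inl (m m' : ℕ) (i : Fin m) : (sumFin m m' (Sum.inl i)).val = i.val := by
  simp [sumFin]

@[simp] theorem sumFin_inr (m m' : ℕ) (i : Fin m') :
    (sumFin m m' (Sum.inr i)).val = m + i.val := by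
  simp [sumFin, Nat.add_comm]

/-- The block sum of two bijections. -/
def blockSum {a a' b b' : ℕ} (e : Fin a ≃ Fin a') (e' : Fin b ≃ Fin b') :
    Fin (b + a) ≃ Fin (b' + a') :=
  (sumFin a b).symm.trans ((Equiv.sumCongr e e').trans (sumFin a' b'))

/-- The bijection which exchanges two blocks. -/
def blockSwap (a b : ℕ) : Fin (b + a) ≃ Fin (a + b) :=
  (sumFin a b).symm.trans ((Equiv.sumComm _ _).trans (sumFin b a))

theorem swapHead_tensor (r B A : R) :
    swapHead r B ▷ A ≫ (α_ r (r ⊗ B) A).hom ≫ r ◁ (α_ r B A).hom =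
      (α_ r (r ⊗ B) A).hom ≫ r ◁ (α_ r B A).hom ≫ swapHead r (B ⊗ A) := by
  simp only [swapHead]
  monoidal

/-- The case of a generator in `permAct_whiskerRight`: as the first block comes first, the
transposed positions keep their numbers when a second block is appended. -/
theorem adjSwap_whiskerRight (r : R) (m m' : ℕ) (i : Fin m) :
    adjSwap r m i ▷ tensorPow r m' ≫ (mulIso r (m + 1) m').hom =
      (mulIso r (m + 1) m').hom ≫ adjSwap r (m' + m) (Fin.castLE (Nat.le_add_left m m') i) := by
  induction m with
  | zero => exact i.elim0
  | succ m ih =>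
    cases i using Fin.cases with
    | zero =>
      rw [mulIso_succ, mulIso_succ, whiskerLeft_comp]
      have h := swapHead_tensor r (tensorPow r m) (tensorPow r m')
      have h' := swapHead_nat r (mulIso r m m').hom
      change swapHead r (tensorPow r m) ▷ tensorPow r m' ≫ _ =
        _ ≫ swapHead r (tensorPow r (m' + m))
      rw [Category.assoc, Category.assoc, ← h', reassoc_of% h]
    | succ i =>
      rw [mulIso_succ, adjSwap_succ, associator_naturality_middle_assoc, ← whiskerLeft_comp, ih i,
        Category.assoc, whiskerLeft_comp]
      rfl

/-- Both sides are multiplicative in `σ`, and adjacent transpositions generate the symmetric group,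
so `adjSwap_whiskerRight` suffices. -/
theorem permAct_whiskerRight (r : R) (m m' : ℕ) (σ : Equiv.Perm (Fin m)) :
    permAct r m σ ▷ tensorPow r m' ≫ (mulIso r m m').hom =
      (mulIso r m m').hom ≫ powMap r (blockSum σ (Equiv.refl (Fin m'))) := by
  cases m with
  | zero =>
    have h : blockSum σ (Equiv.refl (Fin m')) = Equiv.refl _ := by
      ext j
      obtain ⟨j, rfl⟩ := (sumFin 0 m').surjective j
      rcases j with j | j
      · exact j.elim0
      · simp [blockSum]
    rw [h, powMap_refl]
    simp [permAct]
  | succ m =>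
    have hσ : σ ∈ Submonoid.closure
        (Set.range fun i : Fin m => Equiv.swap i.castSucc i.succ) := by
      rw [Equiv.Perm.mclosure_swap_castSucc_succ]; trivial
    induction hσ using Submonoid.closure_induction_left with
    | one =>
      have h : blockSum (1 : Equiv.Perm (Fin (m + 1))) (Equiv.refl (Fin m')) = Equiv.refl _ := by
        ext j
        simp [blockSum, Equiv.Perm.one_def]
      rw [h, powMap_refl, permAct_one]
      simp
    | mul_left x hx y _ ih =>
      obtain ⟨i, rfl⟩ := hx
      have h : blockSum (Equiv.swap i.castSucc i.succ * y) (Equiv.refl (Fin m')) =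
          Equiv.swap (Fin.castLE (Nat.le_add_left m m') i).castSucc
            (Fin.castLE (Nat.le_add_left m m') i).succ * blockSum y (Equiv.refl (Fin m')) := by
        -- A transposition acting on the first summand is a transposition on the union; `sumFin`
        -- carries it to the one of the corresponding positions.
        have hs : ∀ z, sumFin (m + 1) m' (Equiv.sumCongr (Equiv.swap i.castSucc i.succ)
            (Equiv.refl (Fin m')) z) = Equiv.swap
              ((Fin.castLE (Nat.le_add_left m m') i).castSucc : Fin (m' + m + 1))
            (Fin.castLE (Nat.le_add_left m m') i).succ (sumFin (m + 1) m' z) := by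
          intro z
          have h1 : ((Fin.castLE (Nat.le_add_left m m') i).castSucc : Fin (m' + m + 1)) =
              sumFin (m + 1) m' (Sum.inl i.castSucc) := Fin.ext (by simp)
          have h2 : ((Fin.castLE (Nat.le_add_left m m') i).succ : Fin (m' + m + 1)) =
              sumFin (m + 1) m' (Sum.inl i.succ) := Fin.ext (by simp)
          rw [h1, h2, ← (sumFin (m + 1) m').injective.map_swap]
          congr 1
          exact congrArg (fun e : Equiv.Perm _ => e z)
            (Equiv.Perm.sumCongr_swap_refl (β := Fin m') i.castSucc i.succ)
        ext z
        obtain ⟨z, rfl⟩ := (sumFin (m + 1) m').surjective z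
        have := hs (Equiv.sumCongr y (Equiv.refl _) z)
        refine congrArg Fin.val (Eq.trans ?_ (this.trans ?_))
        · rcases z with z | z <;> simp only [blockSum, Equiv.trans_apply, Equiv.symm_apply_apply] <;> rfl
        · simp [blockSum]
      rw [h, permAct_swap_mul, comp_whiskerRight, Category.assoc, adjSwap_whiskerRight,
        reassoc_of% ih, powMap_perm, powMap_perm]
      congr 1
      exact (permAct_swap_mul r (m' + m) _ _).symm

theorem powMap_whiskerRight (r : R) {m₁ m₂ : ℕ} (m' : ℕ) (e : Fin m₁ ≃ Fin m₂) :
    powMap r e ▷ tensorPow r m' ≫ (mulIso r m₂ m').hom =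
      (mulIso r m₁ m').hom ≫ powMap r (blockSum e (Equiv.refl (Fin m'))) := by
  obtain rfl := Fin.equiv_iff_eq.1 ⟨e⟩
  rw [powMap_perm]
  exact permAct_whiskerRight r m₁ m' e

/-- The hexagon identity: `r` passes `r ⊗ B` by passing first `r` and then `B`. -/
theorem braid_head (r A B : R) :
    (β_ r (r ⊗ B)).hom ▷ A ≫ (α_ (r ⊗ B) r A).hom ≫ (α_ r B (r ⊗ A)).hom =
      swapHead r B ▷ A ≫ (α_ r (r ⊗ B) A).hom ≫
        r ◁ ((β_ r B).hom ▷ A ≫ (α_ B r A).hom) := by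
  rw [BraidedCategory.braiding_tensor_right_hom]
  simp only [swapHead]
  monoidal

/-- Passing `n` factors puts the head at position `n`. Induction on `n`, with `braid_head` for the
first factor that is passed. -/
theorem braiding_head_mulIso (r : R) (n m : ℕ) :
    (β_ r (tensorPow r n)).hom ▷ tensorPow r m ≫ (α_ _ _ _).hom ≫ (mulIso r n (m + 1)).hom =
      (α_ _ _ _).hom ≫ r ◁ (mulIso r n m).hom ≫
        moveHead r (m + n) ⟨n, Nat.lt_succ_of_le (Nat.le_add_left n m)⟩ ≫
          castHom r (by omega : m + n + 1 = m + 1 + n) := by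
  induction n with
  | zero =>
    rw [mulIso_zero, mulIso_zero]
    change _ = _ ≫ _ ≫ moveHead r (m + 0) 0 ≫ _
    rw [moveHead_zero]
    simp
  | succ n ih =>
    rw [mulIso_succ, mulIso_succ]
    have h := braid_head r (tensorPow r m) (tensorPow r n)
    have h2 := swapHead_tensor r (tensorPow r n) (tensorPow r m)
    have h3 := swapHead_nat r (mulIso r n m).hom
    have h4 : moveHead r (m + (n + 1))
        ⟨n + 1, Nat.lt_succ_of_le (Nat.le_add_left (n + 1) m)⟩ =
        swapHead r (tensorPow r (m + n)) ≫
          r ◁ moveHead r (m + n) ⟨n, Nat.lt_succ_of_le (Nat.le_add_left n m)⟩ :=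
      moveHead_succ r (m + n) ⟨n, Nat.lt_succ_of_le (Nat.le_add_left n m)⟩
    have h5 := congrArg (fun f => r ◁ f) ih
    have h6 : castHom r (by omega : m + (n + 1) + 1 = m + 1 + (n + 1)) =
      r ◁ castHom r (by omega : m + n + 1 = m + 1 + n) := (whiskerLeft_castHom r _).symm
    simp only [whiskerLeft_comp] at h5
    rw [h4, h6, reassoc_of% h]
    simp only [whiskerLeft_comp, Category.assoc]
    rw [h5, reassoc_of% h2, ← reassoc_of% h3]

/-- Induction on `a`: by the hexagon identity the tail of the first power passes the second power,
and then the head does (`braiding_head_mulIso`). Everything becomes one `powMap`, which leaves an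
identity of bijections of ordinals. -/
theorem braiding_mulIso (r : R) (a b : ℕ) :
    (β_ (tensorPow r a) (tensorPow r b)).hom ≫ (mulIso r b a).hom =
      (mulIso r a b).hom ≫ powMap r (blockSwap a b) := by
  induction a with
  | zero =>
    rw [mulIso_zero, mulIso_zero_right, ← powMap_cast]
    have h : blockSwap 0 b = finCongr (Nat.zero_add b).symm := by
      ext j
      obtain ⟨j, rfl⟩ := (sumFin 0 b).surjective j
      rcases j with j | j
      · exact j.elim0
      · simp only [blockSwap, Equiv.trans_apply, Equiv.symm_apply_apply, Equiv.sumComm_apply,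
          Sum.swap_inr, sumFin_inl, finCongr_apply, Fin.val_cast, sumFin_inr, Nat.zero_add]
    rw [h]
    simp
  | succ a ih =>
    have h := braiding_head_mulIso r b a
    have h2 := congrArg (fun f => r ◁ f) ih
    simp only [whiskerLeft_comp] at h2
    rw [BraidedCategory.braiding_tensor_left_hom]
    simp only [Category.assoc]
    rw [h, Iso.inv_hom_id_assoc, reassoc_of% h2, mulIso_succ, Category.assoc, moveHead_eq_powMap,
      ← powMap_cast, powMap_trans, whiskerLeft_powMap, powMap_trans]
    congr 3
    -- The bijections are compared on the head, on the rest of the first block and on the second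
    -- block.
    ext j
    obtain ⟨j, rfl⟩ := (sumFin (a + 1) b).surjective j
    rcases j with j | j
    · cases j using Fin.cases with
      | zero =>
        have h0 : sumFin (a + 1) b (Sum.inl 0) = (0 : Fin (b + a + 1)) := Fin.ext (by simp)
        simp only [Equiv.trans_apply]
        rw [h0, consEquiv_zero, movePerm_zero, ← h0]
        simp [blockSwap]
      | succ j =>
        have h0 : sumFin (a + 1) b (Sum.inl j.succ) = (sumFin a b (Sum.inl j)).succ :=
          Fin.ext (by simp)
        simp only [Equiv.trans_apply]
        rw [h0, consEquiv_succ, movePerm_succ, ← h0]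
        simp [blockSwap, Fin.succAbove, Fin.lt_def]
        omega
    · have h0 : sumFin (a + 1) b (Sum.inr j) = (sumFin a b (Sum.inr j)).succ :=
        Fin.ext (by simp; omega)
      simp only [Equiv.trans_apply]
      rw [h0, consEquiv_succ, movePerm_succ, ← h0]
      simp [blockSwap, Fin.succAbove, Fin.lt_def]

end TensorPower

end

noncomputable section

namespace TensorPower

variable {R : Type u} [Category.{v} R] [MonoidalCategory R] [SymmetricCategory R]

/-- Conjugation with the braiding exchanges the two blocks and reduces this to
`powMap_whiskerRight`, so that no second induction over transpositions is needed. -/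
theorem whiskerLeft_powMap_mulIso (r : R) (a : ℕ) {b b' : ℕ} (e : Fin b ≃ Fin b') :
    tensorPow r a ◁ powMap r e ≫ (mulIso r a b').hom =
      (mulIso r a b).hom ≫ powMap r (blockSum (Equiv.refl (Fin a)) e) := by
  have h := braiding_mulIso r a b'
  have h2 := powMap_whiskerRight r a e
  have h3 := braiding_mulIso r a b
  have h4 : tensorPow r a ◁ powMap r e ≫ (β_ (tensorPow r a) (tensorPow r b')).hom ≫
      (mulIso r b' a).hom = (mulIso r a b).hom ≫ powMap r (blockSwap a b) ≫
        powMap r (blockSum e (Equiv.refl (Fin a))) := by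
    rw [BraidedCategory.braiding_naturality_right_assoc, h2, reassoc_of% h3]
  rw [h, powMap_trans] at h4
  have h5 : powMap r (blockSwap a b') ≫ powMap r (blockSwap a b').symm = 𝟙 _ := by
    rw [powMap_trans, Equiv.self_trans_symm, powMap_refl]
  have h6 := congrArg (fun f => f ≫ powMap r (blockSwap a b').symm) h4
  simp only [Category.assoc] at h6
  rw [h5, Category.comp_id, powMap_trans] at h6
  rw [h6]
  congr 2
  ext j
  obtain ⟨j, rfl⟩ := (sumFin a b).surjective j
  rcases j with j | j <;> simp [blockSwap, blockSum]

theorem powMap_tensor (r : R) {a a' b b' : ℕ} (e : Fin a ≃ Fin a') (e' : Fin b ≃ Fin b') :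
    (powMap r e ⊗ₘ powMap r e') ≫ (mulIso r a' b').hom =
      (mulIso r a b).hom ≫ powMap r (blockSum e e') := by
  rw [MonoidalCategory.tensorHom_def, Category.assoc, whiskerLeft_powMap_mulIso,
    ← Category.assoc, powMap_whiskerRight, Category.assoc, powMap_trans]
  congr 2
  ext j
  obtain ⟨j, rfl⟩ := (sumFin a b).surjective j
  rcases j with j | j <;> simp [blockSum]

/-- An invertible action of a bijection on tensor powers. -/
def powIso (r : R) {m m' : ℕ} (e : Fin m ≃ Fin m') : tensorPow r m ≅ tensorPow r m' where
  hom := powMap r e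
  inv := powMap r e.symm
  hom_inv_id := by rw [powMap_trans, Equiv.self_trans_symm, powMap_refl]
  inv_hom_id := by rw [powMap_trans, Equiv.symm_trans_self, powMap_refl]

/-! ### Tensor powers indexed by finite sets: the symmetric monoidal functor of an object -/

section Enumerations

variable {A A' B B' C D E : Type} {a a' b b' c d e : ℕ}

/-- The action of a bijection between enumerated sets on tensor powers. -/
def enumMap (r : R) (eA : A ≃ Fin a) (eB : B ≃ Fin b) (f : A ≃ B) :
    tensorPow r a ⟶ tensorPow r b :=
  powMap r (eA.symm.trans (f.trans eB))

theorem enumMap_refl (r : R) (eA : A ≃ Fin a) : enumMap r eA eA (Equiv.refl A) = 𝟙 _ := by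
  rw [← powMap_refl, enumMap]
  congr 1
  ext x
  simp

theorem enumMap_trans (r : R) (eA : A ≃ Fin a) (eB : B ≃ Fin b) (eC : C ≃ Fin c)
    (f : A ≃ B) (g : B ≃ C) :
    enumMap r eA eC (f.trans g) = enumMap r eA eB f ≫ enumMap r eB eC g := by
  rw [enumMap, enumMap, enumMap, powMap_trans]
  congr 1
  ext x
  simp

/-- The comparison of the enumeration of a disjoint union by two blocks with a given one. -/
def unionEquiv (eA : A ≃ Fin a) (eB : B ≃ Fin b) (eC : A ⊕ B ≃ Fin c) :
    Fin (b + a) ≃ Fin c :=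
  (sumFin a b).symm.trans ((Equiv.sumCongr eA.symm eB.symm).trans eC)

@[simp] theorem unionEquiv_inl (eA : A ≃ Fin a) (eB : B ≃ Fin b) (eC : A ⊕ B ≃ Fin c)
    (i : Fin a) : unionEquiv eA eB eC (sumFin a b (Sum.inl i)) = eC (Sum.inl (eA.symm i)) := by
  simp [unionEquiv]

@[simp] theorem unionEquiv_inr (eA : A ≃ Fin a) (eB : B ≃ Fin b) (eC : A ⊕ B ≃ Fin c)
    (i : Fin b) : unionEquiv eA eB eC (sumFin a b (Sum.inr i)) = eC (Sum.inr (eB.symm i)) := by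
  simp [unionEquiv]

@[simp] theorem blockSum_inl (e : Fin a ≃ Fin a') (e' : Fin b ≃ Fin b') (i : Fin a) :
    blockSum e e' (sumFin a b (Sum.inl i)) = sumFin a' b' (Sum.inl (e i)) := by
  simp [blockSum]

@[simp] theorem blockSum_inr (e : Fin a ≃ Fin a') (e' : Fin b ≃ Fin b') (i : Fin b) :
    blockSum e e' (sumFin a b (Sum.inr i)) = sumFin a' b' (Sum.inr (e' i)) := by
  simp [blockSum]

/-- The isomorphism of a product of tensor powers, indexed by enumerated sets, with the tensor
power which is indexed by their disjoint union. -/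
def unionIso (r : R) (eA : A ≃ Fin a) (eB : B ≃ Fin b) (eC : A ⊕ B ≃ Fin c) :
    tensorPow r a ⊗ tensorPow r b ≅ tensorPow r c :=
  mulIso r a b ≪≫ powIso r (unionEquiv eA eB eC)

theorem unionIso_hom (r : R) (eA : A ≃ Fin a) (eB : B ≃ Fin b) (eC : A ⊕ B ≃ Fin c) :
    (unionIso r eA eB eC).hom = (mulIso r a b).hom ≫ powMap r (unionEquiv eA eB eC) := rfl

/-- By `powMap_tensor` both sides are the product isomorphism followed by a `powMap`; the two
bijections agree on each block because the chosen enumerations cancel. -/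
theorem unionIso_natural (r : R) (eA : A ≃ Fin a) (eB : B ≃ Fin b) (eC : A ⊕ B ≃ Fin c)
    (eA' : A' ≃ Fin a') (eB' : B' ≃ Fin b') (eD : A' ⊕ B' ≃ Fin d) (f : A ≃ A') (g : B ≃ B') :
    (enumMap r eA eA' f ⊗ₘ enumMap r eB eB' g) ≫ (unionIso r eA' eB' eD).hom =
      (unionIso r eA eB eC).hom ≫ enumMap r eC eD (Equiv.sumCongr f g) := by
  rw [unionIso_hom, unionIso_hom, enumMap, enumMap, enumMap, ← Category.assoc, powMap_tensor,
    Category.assoc, Category.assoc, powMap_trans, powMap_trans]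
  congr 2
  ext j
  obtain ⟨j, rfl⟩ := (sumFin _ _).surjective j
  rcases j with j | j <;> simp [unionEquiv, blockSum]

theorem unionIso_natural_left (r : R) (eA : A ≃ Fin a) (eB : B ≃ Fin b) (eC : A ⊕ B ≃ Fin c)
    (eA' : A' ≃ Fin a') (eD : A' ⊕ B ≃ Fin d) (f : A ≃ A') :
    enumMap r eA eA' f ▷ tensorPow r b ≫ (unionIso r eA' eB eD).hom =
      (unionIso r eA eB eC).hom ≫ enumMap r eC eD (Equiv.sumCongr f (Equiv.refl B)) := by
  rw [← unionIso_natural r eA eB eC eA' eB eD, enumMap_refl, tensorHom_id]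

theorem unionIso_natural_right (r : R) (eA : A ≃ Fin a) (eB : B ≃ Fin b) (eC : A ⊕ B ≃ Fin c)
    (eB' : B' ≃ Fin b') (eD : A ⊕ B' ≃ Fin d) (g : B ≃ B') :
    tensorPow r a ◁ enumMap r eB eB' g ≫ (unionIso r eA eB' eD).hom =
      (unionIso r eA eB eC).hom ≫ enumMap r eC eD (Equiv.sumCongr (Equiv.refl A) g) := by
  rw [← unionIso_natural r eA eB eC eA eB' eD, enumMap_refl, id_tensorHom]

/-- Naturality moves every reindexing behind the product isomorphisms, where `mulIso_assoc` applies.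
What remains is an equality of bijections, checked on the three blocks. -/
theorem unionIso_assoc (r : R) (eA : A ≃ Fin a) (eB : B ≃ Fin b) (eC : C ≃ Fin c)
    {ab bc l l' : ℕ} (eAB : A ⊕ B ≃ Fin ab) (eBC : B ⊕ C ≃ Fin bc)
    (eL : (A ⊕ B) ⊕ C ≃ Fin l) (eL' : A ⊕ (B ⊕ C) ≃ Fin l') :
    (unionIso r eA eB eAB).hom ▷ tensorPow r c ≫ (unionIso r eAB eC eL).hom ≫
        enumMap r eL eL' (Equiv.sumAssoc A B C) =
      (α_ _ _ _).hom ≫ tensorPow r a ◁ (unionIso r eB eC eBC).hom ≫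
        (unionIso r eA eBC eL').hom := by
  have h := mulIso_assoc r a b c
  have h1 := powMap_whiskerRight r c (unionEquiv eA eB eAB)
  have h2 := whiskerLeft_powMap_mulIso r a (unionEquiv eB eC eBC)
  simp only [unionIso_hom, enumMap, comp_whiskerRight, whiskerLeft_comp, Category.assoc]
  rw [reassoc_of% h1, reassoc_of% h2, reassoc_of% h, ← powMap_cast]
  simp only [powMap_trans]
  congr 4
  ext j
  obtain ⟨j, rfl⟩ := (sumFin a (c + b)).surjective j
  rcases j with j | j
  · have h : finCongr (Nat.add_assoc c b a) (sumFin a (c + b) (Sum.inl j)) =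
        sumFin (b + a) c (Sum.inl (sumFin a b (Sum.inl j))) := Fin.ext (by simp)
    simp only [Equiv.trans_apply]
    rw [h]
    simp
  · obtain ⟨j, rfl⟩ := (sumFin b c).surjective j
    rcases j with j | j
    · have h : finCongr (Nat.add_assoc c b a)
          (sumFin a (c + b) (Sum.inr (sumFin b c (Sum.inl j)))) =
            sumFin (b + a) c (Sum.inl (sumFin a b (Sum.inr j))) := Fin.ext (by simp)
      simp only [Equiv.trans_apply]
      rw [h]
      simp
    · have h : finCongr (Nat.add_assoc c b a)
          (sumFin a (c + b) (Sum.inr (sumFin b c (Sum.inr j)))) =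
            sumFin (b + a) c (Sum.inr j) := Fin.ext (by simp; omega)
      simp only [Equiv.trans_apply]
      rw [h]
      simp

/-- The bijection `h₀` forces `e = 0`, after which the product isomorphism is the unitor itself and
all reindexings compose to the identity. -/
theorem unionIso_left_unit (r : R) (eA : A ≃ Fin a) (eE : E ≃ Fin e) (eC : E ⊕ A ≃ Fin c)
    (h₀ : Fin 0 ≃ Fin e) (f : E ⊕ A ≃ A) (hf : ∀ x, f (Sum.inr x) = x) :
    (λ_ (tensorPow r a)).hom =
      powMap r h₀ ▷ tensorPow r a ≫ (unionIso r eE eA eC).hom ≫ enumMap r eC eA f := by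
  obtain rfl := Fin.equiv_iff_eq.1 ⟨h₀⟩
  obtain rfl : h₀ = Equiv.refl _ := Subsingleton.elim _ _
  rw [powMap_refl, id_whiskerRight, Category.id_comp, unionIso_hom, Category.assoc, mulIso_zero,
    enumMap, powMap_trans]
  have h : (unionEquiv eE eA eC).trans (eC.symm.trans (f.trans eA)) = Equiv.refl _ := by
    ext j
    obtain ⟨j, rfl⟩ := (sumFin 0 a).surjective j
    rcases j with j | j
    · exact j.elim0
    · have h := unionEquiv_inr eE eA eC j
      simp only [Equiv.trans_apply]
      rw [h]
      simp only [Equiv.symm_apply_apply, hf, Equiv.apply_symm_apply]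
      exact ((sumFin_inr 0 a j).trans (Nat.zero_add _)).symm
  rw [h, powMap_refl]
  simp

theorem unionIso_right_unit (r : R) (eA : A ≃ Fin a) (eE : E ≃ Fin e) (eC : A ⊕ E ≃ Fin c)
    (h₀ : Fin 0 ≃ Fin e) (f : A ⊕ E ≃ A) (hf : ∀ x, f (Sum.inl x) = x) :
    (ρ_ (tensorPow r a)).hom =
      tensorPow r a ◁ powMap r h₀ ≫ (unionIso r eA eE eC).hom ≫ enumMap r eC eA f := by
  obtain rfl := Fin.equiv_iff_eq.1 ⟨h₀⟩
  obtain rfl : h₀ = Equiv.refl _ := Subsingleton.elim _ _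
  rw [powMap_refl, whiskerLeft_id, Category.id_comp, unionIso_hom, Category.assoc,
    mulIso_zero_right, ← powMap_cast, enumMap, powMap_trans, Category.assoc, powMap_trans]
  have h : (finCongr (Nat.zero_add a).symm).trans ((unionEquiv eA eE eC).trans
      (eC.symm.trans (f.trans eA))) = Equiv.refl _ := by
    ext j
    have h : finCongr (Nat.zero_add a).symm j = sumFin a 0 (Sum.inl j) := Fin.ext (by simp)
    simp only [Equiv.trans_apply]
    rw [h]
    simp [hf]
  rw [h, powMap_refl]
  simp

theorem unionIso_braid (r : R) (eA : A ≃ Fin a) (eB : B ≃ Fin b) (eC : A ⊕ B ≃ Fin c)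
    (eD : B ⊕ A ≃ Fin d) :
    (unionIso r eA eB eC).hom ≫ enumMap r eC eD (Equiv.sumComm A B) =
      (β_ _ _).hom ≫ (unionIso r eB eA eD).hom := by
  rw [unionIso_hom, unionIso_hom, ← Category.assoc (β_ _ _).hom, braiding_mulIso,
    Category.assoc, Category.assoc, enumMap, powMap_trans, powMap_trans]
  congr 2
  ext j
  obtain ⟨j, rfl⟩ := (sumFin _ _).surjective j
  rcases j with j | j <;> simp [blockSwap]

end Enumerations

/-- An enumeration of a finite set. -/
def enum (A : FinBij) : A.carrier ≃ Fin (Fintype.card A.carrier) := Fintype.equivFin A.carrier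

/-- The functor which sends a finite set to a tensor power of a given object. -/
def functor (r : R) : FinBij ⥤ R where
  obj A := tensorPow r (Fintype.card A.carrier)
  map f := enumMap r (enum _) (enum _) f.toEquiv
  map_id _ := enumMap_refl r _
  map_comp f g := enumMap_trans r _ _ _ f.toEquiv g.toEquiv

/-- The enumerations of `A`, of `B` and of their disjoint union are chosen independently; `unionIso`
contains the permutation that compares them, which is why the axioms were proved for arbitrary
enumerations. -/
instance (r : R) : (functor r).Monoidal :=
  Functor.CoreMonoidal.toMonoidal
    { εIso := powIso r (m := 0) (m' := Fintype.card Empty) (finCongr Fintype.card_empty.symm)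
      μIso A B := unionIso r (enum A) (enum B) (enum (A ⊗ B))
      μIso_hom_natural_left f _ := unionIso_natural_left r _ _ _ _ _ f.toEquiv
      μIso_hom_natural_right _ f := unionIso_natural_right r _ _ _ _ _ f.toEquiv
      associativity _ _ _ := unionIso_assoc r _ _ _ _ _ _ _
      left_unitality A := unionIso_left_unit r (enum A) (enum (𝟙_ _)) (enum (𝟙_ _ ⊗ A))
        _ (Equiv.emptySum Empty A.carrier) fun _ => rfl
      right_unitality A := unionIso_right_unit r (enum A) (enum (𝟙_ _)) (enum (A ⊗ 𝟙_ _))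
        _ (Equiv.sumEmpty A.carrier Empty) fun _ => rfl }

instance (r : R) : (functor r).Braided where
  braided A B := unionIso_braid r (enum A) (enum B) (enum (A ⊗ B)) (enum (B ⊗ A))

/-- The functor of tensor powers sends the one-element set to the given object. -/
def functorObjIso (r : R) : (functor r).obj ⟨Unit⟩ ≅ r :=
  powIso r (finCongr Fintype.card_unit) ≪≫ ρ_ r

end TensorPower

end

noncomputable section

open Functor.LaxMonoidal

/-! ### Construction and transport of braided functors -/

section Braided

variable {C : Type u} [Category.{v} C] [MonoidalCategory C]
  {D : Type u'} [Category.{v'} D] [MonoidalCategory D]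

section

variable [BraidedCategory C] [BraidedCategory D]

/-- The structure of a braided functor is transported along natural isomorphisms. -/
abbrev CategoryTheory.Functor.Braided.transport {F G : C ⥤ D} [F.Braided] (i : F ≅ G) : G.Braided :=
  letI := Functor.Monoidal.transport i
  { braided := fun X Y => by
      rw [Functor.Monoidal.transport_μ, Functor.Monoidal.transport_μ, Category.assoc,
        Category.assoc, ← i.hom.naturality, Functor.LaxBraided.braided_assoc,
        BraidedCategory.braiding_naturality_assoc] }

/-- The inverse of a braided equivalence is braided. -/
abbrev CategoryTheory.Equivalence.inverseBraided (e : C ≌ D) [e.functor.Braided] : e.inverse.Braided :=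
  letI := e.inverseMonoidal
  haveI : e.IsMonoidal := ⟨rfl, fun _ _ => rfl⟩
  { braided := fun X Y => by
      -- After applying the faithful `e.functor` and composing with the counit, the tensorators of
      -- the inverse turn into those of `e.functor`; naturality of the counit and of the braiding
      -- then gives the claim.
      apply e.functor.map_injective
      have h := e.functor_map_μ_inverse_comp_counitIso_hom_app_tensor X Y
      have h' := e.functor_map_μ_inverse_comp_counitIso_hom_app_tensor Y X
      rw [← cancel_mono (e.counitIso.hom.app (Y ⊗ X))]
      have hn := e.counitIso.hom.naturality (β_ X Y).hom
      simp only [Functor.comp_map, Functor.id_map] at hn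
      simp only [Functor.map_comp, Category.assoc]
      rw [hn, h', reassoc_of% h]
      simp }

end

/-- A constructor for braided functors. -/
abbrev CategoryTheory.Functor.Braided.ofCore [SymmetricCategory C] [SymmetricCategory D] {F : C ⥤ D}
    (h : F.CoreMonoidal)
    (hb : ∀ X Y : C, (h.μIso X Y).hom ≫ F.map (β_ X Y).hom =
      (β_ (F.obj X) (F.obj Y)).hom ≫ (h.μIso Y X).hom) : F.Braided :=
  letI := h.toMonoidal
  { braided := hb }

end Braided

/-! ### Linear extension of symmetric monoidal functors -/

namespace FreeLinear

variable {k : Type w} [CommRing k] {C : Type u} [Category.{v} C]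
  {D : Type u'} [Category.{v'} D] [Preadditive D] [Linear k D]

/-- Both sides are bilinear in `f` and `g`, so basis vectors suffice. -/
theorem extend_map_comp (F : C ⥤ D) {X Y Z : C} (f : Free.of k X ⟶ Free.of k Y)
    (g : Free.of k Y ⟶ Free.of k Z) :
    extend (fun h : X ⟶ Z => F.map h) (f ≫ g) =
      extend (fun h : X ⟶ Y => F.map h) f ≫ extend (fun h : Y ⟶ Z => F.map h) g := by
  induction f using hom_induction with
  | zero => simp
  | add _ _ h h' => simp [h, h']
  | smul _ _ h => simp [h]
  | bas f =>
    induction g using hom_induction with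
    | zero => simp
    | add _ _ h h' => simp [h, h']
    | smul _ _ h => simp [h]
    | bas g => simp [basis_comp]

theorem extend_map_id (F : C ⥤ D) (X : C) :
    extend (k := k) (fun h : X ⟶ X => F.map h) (𝟙 (Free.of k X)) = 𝟙 (F.obj X) :=
  (extend_basis (k := k) _ (𝟙 X)).trans (F.map_id X)

/-- Structure isomorphisms of the free linear category are basis vectors, so this turns the
coherence axioms of the extension into those of `F`. -/
theorem comp_extend_basis (F : C ⥤ D) {X Y : C} {W : D} (g : W ⟶ F.obj X) (f : X ⟶ Y) :
    g ≫ extend (k := k) (fun h : X ⟶ Y => F.map h) (basis f) = g ≫ F.map f := by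
  rw [extend_basis]

variable (k) in
/-- The linear extension of a functor to the free linear category. -/
def lift (F : C ⥤ D) : Free k C ⥤ D where
  obj X := F.obj X
  map {X Y} f := extend (k := k) (C := C) (X := X) (Y := Y) (fun h => F.map h) f
  map_id X := extend_map_id F X
  map_comp f g := extend_map_comp (C := C) F f g

instance (F : C ⥤ D) : (lift k F).Additive where
  map_add {X Y f g} := map_add (extend (k := k) (C := C) (X := X) (Y := Y) (fun h => F.map h)) f g

instance (F : C ⥤ D) : (lift k F).Linear k where
  map_smul {X Y} f a := map_smul (extend (k := k) (C := C) (X := X) (Y := Y) (fun h => F.map h)) a f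

variable [MonoidalCategory C] [MonoidalCategory D] [MonoidalPreadditive D] [MonoidalLinear k D]

theorem extend_whiskerR (F : C ⥤ D) [F.Monoidal] {X Y : C} (f : Free.of k X ⟶ Free.of k Y)
    (Z : C) :
    extend (fun h : X ⟶ Y => F.map h) f ▷ F.obj Z ≫ μ F Y Z =
      μ F X Z ≫ extend (fun h : X ⊗ Z ⟶ Y ⊗ Z => F.map h) (whiskerR Z f) := by
  induction f using hom_induction with
  | zero => simp
  | add _ _ h h' => simp [h, h']
  | smul _ _ h => simp [h]
  | bas f => simp

theorem extend_whiskerL (F : C ⥤ D) [F.Monoidal] (Z : C) {X Y : C}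
    (f : Free.of k X ⟶ Free.of k Y) :
    F.obj Z ◁ extend (fun h : X ⟶ Y => F.map h) f ≫ μ F Z Y =
      μ F Z X ≫ extend (fun h : Z ⊗ X ⟶ Z ⊗ Y => F.map h) (whiskerL Z f) := by
  induction f using hom_induction with
  | zero => simp
  | add _ _ h h' => simp [h, h']
  | smul _ _ h => simp [h]
  | bas f => simp

variable [SymmetricCategory C] [SymmetricCategory D]

/-- The structure isomorphisms are those of `F`. Only the naturality of the tensorator involves
general morphisms, and it extends from basis vectors by linearity. -/
instance (F : C ⥤ D) [F.Braided] : (lift k F).Braided :=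
  Functor.Braided.ofCore
    { εIso := Functor.Monoidal.εIso (C := C) F
      μIso X Y := Functor.Monoidal.μIso (C := C) F X Y
      μIso_hom_natural_left f Z := extend_whiskerR (C := C) F f Z
      μIso_hom_natural_right Z f := extend_whiskerL (C := C) F Z f
      associativity X Y Z := by
        refine Eq.trans ?_ (associativity (C := C) F X Y Z)
        exact congrArg (fun t => μ (C := C) F X Y ▷ F.obj Z ≫ t)
          (comp_extend_basis (k := k) (C := C) F _ _)
      left_unitality X := by
        refine (left_unitality (C := C) F X).trans ?_
        exact congrArg (fun t => ε F ▷ F.obj X ≫ t)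
          (comp_extend_basis (k := k) (C := C) F _ _).symm
      right_unitality X := by
        refine (right_unitality (C := C) F X).trans ?_
        exact congrArg (fun t => F.obj X ◁ ε F ≫ t)
          (comp_extend_basis (k := k) (C := C) F _ _).symm }
    (fun X Y => (comp_extend_basis (k := k) (C := C) F _ _).trans
      (Functor.LaxBraided.braided (C := C) X Y))

end FreeLinear

/-! ### Functoriality of the completion under finite biproducts -/

namespace AddCompletion

variable {C : Type u} [Category.{v} C] [Preadditive C]
  {D : Type u'} [Category.{v'} D] [Preadditive D]

variable (F : C ⥤ D) [F.Additive]

/-- The image of a finite family of objects. -/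
abbrev mapObj (M : Mat_ C) : Mat_ D := ⟨M.ι, fun i => F.obj (M.X i)⟩

/-- The image of a matrix of morphisms. -/
def mapHom {M N : Mat_ C} (f : M ⟶ N) : mapObj F M ⟶ mapObj F N :=
  ofEntries fun i j => F.map (f i j)

theorem mapHom_apply {M N : Mat_ C} (f : M ⟶ N) (i j) : mapHom F f i j = F.map (f i j) := rfl

/-- Identities, tensorators and coherence isomorphisms are all of the form `graph`. With
`graph_comp_graph` and `kron_graph`, this reduces each coherence axiom to the axiom of `F` for
single entries. -/
theorem mapHom_graph {M N : Mat_ C} (e : M.ι → N.ι) (φ : ∀ i, M.X i ⟶ N.X (e i)) :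
    mapHom F (graph e φ) =
      graph (M := mapObj F M) (N := mapObj F N) e (fun i => F.map (φ i)) := by
  ext i j
  rw [mapHom_apply]
  by_cases h : e i = j
  · subst h
    rw [graph_apply_self, graph_apply_self (M := mapObj F M) (N := mapObj F N)]
  · rw [graph_apply_ne e φ h, graph_apply_ne (M := mapObj F M) (N := mapObj F N) e _ h,
      F.map_zero]

theorem mapHom_id (M : Mat_ C) : mapHom F (𝟙 M) = 𝟙 (mapObj F M) := by
  rw [id_eq_graph, id_eq_graph, mapHom_graph]
  exact graph_congr fun i => F.map_id _

theorem mapHom_comp {M N K : Mat_ C} (f : M ⟶ N) (g : N ⟶ K) :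
    mapHom F (f ≫ g) = mapHom F f ≫ mapHom F g := by
  ext i j
  change F.map (∑ l, f i l ≫ g l j) = ∑ l, F.map (f i l) ≫ F.map (g l j)
  simp

/-- The functor between additive completions which is induced by an additive functor. -/
def map : Mat_ C ⥤ Mat_ D where
  obj M := mapObj F M
  map f := mapHom F f
  map_id M := mapHom_id F M
  map_comp f g := mapHom_comp F f g

instance : (map F).Additive where
  map_add {M N f g} := by
    ext i j
    exact F.map_add

instance (k : Type w) [CommRing k] [Linear k C] [Linear k D] [F.Linear k] :
    (map F).Linear k where
  map_smul {M N} f a := by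
    ext i j
    exact F.map_smul a (f i j)

variable [MonoidalCategory C] [MonoidalCategory D] [F.Monoidal]

/-- The tensorator of the functor between additive completions. -/
def mapμ (M N : Mat_ C) : tens (mapObj F M) (mapObj F N) ≅ mapObj F (tens M N) :=
  graphIso (M := tens (mapObj F M) (mapObj F N)) (N := mapObj F (tens M N))
    (Equiv.refl _) fun p => Functor.Monoidal.μIso F (M.X p.1) (N.X p.2)

theorem mapμ_hom (M N : Mat_ C) : (mapμ F M N).hom =
    graph (M := tens (mapObj F M) (mapObj F N)) (N := mapObj F (tens M N))
      (fun p => p) (fun p => μ F (M.X p.1) (N.X p.2)) := rfl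

/-- The unit comparison of the functor between additive completions. -/
def mapε : (unit : Mat_ D) ≅ mapObj F unit :=
  graphIso (M := (unit : Mat_ D)) (N := mapObj F unit) (Equiv.refl _)
    fun _ => Functor.Monoidal.εIso F

theorem mapε_hom : (mapε F).hom = graph (M := (unit : Mat_ D)) (N := mapObj F unit)
    (fun p => p) (fun _ => ε F) := rfl

/-- The tensorator is diagonal, so each entry is an instance of the naturality of the tensorator of
`F`. -/
theorem mapμ_natural {M N M' N' : Mat_ C} (f : M ⟶ M') (g : N ⟶ N') :
    kron (mapHom F f) (mapHom F g) ≫ (mapμ F M' N').hom =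
      (mapμ F M N).hom ≫ mapHom F (kron f g) := by
  rw [mapμ_hom, mapμ_hom]
  ext ⟨i, i'⟩ ⟨j, j'⟩
  refine Eq.trans ?_ (graph_comp_apply _ _ _ _ _).symm
  refine (comp_graph_apply (M := tens (mapObj F M) (mapObj F N))
    (N := tens (mapObj F M') (mapObj F N')) (K := mapObj F (tens M' N'))
    (fun p => p) Function.injective_id
    (fun p => μ F (M'.X p.1) (N'.X p.2)) _ (i, i') (j, j')).trans ?_
  exact μ_natural F _ _

variable [MonoidalPreadditive C] [MonoidalPreadditive D]

theorem map_associativity (M N K : Mat_ C) :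
    kron (mapμ F M N).hom (𝟙 (mapObj F K)) ≫ (mapμ F (tens M N) K).hom ≫
        mapHom F (assoc M N K).hom =
      (assoc _ _ _).hom ≫ kron (𝟙 (mapObj F M)) (mapμ F N K).hom ≫
        (mapμ F M (tens N K)).hom := by
  simp only [assoc_hom, mapμ_hom, mapHom_graph, id_eq_graph, kron_graph, graph_comp_graph]
  refine graph_congr fun p => ?_
  simp

theorem map_left_unitality (M : Mat_ C) :
    (leftU (mapObj F M)).hom = kron (mapε F).hom (𝟙 (mapObj F M)) ≫
      (mapμ F unit M).hom ≫ mapHom F (leftU M).hom := by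
  simp only [leftU_hom, mapμ_hom, mapε_hom, mapHom_graph, id_eq_graph, kron_graph,
    graph_comp_graph]
  refine graph_congr fun p => ?_
  simp

theorem map_right_unitality (M : Mat_ C) :
    (rightU (mapObj F M)).hom = kron (𝟙 (mapObj F M)) (mapε F).hom ≫
      (mapμ F M unit).hom ≫ mapHom F (rightU M).hom := by
  simp only [rightU_hom, mapμ_hom, mapε_hom, mapHom_graph, id_eq_graph, kron_graph,
    graph_comp_graph]
  refine graph_congr fun p => ?_
  simp

/-- The functor between additive completions is monoidal. -/
def mapCore : (map F).CoreMonoidal where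
  εIso := mapε F
  μIso := mapμ F
  μIso_hom_natural_left f K := by
    have h := mapμ_natural F f (𝟙 K)
    rw [mapHom_id] at h
    exact h
  μIso_hom_natural_right K f := by
    have h := mapμ_natural F (𝟙 K) f
    rw [mapHom_id] at h
    exact h
  associativity := map_associativity F
  left_unitality := map_left_unitality F
  right_unitality := map_right_unitality F

/-- A family with one member. -/
abbrev embObj (X : C) : Mat_ C := ⟨PUnit, fun _ => X⟩

/-- A matrix with one entry. -/
def embHom {X Y : C} (f : X ⟶ Y) : embObj X ⟶ embObj Y := ofEntries fun _ _ => f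

theorem embHom_eq_graph {X Y : C} (f : X ⟶ Y) : embHom f =
    graph (M := embObj X) (N := embObj Y) (fun _ => PUnit.unit) (fun _ => f) := by
  ext i j
  exact (graph_apply_self (M := embObj X) (N := embObj Y) _ (fun _ => f) i).symm

/-- The tensorator of the embedding into the additive completion. -/
def embμ (X Y : C) : tens (embObj X) (embObj Y) ≅ embObj (X ⊗ Y) :=
  graphIso (M := tens (embObj X) (embObj Y)) (N := embObj (X ⊗ Y))
    (Equiv.punitProd PUnit) fun _ => Iso.refl _

theorem embμ_hom (X Y : C) : (embμ X Y).hom =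
    graph (M := tens (embObj X) (embObj Y)) (N := embObj (X ⊗ Y))
      (fun _ => PUnit.unit) (fun _ => 𝟙 (X ⊗ Y)) := rfl

theorem embμ_natural {X Y X' Y' : C} (f : X ⟶ X') (g : Y ⟶ Y') :
    kron (embHom f) (embHom g) ≫ (embμ X' Y').hom = (embμ X Y).hom ≫ embHom (f ⊗ₘ g) := by
  simp only [embμ_hom, embHom_eq_graph, kron_graph, graph_comp_graph]
  refine graph_congr fun p => ?_
  simp

theorem embHom_id (X : C) : embHom (𝟙 X) = 𝟙 (embObj X) := (Mat_.embedding C).map_id X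

theorem emb_associativity (X Y Z : C) :
    kron (embμ X Y).hom (𝟙 (embObj Z)) ≫ (embμ (X ⊗ Y) Z).hom ≫ embHom (α_ X Y Z).hom =
      (assoc _ _ _).hom ≫ kron (𝟙 (embObj X)) (embμ Y Z).hom ≫ (embμ X (Y ⊗ Z)).hom := by
  simp only [assoc_hom, embμ_hom, embHom_eq_graph, id_eq_graph, kron_graph, graph_comp_graph]
  refine graph_congr fun p => ?_
  simp

theorem emb_left_unitality (X : C) :
    (leftU (embObj X)).hom = kron (𝟙 unit) (𝟙 (embObj X)) ≫
      (embμ (𝟙_ C) X).hom ≫ embHom (λ_ X).hom := by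
  simp only [leftU_hom, embμ_hom, embHom_eq_graph, id_eq_graph, kron_graph, graph_comp_graph]
  refine graph_congr fun p => ?_
  simp

theorem emb_right_unitality (X : C) :
    (rightU (embObj X)).hom = kron (𝟙 (embObj X)) (𝟙 unit) ≫
      (embμ X (𝟙_ C)).hom ≫ embHom (ρ_ X).hom := by
  simp only [rightU_hom, embμ_hom, embHom_eq_graph, id_eq_graph, kron_graph, graph_comp_graph]
  refine graph_congr fun p => ?_
  simp

/-- The embedding into the additive completion is monoidal. -/
def embCore : (Mat_.embedding C).CoreMonoidal where
  εIso := Iso.refl _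
  μIso := embμ
  μIso_hom_natural_left f K := by
    have h := embμ_natural f (𝟙 K)
    rw [embHom_id, tensorHom_id] at h
    exact h
  μIso_hom_natural_right K f := by
    have h := embμ_natural (𝟙 K) f
    rw [embHom_id, id_tensorHom] at h
    exact h
  associativity := emb_associativity
  left_unitality := emb_left_unitality
  right_unitality := emb_right_unitality

variable [SymmetricCategory C] [SymmetricCategory D]

theorem map_braided (F : C ⥤ D) [F.Additive] [F.Braided] (M N : Mat_ C) :
    (mapμ F M N).hom ≫ mapHom F (braid M N).hom =
      (braid _ _).hom ≫ (mapμ F N M).hom := by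
  simp only [braid_hom, mapμ_hom, mapHom_graph, graph_comp_graph]
  refine graph_congr fun p => ?_
  simp

instance (F : C ⥤ D) [F.Additive] [F.Braided] : (map F).Braided :=
  Functor.Braided.ofCore (mapCore F) (map_braided F)

theorem emb_braided (X Y : C) :
    (embμ X Y).hom ≫ embHom (β_ X Y).hom = (braid _ _).hom ≫ (embμ Y X).hom := by
  simp only [braid_hom, embμ_hom, embHom_eq_graph, graph_comp_graph]
  refine graph_congr fun p => ?_
  simp

instance : (Mat_.embedding C).Braided := Functor.Braided.ofCore embCore emb_braided

end AddCompletion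

end

noncomputable section

open Functor.LaxMonoidal

/-! ### Functoriality of the idempotent completion -/

namespace IdemCompletion

open Idempotents

variable {C : Type u} [Category.{v} C] {D : Type u'} [Category.{v'} D]

/-- The image of an idempotent. -/
abbrev mapObj (F : C ⥤ D) (P : Karoubi C) : Karoubi D where
  X := F.obj P.X
  p := F.map P.p
  idem := by rw [← F.map_comp, P.idem]

/-- The functor between idempotent completions which is induced by a functor. -/
def map (F : C ⥤ D) : Karoubi C ⥤ Karoubi D where
  obj P := mapObj F P
  map {P Q} f :=
    { f := F.map f.f
      comm := by
        change F.map P.p ≫ F.map f.f ≫ F.map Q.p = F.map f.f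
        simp only [← F.map_comp, f.comm] }
  map_comp f g := Karoubi.hom_ext _ _ (F.map_comp f.f g.f)

instance [Preadditive C] [Preadditive D] (F : C ⥤ D) [F.Additive] : (map F).Additive where
  map_add := Karoubi.hom_ext _ _ F.map_add

instance [Preadditive C] [Preadditive D] (F : C ⥤ D) (k : Type w) [CommRing k] [Linear k C]
    [Linear k D] [F.Linear k] : (map F).Linear k where
  map_smul f a := Karoubi.hom_ext _ _ (F.map_smul a f.f)

variable [MonoidalCategory C] [MonoidalCategory D]

/-- The tensorator of the functor between idempotent completions. -/
def mapμ (F : C ⥤ D) [F.Monoidal] (P Q : Karoubi C) :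
    tens (mapObj F P) (mapObj F Q) ≅ mapObj F (tens P Q) :=
  isoOf (P := tens (mapObj F P) (mapObj F Q)) (Q := mapObj F (tens P Q))
    (Functor.Monoidal.μIso F P.X Q.X) (μ_natural F P.p Q.p)

theorem mapμ_hom_f (F : C ⥤ D) [F.Monoidal] (P Q : Karoubi C) :
    (mapμ F P Q).hom.f = (F.map P.p ⊗ₘ F.map Q.p) ≫ μ F P.X Q.X := rfl

/-- The idempotent built into the tensorator is absorbed by `f` and `g` on either side. -/
theorem mapμ_natural (F : C ⥤ D) [F.Monoidal] {P Q P' Q' : Karoubi C} (f : P ⟶ P') (g : Q ⟶ Q') :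
    (F.map f.f ⊗ₘ F.map g.f) ≫ (mapμ F P' Q').hom.f =
      (mapμ F P Q).hom.f ≫ F.map (f.f ⊗ₘ g.f) := by
  rw [mapμ_hom_f, mapμ_hom_f, Category.assoc, ← μ_natural, tensorHom_comp_tensorHom_assoc,
    tensorHom_comp_tensorHom_assoc]
  simp only [← F.map_comp, Karoubi.comp_p, Karoubi.p_comp]

theorem map_idem (F : C ⥤ D) (P : Karoubi C) : F.map P.p ≫ F.map P.p = F.map P.p := by
  rw [← F.map_comp, P.idem]

theorem comm_whiskerLeft {X Y Z : C} {p : X ⟶ X} {q : Y ⟶ Y} {e : X ⟶ Y}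
    (h : p ≫ e = e ≫ q) (r : Z ⟶ Z) : (r ⊗ₘ p) ≫ Z ◁ e = Z ◁ e ≫ (r ⊗ₘ q) := by
  rw [← id_tensorHom, tensorHom_comp_tensorHom, tensorHom_comp_tensorHom, h, Category.comp_id,
    Category.id_comp]

/-- Each arrow is an idempotent followed by a structure morphism that commutes with the idempotents.
By `comp_aux` all idempotents collect into a single one in front, and the associativity axiom of `F`
remains. -/
theorem map_associativity (F : C ⥤ D) [F.Monoidal] (P Q R : Karoubi C) :
    ((mapμ F P Q).hom.f ⊗ₘ F.map R.p) ≫ (mapμ F (tens P Q) R).hom.f ≫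
        F.map (((P.p ⊗ₘ Q.p) ⊗ₘ R.p) ≫ (α_ P.X Q.X R.X).hom) =
      (((F.map P.p ⊗ₘ F.map Q.p) ⊗ₘ F.map R.p) ≫ (α_ _ _ _).hom) ≫
        (F.map P.p ⊗ₘ (mapμ F Q R).hom.f) ≫ (mapμ F P (tens Q R)).hom.f := by
  have hP := map_idem F P
  have hQ := map_idem F Q
  have hR := map_idem F R
  have hPQ : F.map (P.p ⊗ₘ Q.p) ≫ F.map (P.p ⊗ₘ Q.p) = F.map (P.p ⊗ₘ Q.p) :=
    map_idem F (tens P Q)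
  rw [mapμ_hom_f, comp_tensor, mapμ_hom_f F (tens P Q) R, mapμ_hom_f, tensor_comp',
    mapμ_hom_f F P (tens Q R), F.map_comp]
  rw [comp_aux (μ_natural F (P.p ⊗ₘ Q.p) R.p) (tensor_idem hPQ hR),
    comp_aux (comm_whiskerRight (μ_natural F P.p Q.p) (F.map R.p))
      (tensor_idem (tensor_idem hP hQ) hR),
    comp_aux (comm_whiskerLeft (μ_natural F Q.p R.p) (F.map P.p))
      (tensor_idem hP (tensor_idem hQ hR)),
    comp_aux (MonoidalCategory.associator_naturality (F.map P.p) (F.map Q.p) (F.map R.p))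
      (tensor_idem (tensor_idem hP hQ) hR), associativity]

theorem map_left_unitality (F : C ⥤ D) [F.Monoidal] (P : Karoubi C) :
    (𝟙 (𝟙_ D) ⊗ₘ F.map P.p) ≫ (λ_ (F.obj P.X)).hom =
      (ε F ⊗ₘ F.map P.p) ≫ (mapμ F unit P).hom.f ≫ F.map ((𝟙 (𝟙_ C) ⊗ₘ P.p) ≫ (λ_ P.X).hom) := by
  -- `comp_aux` needs an idempotent in front of each structure morphism, so the whiskered unit
  -- comparison is brought into this shape; `h2` is the commutation that `comp_aux` asks for.
  have h : (ε F ⊗ₘ F.map P.p) = (𝟙 (𝟙_ D) ⊗ₘ F.map P.p) ≫ ε F ▷ F.obj P.X := by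
    rw [← tensorHom_id, tensorHom_comp_tensorHom, Category.id_comp, Category.comp_id]
  have h2 : (𝟙 (𝟙_ D) ⊗ₘ F.map P.p) ≫ ε F ▷ F.obj P.X =
      ε F ▷ F.obj P.X ≫ (F.map (𝟙 (𝟙_ C)) ⊗ₘ F.map P.p) := by
    rw [F.map_id, ← tensorHom_id, tensorHom_comp_tensorHom, tensorHom_comp_tensorHom]
    simp only [Category.id_comp, Category.comp_id]
  rw [h, mapμ_hom_f, F.map_comp, comp_aux (μ_natural F (𝟙 (𝟙_ C)) P.p)
      (tensor_idem (by simp) (map_idem F P)),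
    comp_aux h2 (tensor_idem (by simp) (map_idem F P)), left_unitality]

theorem map_right_unitality (F : C ⥤ D) [F.Monoidal] (P : Karoubi C) :
    (F.map P.p ⊗ₘ 𝟙 (𝟙_ D)) ≫ (ρ_ (F.obj P.X)).hom =
      (F.map P.p ⊗ₘ ε F) ≫ (mapμ F P unit).hom.f ≫ F.map ((P.p ⊗ₘ 𝟙 (𝟙_ C)) ≫ (ρ_ P.X).hom) := by
  have h : (F.map P.p ⊗ₘ ε F) = (F.map P.p ⊗ₘ 𝟙 (𝟙_ D)) ≫ F.obj P.X ◁ ε F := by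
    rw [← id_tensorHom, tensorHom_comp_tensorHom, Category.id_comp, Category.comp_id]
  have h2 : (F.map P.p ⊗ₘ 𝟙 (𝟙_ D)) ≫ F.obj P.X ◁ ε F =
      F.obj P.X ◁ ε F ≫ (F.map P.p ⊗ₘ F.map (𝟙 (𝟙_ C))) := by
    rw [F.map_id, ← id_tensorHom, tensorHom_comp_tensorHom, tensorHom_comp_tensorHom]
    simp
  rw [h, mapμ_hom_f, F.map_comp, comp_aux (μ_natural F P.p (𝟙 (𝟙_ C)))
      (tensor_idem (map_idem F P) (by simp)),
    comp_aux h2 (tensor_idem (map_idem F P) (by simp)), right_unitality]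

/-- The unit comparison of the functor between idempotent completions. -/
def mapε (F : C ⥤ D) [F.Monoidal] : (unit : Karoubi D) ≅ mapObj F unit :=
  isoOf (P := (unit : Karoubi D)) (Q := mapObj F unit) (Functor.Monoidal.εIso F) (by simp)

theorem mapε_hom_f (F : C ⥤ D) [F.Monoidal] : (mapε F).hom.f = ε F := by
  simp [mapε]

/-- The functor between idempotent completions is monoidal. -/
def mapCore (F : C ⥤ D) [F.Monoidal] : (map F).CoreMonoidal where
  εIso := mapε F
  μIso := mapμ F
  μIso_hom_natural_left f R := Karoubi.hom_ext _ _ (mapμ_natural F f (𝟙 R))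
  μIso_hom_natural_right R f := Karoubi.hom_ext _ _ (mapμ_natural F (𝟙 R) f)
  associativity P Q R := Karoubi.hom_ext _ _ (map_associativity F P Q R)
  left_unitality P := Karoubi.hom_ext _ _ (by
    have h := map_left_unitality F P
    rw [← mapε_hom_f] at h
    exact h)
  right_unitality P := Karoubi.hom_ext _ _ (by
    have h := map_right_unitality F P
    rw [← mapε_hom_f] at h
    exact h)

/-- The tensorator of the embedding into the idempotent completion. -/
def embμ (X Y : C) : tens (⟨X, 𝟙 X, Category.comp_id _⟩ : Karoubi C) ⟨Y, 𝟙 Y, Category.comp_id _⟩ ≅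
    ⟨X ⊗ Y, 𝟙 (X ⊗ Y), Category.comp_id _⟩ :=
  isoOf (Iso.refl _) (by simp)

theorem embμ_hom_f (X Y : C) : (embμ X Y).hom.f = 𝟙 _ := by
  simp [embμ]

/-- The embedding into the idempotent completion is monoidal. -/
def embCore : (toKaroubi C).CoreMonoidal where
  εIso := Iso.refl _
  μIso := embμ
  μIso_hom_natural_left {X Y} f Z := Karoubi.hom_ext _ _ (by
    refine Eq.trans (b := (f ⊗ₘ 𝟙 Z) ≫ (embμ Y Z).hom.f) rfl ?_
    refine Eq.trans ?_ (b := (embμ X Z).hom.f ≫ f ▷ Z) rfl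
    simp [embμ_hom_f])
  μIso_hom_natural_right {X Y} Z f := Karoubi.hom_ext _ _ (by
    refine Eq.trans (b := (𝟙 Z ⊗ₘ f) ≫ (embμ Z Y).hom.f) rfl ?_
    refine Eq.trans ?_ (b := (embμ Z X).hom.f ≫ Z ◁ f) rfl
    simp [embμ_hom_f])
  associativity X Y Z := Karoubi.hom_ext _ _ (by
    refine Eq.trans (b := ((embμ X Y).hom.f ⊗ₘ 𝟙 Z) ≫ (embμ (X ⊗ Y) Z).hom.f ≫ (α_ X Y Z).hom)
      rfl ?_
    refine Eq.trans ?_ (b := (((𝟙 X ⊗ₘ 𝟙 Y) ⊗ₘ 𝟙 Z) ≫ (α_ X Y Z).hom) ≫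
      (𝟙 X ⊗ₘ (embμ Y Z).hom.f) ≫ (embμ X (Y ⊗ Z)).hom.f) rfl
    simp [embμ_hom_f])
  left_unitality X := Karoubi.hom_ext _ _ (by
    refine Eq.trans (b := (𝟙 (𝟙_ C) ⊗ₘ 𝟙 X) ≫ (λ_ X).hom) rfl ?_
    refine Eq.trans ?_ (b := (𝟙 (𝟙_ C) ⊗ₘ 𝟙 X) ≫ (embμ (𝟙_ C) X).hom.f ≫ (λ_ X).hom) rfl
    simp [embμ_hom_f])
  right_unitality X := Karoubi.hom_ext _ _ (by
    refine Eq.trans (b := (𝟙 X ⊗ₘ 𝟙 (𝟙_ C)) ≫ (ρ_ X).hom) rfl ?_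
    refine Eq.trans ?_ (b := (𝟙 X ⊗ₘ 𝟙 (𝟙_ C)) ≫ (embμ X (𝟙_ C)).hom.f ≫ (ρ_ X).hom) rfl
    simp [embμ_hom_f])

instance [Preadditive C] (k : Type w) [CommRing k] [Linear k C] : (toKaroubi C).Linear k where
  map_smul _ _ := rfl

variable [SymmetricCategory C] [SymmetricCategory D]

theorem map_braided (F : C ⥤ D) [F.Braided] (P Q : Karoubi C) :
    (mapμ F P Q).hom.f ≫ F.map ((P.p ⊗ₘ Q.p) ≫ (β_ P.X Q.X).hom) =
      ((F.map P.p ⊗ₘ F.map Q.p) ≫ (β_ _ _).hom) ≫ (mapμ F Q P).hom.f := by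
  have hPQ := tensor_idem (map_idem F P) (map_idem F Q)
  rw [mapμ_hom_f, mapμ_hom_f, F.map_comp, comp_aux (μ_natural F P.p Q.p) hPQ,
    comp_aux (BraidedCategory.braiding_naturality (F.map P.p) (F.map Q.p)) hPQ,
    Functor.LaxBraided.braided]

instance (F : C ⥤ D) [F.Braided] : (map F).Braided :=
  Functor.Braided.ofCore (mapCore F) fun P Q => Karoubi.hom_ext _ _ (map_braided F P Q)

instance : (toKaroubi C).Braided :=
  Functor.Braided.ofCore embCore fun X Y => Karoubi.hom_ext _ _ (by
    refine Eq.trans (b := (embμ X Y).hom.f ≫ (β_ X Y).hom) rfl ?_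
    refine Eq.trans ?_ (b := ((𝟙 X ⊗ₘ 𝟙 Y) ≫ (β_ X Y).hom) ≫ (embμ Y X).hom.f) rfl
    simp [embμ_hom_f])

end IdemCompletion

/-! ### The projection to the quotient by a 2-ideal as a symmetric monoidal functor -/

namespace TwoIdeal

open Limits

attribute [local instance] hasBinaryBiproducts_of_finite_biproducts

variable {R : Type u} [Category.{v} R] [Preadditive R] [HasFiniteBiproducts R]
  [MonoidalCategory R] [MonoidalPreadditive R] [SymmetricCategory R] (I : TwoIdeal R)

/-- The projection to the quotient by a 2-ideal is monoidal. -/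
def quotientCore : (CategoryTheory.Quotient.functor I.rel).CoreMonoidal where
  εIso := Iso.refl _
  μIso _ _ := Iso.refl _
  μIso_hom_natural_left _ _ := (Category.comp_id _).trans (Category.id_comp _).symm
  μIso_hom_natural_right _ _ := (Category.comp_id _).trans (Category.id_comp _).symm
  associativity X Y Z := by
    -- The quotient has the objects and structure morphisms of `R`, and the tensorators are
    -- identities. Both sides are therefore images of composites in `R` that agree there.
    refine Eq.trans (b := ((CategoryTheory.Quotient.functor I.rel).map
      (𝟙 (X ⊗ Y) ▷ Z ≫ 𝟙 _ ≫ (α_ X Y Z).hom))) ?_ ?_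
    · simp only [Functor.map_comp]
      rfl
    · refine Eq.trans ?_ (b := ((CategoryTheory.Quotient.functor I.rel).map
        ((α_ X Y Z).hom ≫ X ◁ 𝟙 (Y ⊗ Z) ≫ 𝟙 _))) ?_
      · simp
      · simp only [Functor.map_comp]
        rfl
  left_unitality X := by
    refine Eq.trans ?_ (b := ((CategoryTheory.Quotient.functor I.rel).map
      (𝟙 (𝟙_ R) ▷ X ≫ 𝟙 _ ≫ (λ_ X).hom))) ?_
    · simp
      rfl
    · simp only [Functor.map_comp]
      rfl
  right_unitality X := by
    refine Eq.trans ?_ (b := ((CategoryTheory.Quotient.functor I.rel).map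
      (X ◁ 𝟙 (𝟙_ R) ≫ 𝟙 _ ≫ (ρ_ X).hom))) ?_
    · simp
      rfl
    · simp only [Functor.map_comp]
      rfl

instance : (CategoryTheory.Quotient.functor I.rel).Braided :=
  Functor.Braided.ofCore I.quotientCore fun _ _ =>
    (Category.id_comp _).trans (Category.comp_id _).symm

end TwoIdeal

end

noncomputable section

open Functor.LaxMonoidal Limits Idempotents

attribute [local instance] hasBinaryBiproducts_of_finite_biproducts

/-! ### Annihilated objects and factorization through the quotient -/

namespace TwoIdeal

variable {R : Type u} [Category.{v} R] [Preadditive R] [HasFiniteBiproducts R]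
  [MonoidalCategory R] [MonoidalPreadditive R] [SymmetricCategory R]
  {D : Type u'} [Category.{v'} D] [Preadditive D] [MonoidalCategory D] [MonoidalPreadditive D]
  [SymmetricCategory D]

/-- The 2-ideal of the objects which are annihilated by a functor. -/
def ker (F : R ⥤ D) [F.Additive] [F.Monoidal] : TwoIdeal R where
  mem X := IsZero (F.obj X)
  zero_mem Z hZ := F.map_isZero hZ
  biprod_mem X Y hX hY := by
    rw [IsZero.iff_id_eq_zero, ← F.map_id, ← biprod.total, F.map_add, F.map_comp, F.map_comp,
      hX.eq_zero_of_tgt (F.map biprod.fst), hY.eq_zero_of_tgt (F.map biprod.snd)]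
    simp
  iso_mem X Y e hX := hX.of_iso (F.mapIso e.symm)
  retract_mem X Y r hY := by
    rw [IsZero.iff_id_eq_zero, ← F.map_id, ← r.retract, F.map_comp,
      hY.eq_zero_of_tgt (F.map r.i), zero_comp]
  tensor_mem X Y hX := by
    refine IsZero.of_iso ?_ (Functor.Monoidal.μIso F X Y).symm
    rw [IsZero.iff_id_eq_zero, ← id_whiskerRight, hX.eq_zero_of_tgt (𝟙 _),
      MonoidalPreadditive.zero_whiskerRight]

/-- The difference of equivalent morphisms factors through an object that `F` sends to zero. -/
theorem map_eq_of_rel (F : R ⥤ D) [F.Additive] {I : TwoIdeal R}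
    (hI : ∀ X, I.mem X → IsZero (F.obj X)) {X Y : R} {f g : X ⟶ Y} (h : I.rel f g) :
    F.map f = F.map g := by
  obtain ⟨J, hJ, a, b, e⟩ := h
  rw [← sub_eq_zero, ← F.map_sub, ← e, F.map_comp, (hI J hJ).eq_zero_of_tgt (F.map a), zero_comp]

variable (F : R ⥤ D) [F.Additive] (I : TwoIdeal R)
  (hI : ∀ X, I.mem X → IsZero (F.obj X))

/-- The factorization of a functor through the quotient by a 2-ideal which it annihilates. -/
def lift : CategoryTheory.Quotient I.rel ⥤ D :=
  CategoryTheory.Quotient.lift I.rel F fun _ _ _ _ h => map_eq_of_rel F hI h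

instance : (lift F I hI).Additive where
  map_add := by
    rintro X Y ⟨f⟩ ⟨g⟩
    exact F.map_add

instance (k : Type w) [CommRing k] [Linear k R] [Linear k D] [F.Linear k] :
    (lift F I hI).Linear k where
  map_smul := by
    rintro X Y ⟨f⟩ a
    exact F.map_smul a f

/-- The factorization through the quotient by a 2-ideal is braided. -/
instance [F.Braided] : (lift F I hI).Braided :=
  Functor.Braided.ofCore
    { εIso := Functor.Monoidal.εIso F
      μIso X Y := Functor.Monoidal.μIso F X.as Y.as
      μIso_hom_natural_left := by
        rintro X Y ⟨f⟩ Z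
        exact μ_natural_left F f Z.as
      μIso_hom_natural_right := by
        rintro X Y Z ⟨f⟩
        exact μ_natural_right F Z.as f
      associativity X Y Z := associativity F X.as Y.as Z.as
      left_unitality X := left_unitality F X.as
      right_unitality X := right_unitality F X.as }
    fun X Y => Functor.LaxBraided.braided X.as Y.as

end TwoIdeal

/-! ### A Cauchy complete category is its own Cauchy completion -/

namespace CauchyCompletion

variable (R : Type u) [Category.{v} R] [Preadditive R]

/-- The embedding of a category into its Cauchy completion. -/
abbrev embedding : R ⥤ CauchyCompletion R := Mat_.embedding R ⋙ toKaroubi (Mat_ R)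

/-- A family is the biproduct of its embedded members, and the additive embedding preserves the
biproduct which already exists in `R`. -/
instance [HasFiniteBiproducts R] : (Mat_.embedding R).EssSurj where
  mem_essImage M :=
    ⟨⨁ M.X, ⟨(Mat_.embedding R).mapBiproduct M.X ≪≫ (Mat_.isoBiproductEmbedding M).symm⟩⟩

instance [HasFiniteBiproducts R] : (Mat_.embedding R).IsEquivalence where

theorem isIdempotentComplete_mat [HasFiniteBiproducts R] [IsIdempotentComplete R] :
    IsIdempotentComplete (Mat_ R) :=
  (isIdempotentComplete_iff_of_equivalence (Mat_.embedding R).asEquivalence).1 inferInstance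

/-- Splitting of idempotents passes to `Mat_ R` along the equivalence with `R`, so the second
completion changes nothing either. -/
theorem isEquivalence_embedding [HasFiniteBiproducts R] [IsIdempotentComplete R] :
    (embedding R).IsEquivalence :=
  haveI := isIdempotentComplete_mat R
  inferInstance

end CauchyCompletion

/-- A Cauchy complete category is equivalent to its Cauchy completion. -/
def CauchyCompletion.equivalence (R : Type u) [Category.{v} R] [Preadditive R]
    [HasFiniteBiproducts R] [IsIdempotentComplete R] : R ≌ CauchyCompletion R :=
  haveI := CauchyCompletion.isEquivalence_embedding R
  (CauchyCompletion.embedding R).asEquivalence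

/-! ### The map out of the free 2-rig given by an object -/

section Extension

variable {k : Type w} [Field k] {R : Type u} [Category.{v} R] [Preadditive R] [Linear k R]
  [MonoidalCategory R] [SymmetricCategory R] [MonoidalPreadditive R] [MonoidalLinear k R]
  [HasFiniteBiproducts R] [IsIdempotentComplete R]

namespace CauchyCompletion

instance : (equivalence R).functor.Braided := inferInstanceAs (embedding R).Braided

instance : (equivalence R).functor.Additive := inferInstanceAs (embedding R).Additive

instance : (Mat_.embedding R).Linear k where
  map_smul _ _ := rfl

instance : (equivalence R).functor.Linear k := inferInstanceAs ((embedding R).Linear k)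

instance : (equivalence R).inverse.Braided := (equivalence R).inverseBraided

instance : (equivalence R).inverse.Additive := (equivalence R).inverse_additive

instance : (equivalence R).inverse.Linear k := (equivalence R).inverseLinear k

end CauchyCompletion

/-- The functor between idempotent completions extends the given one. -/
def IdemCompletion.mapToKaroubiObjIso {C : Type u} [Category.{v} C] {D : Type u'} [Category.{v'} D]
    (F : C ⥤ D) (X : C) : (map F).obj ((toKaroubi C).obj X) ≅ (toKaroubi D).obj (F.obj X) :=
  isoOf (P := (map F).obj ((toKaroubi C).obj X)) (Q := (toKaroubi D).obj (F.obj X)) (Iso.refl _)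
    (((Category.comp_id _).trans (F.map_id X)).trans (Category.id_comp _).symm)

namespace FreeTwoRig

variable (k)

/-- The functor between Cauchy completions which is given by the tensor powers of an object. -/
def completedFunctor (r : R) : FreeTwoRig k ⥤ CauchyCompletion R :=
  IdemCompletion.map (AddCompletion.map (FreeLinear.lift k (TensorPower.functor r)))

/-- The map of 2-rigs from the free 2-rig on one object which is given by an object. -/
def lift (r : R) : TwoRigMap k (FreeTwoRig k) R :=
  letI : (completedFunctor k r).Braided :=
    inferInstanceAs
      (IdemCompletion.map (AddCompletion.map (FreeLinear.lift k (TensorPower.functor r)))).Braided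
  letI : (completedFunctor k r).Additive :=
    inferInstanceAs
      (IdemCompletion.map (AddCompletion.map (FreeLinear.lift k (TensorPower.functor r)))).Additive
  letI : (completedFunctor k r).Linear k :=
    inferInstanceAs
      ((IdemCompletion.map
        (AddCompletion.map (FreeLinear.lift k (TensorPower.functor r)))).Linear k)
  ⟨completedFunctor k r ⋙ (CauchyCompletion.equivalence R).inverse⟩

/-- The value of the functor between Cauchy completions at the generating object. -/
def completedFunctorGenIso (r : R) :
    (completedFunctor k r).obj (gen k) ≅ (CauchyCompletion.embedding R).obj r :=
  IdemCompletion.mapToKaroubiObjIso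
      (AddCompletion.map (FreeLinear.lift k (TensorPower.functor r)))
      ((Mat_.embedding _).obj (Free.of k ⟨Unit⟩)) ≪≫
    (CauchyCompletion.embedding R).mapIso (TensorPower.functorObjIso r)

/-- The value at the generating object. -/
def liftGenIso (r : R) : (lift k r).toFunctor.obj (gen k) ≅ r :=
  (CauchyCompletion.equivalence R).inverse.mapIso (completedFunctorGenIso k r) ≪≫
    ((CauchyCompletion.equivalence R).unitIso.app r).symm

end FreeTwoRig

end Extension

end

noncomputable section

open Limits Idempotents

attribute [local instance] hasBinaryBiproducts_of_finite_biproducts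

/-! ### Prescribing the value at one object strictly -/

namespace TwoRigMap

variable {k : Type w} [Field k]
  {R : Type u} [Category.{v} R] [Preadditive R] [Linear k R] [MonoidalCategory R]
  [SymmetricCategory R]
  {R' : Type u'} [Category.{v'} R'] [Preadditive R'] [Linear k R'] [MonoidalCategory R']
  [SymmetricCategory R']

/-- A map of 2-rigs with prescribed values on objects. -/
def copyObj (F : TwoRigMap k R R') (obj : R → R') (e : ∀ X, F.toFunctor.obj X ≅ obj X) :
    TwoRigMap k R R' :=
  letI := Functor.Braided.transport (F.toFunctor.isoCopyObj obj e)
  haveI := Functor.additive_of_iso (F.toFunctor.isoCopyObj obj e)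
  haveI := Functor.linear_of_iso k (F.toFunctor.isoCopyObj obj e)
  ⟨F.toFunctor.copyObj obj e⟩

/-- The extension takes `x` to an object that is only isomorphic to `r`, whereas an equality is
wanted. Replacing the single value at `x` and transporting all structure along the isomorphism
achieves it. -/
theorem exists_obj_eq (F : TwoRigMap k R R') {x : R} {r : R'} (e : F.toFunctor.obj x ≅ r) :
    ∃ G : TwoRigMap k R R', G.toFunctor.obj x = r := by
  classical
  refine ⟨F.copyObj (fun X => if X = x then r else F.toFunctor.obj X) fun X =>
    if h : X = x then F.toFunctor.mapIso (eqToIso h) ≪≫ e ≪≫ eqToIso (by simp [h])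
    else eqToIso (by simp [h]), ?_⟩
  exact if_pos rfl

end TwoRigMap

namespace TwoIdeal

variable {R : Type u} [Category.{v} R] [Preadditive R] [HasFiniteBiproducts R]
  [MonoidalCategory R] (I : TwoIdeal R)

/-- The projection is additive, hence preserves biproducts, and every object of the quotient is in
its image. -/
instance : HasFiniteBiproducts (CategoryTheory.Quotient I.rel) where
  out _ :=
    { has_biproduct := fun f =>
        (CategoryTheory.Quotient.functor I.rel).hasBiproduct_of_preserves fun j => (f j).as }

theorem isZero_obj {X : R} (hX : I.mem X) :
    IsZero ((CategoryTheory.Quotient.functor I.rel).obj X) := by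
  rw [IsZero.iff_id_eq_zero]
  exact CategoryTheory.Quotient.sound _ ⟨X, hX, 𝟙 X, 𝟙 X, by simp; rfl⟩

end TwoIdeal

/-! ### Lifting idempotents along the quotient -/

section LiftIdempotent

open Polynomial

/-- Write `m = X ^ i * q` with `q` prime to `X`, and take `u * X ^ (i + 1) + v * q = 1`. The
polynomial `e = u * X ^ (i + 1)` satisfies `e * e - e = -e * v * q`, a multiple of `m`. If `b` is
idempotent and `m` kills `b`, then `b * q(b) = 0`; multiplying the relation by `X` and evaluating
gives `u(b) * b = b`, which is `e(b) = b`. The polynomial `e` depends on `m` alone, so it can be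
used both upstairs and in the quotient. -/
theorem exists_idempotent_polynomial {k : Type*} [Field k] (m : k[X]) (hm : m ≠ 0) :
    ∃ e : k[X], m ∣ e * e - e ∧ ∀ {B : Type*} [Ring B] [Algebra k B] (b : B), b * b = b →
      aeval b m = 0 → aeval b e = b := by
  obtain ⟨q, hq, hX⟩ := exists_eq_pow_rootMultiplicity_mul_and_not_dvd m hm 0
  rw [C_0, sub_zero] at hq hX
  set i := rootMultiplicity 0 m
  -- The exponent is `i + 1` and not `i` so that `e` is divisible by `X` even when `i = 0`;
  -- otherwise `e(b)` would be `u(b)`, without the factor `b`.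
  obtain ⟨u, v, huv⟩ : IsCoprime (X ^ (i + 1)) q :=
    ((irreducible_X.coprime_iff_not_dvd).2 hX).pow_left
  refine ⟨u * X ^ (i + 1), ⟨-(u * v * X), ?_⟩, fun {B} _ _ b hb hm => ?_⟩
  · rw [hq]
    linear_combination (u * X ^ (i + 1)) * huv
  · have hpow : ∀ j : ℕ, b ^ (j + 1) = b := fun j => by
      induction j with
      | zero => simp
      | succ j ih => rw [pow_succ, ih, hb]
    have h1 : aeval b (q * X ^ (i + 1)) = 0 := by
      rw [show q * X ^ (i + 1) = X * m by rw [hq]; ring, map_mul, hm, mul_zero]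
    have h2 := congrArg (fun f => aeval b (f * X)) huv
    have h3 : (u * X ^ (i + 1) + v * q) * X = u * X ^ (i + 1 + 1) + v * (q * X) := by ring
    simp only [map_mul, map_pow, aeval_X, hpow] at h1
    simp only [h3, map_mul, map_add, map_pow, aeval_X, hpow, h1, mul_zero, add_zero, one_mul] at h2
    simp only [map_mul, map_pow, aeval_X, hpow, h2]

end LiftIdempotent

/-- Idempotents lift to a category whose endomorphism algebras are integral. -/
theorem TwoIdeal.exists_idempotent_lift {k : Type w} [Field k] {R : Type u} [Category.{v} R]
    [Preadditive R] [Linear k R] [HasFiniteBiproducts R] [MonoidalCategory R] (I : TwoIdeal R)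
    {X : R} (hX : Algebra.IsIntegral k (End X)) (p : X ⟶ X) (hp : I.rel (p ≫ p) p) :
    ∃ q : X ⟶ X, q ≫ q = q ∧ I.rel q p := by
  let Q := CategoryTheory.Quotient.functor I.rel
  let φ : End X →ₐ[k] End (Q.obj X) :=
    -- Multiplication in `End` is composition in the opposite order, hence the exchanged arguments.
    AlgHom.ofLinearMap (Q.mapLinearMap k) (Q.map_id X) fun f g => Q.map_comp g f
  let a : End X := p
  obtain ⟨e, he, hlift⟩ := exists_idempotent_polynomial (minpoly k a)
    (minpoly.ne_zero (hX.isIntegral a))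
  have ha : φ a * φ a = φ a := (Q.map_comp p p).symm.trans (CategoryTheory.Quotient.sound _ hp)
  have h0 : Polynomial.aeval (φ a) (minpoly k a) = 0 := by
    rw [Polynomial.aeval_algHom_apply, minpoly.aeval, map_zero]
  refine ⟨Polynomial.aeval a e, ?_, ?_⟩
  -- The minimal polynomial of `a` divides `e * e - e`, so `e(a)` is idempotent before passing to
  -- the quotient.
  · have h := (minpoly.dvd_iff).1 he
    rw [map_sub, map_mul, sub_eq_zero] at h
    exact h
  -- The class of `a` is idempotent and is killed by the minimal polynomial of `a`, so `e` fixes it;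
  -- hence `e(a)` and `a` have the same class.
  · refine (CategoryTheory.Quotient.functor_map_eq_iff I.rel _ _).1 ?_
    have h := hlift (φ a) ha h0
    rw [Polynomial.aeval_algHom_apply] at h
    exact h

/-- An idempotent of the quotient lifts to an idempotent of `R`, and the image of a splitting there
is a splitting of the given one. -/
theorem TwoIdeal.isIdempotentComplete {k : Type w} [Field k] {R : Type u} [Category.{v} R]
    [Preadditive R] [Linear k R] [HasFiniteBiproducts R] [MonoidalCategory R] (I : TwoIdeal R)
    [IsIdempotentComplete R] (hR : ∀ X : R, Algebra.IsIntegral k (End X)) :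
    IsIdempotentComplete (CategoryTheory.Quotient I.rel) where
  idempotents_split := by
    rintro ⟨X⟩ ⟨p⟩ hp
    obtain ⟨q, hq, hqp⟩ := I.exists_idempotent_lift (hR X) p
      ((CategoryTheory.Quotient.functor_map_eq_iff I.rel _ _).1 hp)
    obtain ⟨Y, i, e, h, h'⟩ := IsIdempotentComplete.idempotents_split X q hq
    refine ⟨(CategoryTheory.Quotient.functor I.rel).obj Y,
      (CategoryTheory.Quotient.functor I.rel).map i,
      (CategoryTheory.Quotient.functor I.rel).map e, ?_, ?_⟩
    · rw [← CategoryTheory.Functor.map_comp, h, CategoryTheory.Functor.map_id]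
    · rw [← CategoryTheory.Functor.map_comp, h']
      exact CategoryTheory.Quotient.sound _ hqp

/-! ### Finite-dimensionality of the morphism spaces of the free 2-rig -/

namespace FreeTwoRig

variable (k : Type w) [Field k]

theorem _root_.FinBij.finite_hom (A B : FinBij) : Finite (A ⟶ B) :=
  Finite.of_injective (fun f : A ⟶ B => f.toEquiv) fun _ _ h => FinBij.Hom.ext h

instance (A B : Free k FinBij) : Module.Finite k (A ⟶ B) :=
  haveI := FinBij.finite_hom A B
  inferInstanceAs (Module.Finite k (Quiver.Hom (V := FinBij) A B →₀ k))

instance (M N : Mat_ (Free k FinBij)) : Module.Finite k (M ⟶ N) :=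
  inferInstanceAs (Module.Finite k (∀ (i : M.ι) (j : N.ι), M.X i ⟶ N.X j))

instance (P Q : FreeTwoRig k) : Module.Finite k (P ⟶ Q) :=
  Module.Finite.of_injective
    ({ toFun := fun f => f.f, map_add' := fun _ _ => rfl, map_smul' := fun _ _ => rfl } :
      (P ⟶ Q) →ₗ[k] (P.X ⟶ Q.X)) fun _ _ h => Karoubi.hom_ext _ _ h

theorem isIntegral_end (A : FreeTwoRig k) : Algebra.IsIntegral k (End A) :=
  haveI : Module.Finite k (End A) := inferInstanceAs (Module.Finite k (A ⟶ A))
  inferInstance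

end FreeTwoRig

/-! ### The quotient as a 2-rig, and the existence of maps out of it -/

namespace FreeSubdim

variable (k : Type w) [Field k] (n : ℕ)

instance : IsTwoRig k (FreeSubdim k n) where
  monoidalPreadditive := inferInstance
  monoidalLinear := inferInstance
  hasFiniteBiproducts := inferInstance
  isIdempotentComplete := TwoIdeal.isIdempotentComplete _ (FreeTwoRig.isIntegral_end k)

/-- The projection preserves exterior powers and kills the object `Λ^(n+1) x` of the 2-ideal.
Characteristic `0` enters through the existence of that exterior power. -/
theorem hasSubdimension_gen [CharZero k] : HasSubdimension k n (gen k n) := by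
  obtain ⟨L, hL⟩ := exists_isExteriorPower k (n + 1) (FreeTwoRig.gen k)
  exact ⟨_, hL.map (CategoryTheory.Quotient.functor (exteriorIdeal k n).rel),
    TwoIdeal.isZero_obj _ fun I hI => hI L hL⟩

variable {k n}

theorem exists_map {R : Type u} [Category.{v} R] [Preadditive R] [Linear k R]
    [MonoidalCategory R] [SymmetricCategory R] [IsTwoRig k R] (r : R)
    (hr : HasSubdimension k n r) :
    ∃ F : TwoRigMap k (FreeSubdim k n) R, F.toFunctor.obj (gen k n) = r := by
  have : MonoidalPreadditive R := IsTwoRig.monoidalPreadditive k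
  have : MonoidalLinear k R := IsTwoRig.monoidalLinear
  have : HasFiniteBiproducts R := IsTwoRig.hasFiniteBiproducts k
  have : IsIdempotentComplete R := IsTwoRig.isIdempotentComplete k
  obtain ⟨F, hF⟩ := (FreeTwoRig.lift k r).exists_obj_eq (FreeTwoRig.liftGenIso k r)
  have hI : ∀ X, (exteriorIdeal k n).mem X → IsZero (F.toFunctor.obj X) := fun X hX =>
    -- The generated 2-ideal lies in every 2-ideal that contains its generators, so it suffices that
    -- `F` kills each choice of `Λ^(n+1) x`; its image is an exterior power of `r`, hence isomorphic
    -- to a zero object.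
    hX (TwoIdeal.ker F.toFunctor) fun L hL => by
      subst hF
      obtain ⟨L', hL', h₀⟩ := hr
      obtain ⟨e⟩ := (hL.map F.toFunctor).nonempty_iso hL'
      exact h₀.of_iso e
  exact ⟨⟨TwoIdeal.lift F.toFunctor (exteriorIdeal k n) hI⟩, hF⟩

end FreeSubdim

end

noncomputable section

open Functor.LaxMonoidal

/-! ### Finite sets as powers of the point -/

namespace FinBij

/-- The one-element set. -/
abbrev point : FinBij := ⟨Unit⟩

/-- The elements of a tensor power of the one-element set. -/
def powEquiv : (m : ℕ) → ((tensorPow point m).carrier ≃ Fin m)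
  | 0 => Equiv.equivOfIsEmpty Empty (Fin 0)
  | m + 1 => (Equiv.sumCongr (Equiv.refl Unit) (powEquiv m)).trans
      ((Equiv.sumComm _ _).trans ((Equiv.optionEquivSumPUnit (Fin m)).symm.trans
        (finSuccEquiv m).symm))

theorem nonempty_iso_pow (A : FinBij) : Nonempty (A ≅ tensorPow point (Fintype.card A.carrier)) :=
  ⟨mkIso ((Fintype.equivFin A.carrier).trans (powEquiv _).symm)⟩

theorem eq_of_pow_hom {m m' : ℕ} (f : tensorPow point m ⟶ tensorPow point m') : m = m' :=
  Fin.equiv_iff_eq.1 ⟨(powEquiv m).symm.trans (f.toEquiv.trans (powEquiv m'))⟩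

theorem exists_moveHead (m : ℕ) (t : (tensorPow point (m + 1)).carrier) :
    ∃ p, (moveHead point m p).toEquiv (Sum.inl ()) = t := by
  induction m with
  | zero =>
    rcases t with t | t
    · exact ⟨0, rfl⟩
    · exact t.elim
  | succ m ih =>
    rcases t with t | t
    · exact ⟨0, by rw [moveHead_zero]; rfl⟩
    · obtain ⟨p, hp⟩ := ih t
      exact ⟨p.succ, congrArg Sum.inr hp⟩

/-- A bijection that fixes the first point restricts to the complements of that point. -/
theorem exists_whiskerLeft {A B : FinBij} (g : point ⊗ A ⟶ point ⊗ B)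
    (hg : g.toEquiv (Sum.inl ()) = Sum.inl ()) : ∃ h : A ⟶ B, g = point ◁ h := by
  have h1 : ∀ a : A.carrier, ∃ b : B.carrier, g.toEquiv (Sum.inr a) = Sum.inr b := fun a => by
    rcases h : g.toEquiv (Sum.inr a) with b | b
    · exact absurd (g.toEquiv.injective (h.trans hg.symm)) Sum.inr_ne_inl
    · exact ⟨b, rfl⟩
  choose f hf using h1
  have hinj : Function.Injective f := fun a a' h =>
    Sum.inr_injective (g.toEquiv.injective ((hf a).trans ((congrArg _ h).trans (hf a').symm)))
  have hsurj : Function.Surjective f := fun b => by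
    obtain ⟨a, ha⟩ := g.toEquiv.surjective (Sum.inr b)
    rcases a with a | a
    · exact absurd (hg.symm.trans ha) Sum.inl_ne_inr
    · exact ⟨a, Sum.inr_injective ((hf a).symm.trans ha)⟩
  refine ⟨⟨Equiv.ofBijective f ⟨hinj, hsurj⟩⟩, hom_ext ?_⟩
  rintro (a | a)
  · exact hg
  · exact hf a

/-- All bijections of a tensor power of the one-element set are permutations of the factors. -/
theorem exists_permAct (m : ℕ) (g : tensorPow point m ⟶ tensorPow point m) :
    ∃ σ, g = permAct point m σ := by
  induction m with
  | zero => exact ⟨1, hom_ext fun a => a.elim⟩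
  | succ m ih =>
    -- Undoing the move of the first factor to its image leaves a bijection that fixes the first
    -- point, so the induction hypothesis applies to the remaining factors.
    obtain ⟨p, hp⟩ := exists_moveHead m (g.toEquiv (Sum.inl ()))
    let q : tensorPow point (m + 1) ⟶ tensorPow point (m + 1) := ⟨(moveHead point m p).toEquiv.symm⟩
    have hq : q ≫ moveHead point m p = 𝟙 _ :=
      hom_ext fun a => (moveHead point m p).toEquiv.apply_symm_apply a
    obtain ⟨h, hh⟩ := exists_whiskerLeft (g ≫ q)
      ((moveHead point m p).toEquiv.symm_apply_eq.2 hp.symm)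
    obtain ⟨τ, rfl⟩ := ih h
    refine ⟨movePerm p * succPerm τ, ?_⟩
    rw [permAct_move]
    rw [← hh, Category.assoc, hq, Category.comp_id]

end FinBij

/-! ### Tensor powers of a morphism commute with permutations -/

section PowHom

variable {R : Type u} [Category.{v} R] [MonoidalCategory R]

/-- The tensor power of a morphism. -/
def powHom {r r' : R} (f : r ⟶ r') : (m : ℕ) → (tensorPow r m ⟶ tensorPow r' m)
  | 0 => 𝟙 _
  | m + 1 => f ⊗ₘ powHom f m

variable [SymmetricCategory R]

theorem swapHead_natural {r r' W W' : R} (f : r ⟶ r') (g : W ⟶ W') :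
    swapHead r W ≫ (f ⊗ₘ (f ⊗ₘ g)) = (f ⊗ₘ (f ⊗ₘ g)) ≫ swapHead r' W' := by
  simp only [swapHead, Category.assoc]
  rw [← MonoidalCategory.associator_naturality, associator_inv_naturality_assoc, ← tensorHom_id,
    ← tensorHom_id, tensorHom_comp_tensorHom_assoc, tensorHom_comp_tensorHom_assoc,
    ← BraidedCategory.braiding_naturality, Category.id_comp, Category.comp_id]

theorem moveHead_natural {r r' : R} (f : r ⟶ r') (m : ℕ) (p : Fin (m + 1)) :
    moveHead r m p ≫ powHom f (m + 1) = powHom f (m + 1) ≫ moveHead r' m p := by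
  induction m with
  | zero => exact (Category.id_comp _).trans (Category.comp_id _).symm
  | succ m ih =>
    cases p using Fin.cases with
    | zero => rw [moveHead_zero, moveHead_zero, Category.id_comp, Category.comp_id]
    | succ p =>
      have h := swapHead_natural f (powHom f m)
      rw [moveHead_succ, moveHead_succ, Category.assoc]
      have h1 : r ◁ moveHead r m p ≫ powHom f (m + 2) = powHom f (m + 2) ≫ r' ◁ moveHead r' m p := by
        change r ◁ moveHead r m p ≫ (f ⊗ₘ powHom f (m + 1)) =
          (f ⊗ₘ powHom f (m + 1)) ≫ r' ◁ moveHead r' m p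
        rw [← id_tensorHom, ← id_tensorHom, tensorHom_comp_tensorHom, tensorHom_comp_tensorHom, ih,
          Category.id_comp, Category.comp_id]
      rw [h1]
      exact (reassoc_of% h) (r' ◁ moveHead r' m p)

/-- A permutation acts through moves of the head, that is, through braidings of factors. Braidings
are natural, and `f` is applied to every factor alike. -/
theorem permAct_natural {r r' : R} (f : r ⟶ r') (m : ℕ) (σ : Equiv.Perm (Fin m)) :
    permAct r m σ ≫ powHom f m = powHom f m ≫ permAct r' m σ := by
  induction m with
  | zero => rfl
  | succ m ih =>
    rw [permAct, permAct, Category.assoc, moveHead_natural, powHom, ← id_tensorHom,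
      tensorHom_comp_tensorHom_assoc, ih, ← id_tensorHom, tensorHom_comp_tensorHom_assoc,
      Category.id_comp, Category.comp_id]

end PowHom

/-! ### Monoidality of a transformation at a pair of objects -/

section MonoidalAt

variable {C : Type u} [Category.{v} C] [MonoidalCategory C] {D : Type u'} [Category.{v'} D]
  [MonoidalCategory D] {F G : C ⥤ D} [F.Monoidal] [G.Monoidal] (τ : F ⟶ G)

/-- Compatibility of a natural transformation with the tensor product of two given objects. -/
def MonoidalAt (X Y : C) : Prop :=
  μ F X Y ≫ τ.app (X ⊗ Y) = (τ.app X ⊗ₘ τ.app Y) ≫ μ G X Y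

variable {τ}

theorem MonoidalAt.of_iso {X Y X' Y' : C} (h : MonoidalAt τ X Y) (e : X ≅ X') (e' : Y ≅ Y') :
    MonoidalAt τ X' Y' := by
  have h1 : (F.map e.hom ⊗ₘ F.map e'.hom) ≫ μ F X' Y' ≫ τ.app (X' ⊗ Y') =
      (F.map e.hom ⊗ₘ F.map e'.hom) ≫ (τ.app X' ⊗ₘ τ.app Y') ≫ μ G X' Y' := by
    rw [μ_natural_assoc, τ.naturality, reassoc_of% h, ← μ_natural, tensorHom_comp_tensorHom_assoc,
      tensorHom_comp_tensorHom_assoc, τ.naturality, τ.naturality]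
  rw [MonoidalAt, ← cancel_epi (F.map e.hom ⊗ₘ F.map e'.hom), h1]

/-- Associativity of the tensorators, in a form that permits induction on the number of factors in
the first argument. -/
theorem MonoidalAt.tensor {X Y Z : C} (h : MonoidalAt τ X Y) (h' : MonoidalAt τ Y Z)
    (h'' : MonoidalAt τ X (Y ⊗ Z)) : MonoidalAt τ (X ⊗ Y) Z := by
  have h1 : (μ F X Y ▷ F.obj Z ≫ μ F (X ⊗ Y) Z ≫ τ.app ((X ⊗ Y) ⊗ Z)) ≫ G.map (α_ X Y Z).hom =
      (μ F X Y ▷ F.obj Z ≫ (τ.app (X ⊗ Y) ⊗ₘ τ.app Z) ≫ μ G (X ⊗ Y) Z) ≫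
        G.map (α_ X Y Z).hom := by
    have e1 : μ F X Y ▷ F.obj Z ≫ (τ.app (X ⊗ Y) ⊗ₘ τ.app Z) =
        ((τ.app X ⊗ₘ τ.app Y) ⊗ₘ τ.app Z) ≫ μ G X Y ▷ G.obj Z := by
      rw [← tensorHom_id, tensorHom_comp_tensorHom, h, ← tensorHom_id, tensorHom_comp_tensorHom,
        Category.id_comp, Category.comp_id]
    have e2 : F.obj X ◁ μ F Y Z ≫ (τ.app X ⊗ₘ τ.app (Y ⊗ Z)) =
        (τ.app X ⊗ₘ (τ.app Y ⊗ₘ τ.app Z)) ≫ G.obj X ◁ μ G Y Z := by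
      rw [← id_tensorHom, tensorHom_comp_tensorHom, h', ← id_tensorHom, tensorHom_comp_tensorHom,
        Category.id_comp, Category.comp_id]
    rw [reassoc_of% e1, Category.assoc, Category.assoc, Category.assoc, ← τ.naturality,
      associativity_assoc, h'', reassoc_of% e2, Category.assoc, associativity,
      associator_naturality_assoc]
  rw [MonoidalAt, ← cancel_epi (μ F X Y ▷ F.obj Z), ← cancel_mono (G.map (α_ X Y Z).hom), h1]

/-- The unit comparison is invertible and can be cancelled, so left unitality of both functors and
naturality at the left unitor suffice. -/
theorem MonoidalAt.unit (h : ε F ≫ τ.app (𝟙_ C) = ε G) (X : C) : MonoidalAt τ (𝟙_ C) X := by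
  rw [MonoidalAt, ← cancel_epi (ε F ▷ F.obj X), ← cancel_mono (G.map (λ_ X).hom)]
  have e1 : ε F ▷ F.obj X ≫ (τ.app (𝟙_ C) ⊗ₘ τ.app X) = (𝟙_ D) ◁ τ.app X ≫ ε G ▷ G.obj X := by
    rw [← tensorHom_id, tensorHom_comp_tensorHom, h, ← tensorHom_id, ← id_tensorHom,
      tensorHom_comp_tensorHom, Category.id_comp, Category.id_comp, Category.comp_id]
  simp only [Category.assoc]
  rw [← τ.naturality, reassoc_of% e1, ← left_unitality, leftUnitor_naturality,
    ← left_unitality_assoc]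

end MonoidalAt

/-! ### Monoidal transformations of functors on finite sets -/

namespace FinBij

variable {R : Type u} [Category.{v} R] [MonoidalCategory R] [SymmetricCategory R]
  {F G : FinBij ⥤ R} [F.Braided] [G.Braided] (f : F.obj point ⟶ G.obj point)

/-- The value of a monoidal natural transformation at a power of the one-element set. -/
def extendPow (m : ℕ) : F.obj (tensorPow point m) ⟶ G.obj (tensorPow point m) :=
  (tensorPowIso F point m).inv ≫ powHom f m ≫ (tensorPowIso G point m).hom

/-- By `exists_permAct` only permutations of the factors have to be considered; `F` and `G` carry
them to the permutation actions, with which the power of `f` commutes. -/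
theorem extendPow_natural (m : ℕ) (g : tensorPow point m ⟶ tensorPow point m) :
    F.map g ≫ extendPow f m = extendPow f m ≫ G.map g := by
  obtain ⟨σ, rfl⟩ := exists_permAct m g
  rw [extendPow, ← cancel_epi (tensorPowIso F point m).hom, reassoc_of% (map_permAct F),
    Iso.hom_inv_id_assoc, Category.assoc, Iso.hom_inv_id_assoc, Category.assoc, map_permAct,
    reassoc_of% (permAct_natural f m σ)]

/-- The recursive step that makes the transformation monoidal at the point and a power of the point.
-/
theorem μ_extendPow_succ (m : ℕ) :
    μ F point (tensorPow point m) ≫ extendPow f (m + 1) =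
      (f ⊗ₘ extendPow f m) ≫ μ G point (tensorPow point m) := by
  have h1 : (tensorPowIso F point (m + 1)).inv =
      Functor.OplaxMonoidal.δ F _ _ ≫ F.obj point ◁ (tensorPowIso F point m).inv := rfl
  rw [extendPow, h1, tensorPowIso_succ_hom, powHom, extendPow]
  simp only [Category.assoc, Functor.Monoidal.μ_δ_assoc]
  rw [← id_tensorHom, ← id_tensorHom, tensorHom_comp_tensorHom_assoc,
    tensorHom_comp_tensorHom_assoc, Category.id_comp, Category.comp_id, Category.assoc]

theorem ε_extendPow_zero : ε F ≫ extendPow f 0 = ε G := by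
  change ε F ≫ Functor.OplaxMonoidal.η F ≫ 𝟙 _ ≫ ε G = ε G
  simp

/-- The value of a monoidal natural transformation, in terms of an enumeration. -/
def extendAt {A : FinBij} {m : ℕ} (e : A ≅ tensorPow point m) : F.obj A ⟶ G.obj A :=
  F.map e.hom ≫ extendPow f m ≫ G.map e.inv

theorem extendAt_natural {A B : FinBij} {m m' : ℕ} (e : A ≅ tensorPow point m)
    (e' : B ≅ tensorPow point m') (g : A ⟶ B) :
    F.map g ≫ extendAt f e' = extendAt f e ≫ G.map g := by
  -- Sets in bijection have enumerations of the same length, so `g` becomes an endomorphism of a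
  -- single power.
  obtain rfl := eq_of_pow_hom (e.inv ≫ g ≫ e'.hom)
  have h := extendPow_natural f m (e.inv ≫ g ≫ e'.hom)
  rw [extendAt, extendAt, ← cancel_epi (F.map e.inv), ← cancel_mono (G.map e'.hom)]
  simp only [Category.assoc, ← G.map_comp]
  simp only [Iso.inv_hom_id, G.map_id, Category.comp_id, ← F.map_comp_assoc] at h ⊢
  rw [h, F.map_id, Category.id_comp]

/-- A chosen enumeration of a finite set. -/
def powIso (A : FinBij) : A ≅ tensorPow point (Fintype.card A.carrier) :=
  (nonempty_iso_pow A).some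

/-- The monoidal natural transformation with a given value at the one-element set. -/
def extend : F ⟶ G where
  app A := extendAt f (powIso A)
  naturality _ _ g := extendAt_natural f _ _ g

/-- Naturality at the identity shows that the value does not depend on the enumeration, so the
arbitrary choice in `powIso` does no harm. -/
theorem extend_app {A : FinBij} {m : ℕ} (e : A ≅ tensorPow point m) :
    (extend f).app A = extendAt f e := by
  have h := extendAt_natural f e (powIso A) (𝟙 A)
  rw [F.map_id, G.map_id, Category.id_comp, Category.comp_id] at h
  exact h

theorem extend_app_pow (m : ℕ) : (extend f).app (tensorPow point m) = extendPow f m := by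
  rw [extend_app f (Iso.refl _), extendAt]
  simp

/-- The first power of the point is `point ⊗ 𝟙_` and not the point itself; the right unitor compares
the two. -/
theorem extend_app_point : (extend f).app point = f := by
  have h := μ_extendPow_succ f 0
  rw [← extend_app_pow, ← extend_app_pow] at h
  have h3 : ε F ≫ (extend f).app (𝟙_ FinBij) = ε G :=
    (congrArg (fun t => ε F ≫ t) (extend_app_pow f 0)).trans (ε_extendPow_zero f)
  have h4 : μ F point (𝟙_ FinBij) ≫ (extend f).app (point ⊗ 𝟙_ FinBij) =
    (f ⊗ₘ (extend f).app (𝟙_ FinBij)) ≫ μ G point (𝟙_ FinBij) := h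
  rw [← cancel_epi (ρ_ (F.obj point)).hom]
  refine Eq.trans ?_ (MonoidalCategory.rightUnitor_naturality f)
  rw [right_unitality, right_unitality, Category.assoc, Category.assoc, (extend f).naturality, reassoc_of% h4,
    ← id_tensorHom, tensorHom_comp_tensorHom_assoc, h3, Category.id_comp, ← tensorHom_id,
    ← id_tensorHom, tensorHom_comp_tensorHom_assoc, Category.id_comp, Category.comp_id]

/-- For the point as first argument this is the recursion `μ_extendPow_succ`. Induction with
`MonoidalAt.tensor` gives all powers of the point, and every finite set is isomorphic to one. -/
theorem monoidalAt_extend (A B : FinBij) : MonoidalAt (extend f) A B := by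
  have hu : ε F ≫ (extend f).app (𝟙_ FinBij) = ε G :=
    (congrArg (fun t => ε F ≫ t) (extend_app_pow f 0)).trans (ε_extendPow_zero f)
  have hp : ∀ B, MonoidalAt (extend f) point B := fun B => by
    refine MonoidalAt.of_iso ?_ (Iso.refl _) (powIso B).symm
    rw [MonoidalAt, extend_app_point]
    have h := μ_extendPow_succ f (Fintype.card B.carrier)
    rw [← extend_app_pow, ← extend_app_pow] at h
    exact h
  have hm : ∀ m B, MonoidalAt (extend f) (tensorPow point m) B := fun m => by
    induction m with
    | zero => exact MonoidalAt.unit hu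
    | succ m ih => exact fun B => (hp _).tensor (ih B) (hp _)
  exact (hm _ B).of_iso (powIso A).symm (Iso.refl _)

instance isMonoidal_extend : NatTrans.IsMonoidal (extend f) where
  unit := (congrArg (fun t => ε F ≫ t) (extend_app_pow f 0)).trans (ε_extendPow_zero f)
  tensor := monoidalAt_extend f

/-- Monoidal natural transformations are determined by their value at the one-element set. -/
theorem natTrans_ext (α β : F ⟶ G) [NatTrans.IsMonoidal α] [NatTrans.IsMonoidal β]
    (h : α.app point = β.app point) : α = β := by
  have hp : ∀ m, α.app (tensorPow point m) = β.app (tensorPow point m) := fun m => by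
    induction m with
    | zero =>
      rw [← cancel_epi (ε F)]
      exact (NatTrans.IsMonoidal.unit (τ := α)).trans (NatTrans.IsMonoidal.unit (τ := β)).symm
    | succ m ih =>
      rw [← cancel_epi (μ F point (tensorPow point m))]
      refine (NatTrans.IsMonoidal.tensor (τ := α) point (tensorPow point m)).trans ?_
      rw [h, ih]
      exact (NatTrans.IsMonoidal.tensor (τ := β) point (tensorPow point m)).symm
  ext A
  rw [← cancel_mono (G.map (powIso A).hom), ← α.naturality, ← β.naturality, hp]

end FinBij

end

noncomputable section

open Functor.LaxMonoidal

/-! ### Extension of transformations from an additively dense family -/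

section Dense

variable {C : Type u''} [Category.{v''} C] {D : Type u} [Category.{v} D] [Preadditive D]
  {R : Type u'} [Category.{v'} R] [Preadditive R]

/-- Every object is a retract of a finite sum of values of the functor. -/
def IsAdditivelyDense (P : C ⥤ D) : Prop :=
  ∀ d : D, ∃ (ι : Type) (_ : Fintype ι) (c : ι → C) (a : ∀ i, d ⟶ P.obj (c i))
    (b : ∀ i, P.obj (c i) ⟶ d), ∑ i, a i ≫ b i = 𝟙 d

namespace IsAdditivelyDense

variable {P : C ⥤ D} {F G : D ⥤ R} [F.Additive] [G.Additive]

/-- The identity of `d` is a sum of maps that factor through values of `P`, and `F` preserves this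
sum. -/
theorem hom_ext (hP : IsAdditivelyDense P) {d : D} {Z : R} {x y : F.obj d ⟶ Z}
    (h : ∀ (c : C) (b : P.obj c ⟶ d), F.map b ≫ x = F.map b ≫ y) : x = y := by
  obtain ⟨ι, _, c, a, b, hab⟩ := hP d
  rw [← Category.id_comp x, ← Category.id_comp y, ← CategoryTheory.Functor.map_id, ← hab,
    F.map_sum, Preadditive.sum_comp, Preadditive.sum_comp]
  refine Finset.sum_congr rfl fun i _ => ?_
  rw [F.map_comp, Category.assoc, Category.assoc, h]

theorem natTrans_ext (hP : IsAdditivelyDense P) {α β : F ⟶ G} (h : ∀ c, α.app (P.obj c) = β.app (P.obj c)) : α = β := by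
  ext d
  refine hP.hom_ext fun c b => ?_
  rw [α.naturality, β.naturality, h]

variable (t : ∀ c, F.obj (P.obj c) ⟶ G.obj (P.obj c))

/-- The component is forced to be `∑ F(a i) ≫ t ≫ G(b i)` for any decomposition of the identity. By
`hom_ext` its defining property determines it, so it does not depend on the decomposition. -/
theorem exists_app (hP : IsAdditivelyDense P)
    (ht : ∀ {c c' : C} (h : P.obj c ⟶ P.obj c'), F.map h ≫ t c' = t c ≫ G.map h)
    (d : D) : ∃ x : F.obj d ⟶ G.obj d,
    ∀ (c : C) (b : P.obj c ⟶ d), F.map b ≫ x = t c ≫ G.map b := by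
  obtain ⟨ι, _, c, a, b, hab⟩ := hP d
  refine ⟨∑ i, F.map (a i) ≫ t (c i) ≫ G.map (b i), fun c' b' => ?_⟩
  conv_rhs => rw [← Category.comp_id b', ← hab, Preadditive.comp_sum, G.map_sum,
    Preadditive.comp_sum]
  rw [Preadditive.comp_sum]
  refine Finset.sum_congr rfl fun i _ => ?_
  rw [← Category.assoc b', G.map_comp, ← reassoc_of% (ht (b' ≫ a i)), F.map_comp, Category.assoc]

/-- The extension of a natural transformation from an additively dense subcategory. -/
def extend (hP : IsAdditivelyDense P)
    (ht : ∀ {c c' : C} (h : P.obj c ⟶ P.obj c'), F.map h ≫ t c' = t c ≫ G.map h)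
    : F ⟶ G where
  app d := (hP.exists_app t ht d).choose
  naturality d d' f := hP.hom_ext fun c b => by
    rw [← F.map_comp_assoc, (hP.exists_app t ht d').choose_spec,
      reassoc_of% ((hP.exists_app t ht d).choose_spec c b), G.map_comp]

theorem map_extend_app (hP : IsAdditivelyDense P)
    (ht : ∀ {c c' : C} (h : P.obj c ⟶ P.obj c'), F.map h ≫ t c' = t c ≫ G.map h)
    {d : D} {c : C} (b : P.obj c ⟶ d) :
    F.map b ≫ (hP.extend t ht).app d = t c ≫ G.map b :=
  (hP.exists_app t ht d).choose_spec c b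

theorem extend_app (hP : IsAdditivelyDense P)
    (ht : ∀ {c c' : C} (h : P.obj c ⟶ P.obj c'), F.map h ≫ t c' = t c ≫ G.map h)
    (c : C) : (hP.extend t ht).app (P.obj c) = t c := by
  have h := hP.map_extend_app t ht (𝟙 (P.obj c))
  rwa [F.map_id, G.map_id, Category.id_comp, Category.comp_id] at h

variable [MonoidalCategory C] [MonoidalCategory D] [MonoidalCategory R] [MonoidalPreadditive R]
  [P.Monoidal] [F.Monoidal] [G.Monoidal]

/-- The two-variable form of `hom_ext`: both identities are decomposed, and the tensor product is
biadditive. -/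
theorem tensor_hom_ext (hP : IsAdditivelyDense P) {d d' : D} {Z : R} {x y : F.obj d ⊗ F.obj d' ⟶ Z}
    (h : ∀ (c c' : C) (b : P.obj c ⟶ d) (b' : P.obj c' ⟶ d'),
      (F.map b ⊗ₘ F.map b') ≫ x = (F.map b ⊗ₘ F.map b') ≫ y) : x = y := by
  obtain ⟨ι, _, c, a, b, hab⟩ := hP d
  obtain ⟨ι', _, c', a', b', hab'⟩ := hP d'
  rw [← Category.id_comp x, ← Category.id_comp y, ← id_tensorHom_id,
    ← CategoryTheory.Functor.map_id, ← CategoryTheory.Functor.map_id, ← hab, ← hab', F.map_sum,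
    F.map_sum, sum_tensor, Preadditive.sum_comp, Preadditive.sum_comp]
  refine Finset.sum_congr rfl fun i _ => ?_
  rw [tensor_sum, Preadditive.sum_comp, Preadditive.sum_comp]
  refine Finset.sum_congr rfl fun j _ => ?_
  rw [F.map_comp, F.map_comp, ← tensorHom_comp_tensorHom, Category.assoc, Category.assoc, h]

/-- Compatibility with tensor products can be tested on maps out of values of `P`, where `hμ`
provides it once the invertible tensorator of `P` is cancelled. The hypotheses use composite
comparison maps so as to match the monoidal structure of `P ⋙ F` and `P ⋙ G`. -/
theorem isMonoidal_extend (hP : IsAdditivelyDense P)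
    (ht : ∀ {c c' : C} (h : P.obj c ⟶ P.obj c'), F.map h ≫ t c' = t c ≫ G.map h)
    (hε : ε F ≫ F.map (ε P) ≫ t (𝟙_ C) = ε G ≫ G.map (ε P))
    (hμ : ∀ c c', μ F (P.obj c) (P.obj c') ≫ F.map (μ P c c') ≫ t (c ⊗ c') =
      (t c ⊗ₘ t c') ≫ μ G (P.obj c) (P.obj c') ≫ G.map (μ P c c')) :
    NatTrans.IsMonoidal (hP.extend t ht) where
  unit := by
    rw [← cancel_mono (G.map (ε P)), Category.assoc, ← (hP.extend t ht).naturality,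
      extend_app, hε]
  tensor d d' := by
    refine hP.tensor_hom_ext fun c c' b b' => ?_
    have h1 : μ F (P.obj c) (P.obj c') ≫ (hP.extend t ht).app (P.obj c ⊗ P.obj c') =
        (t c ⊗ₘ t c') ≫ μ G (P.obj c) (P.obj c') := by
      rw [← cancel_mono (G.map (μ P c c')), Category.assoc, Category.assoc,
        ← (hP.extend t ht).naturality, extend_app, hμ]
    rw [μ_natural_assoc, (hP.extend t ht).naturality, reassoc_of% h1, ← μ_natural,
      tensorHom_comp_tensorHom_assoc, tensorHom_comp_tensorHom_assoc, map_extend_app,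
      map_extend_app]

end IsAdditivelyDense

end Dense

/-! ### The embedding into the free linear category -/

namespace FreeLinear

variable (k : Type w) [CommRing k] {C : Type u} [Category.{v} C]

theorem natural_of_natural_basis {R : Type u'} [Category.{v'} R] [Preadditive R] [Linear k R]
    (A B : Free k C ⥤ R) [A.Additive] [A.Linear k] [B.Additive] [B.Linear k] {X Y : C}
    {x : A.obj (Free.of k X) ⟶ B.obj (Free.of k X)} {y : A.obj (Free.of k Y) ⟶ B.obj (Free.of k Y)}
    (h : ∀ f : X ⟶ Y, A.map (basis f) ≫ y = x ≫ B.map (basis f))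
    (f : Free.of k X ⟶ Free.of k Y) : A.map f ≫ y = x ≫ B.map f := by
  induction f using hom_induction with
  | zero => simp
  | add f g hf hg => rw [A.map_add, B.map_add, Preadditive.add_comp, hf, hg, Preadditive.comp_add]
  | smul a f hf => rw [A.map_smul, B.map_smul, Linear.smul_comp, hf, Linear.comp_smul]
  | bas f => exact h f

variable [MonoidalCategory C]

/-- The embedding into the free linear category is monoidal. -/
def embCore : (Free.embedding k C).CoreMonoidal where
  εIso := Iso.refl _
  μIso _ _ := Iso.refl _
  μIso_hom_natural_left f Z := by
    refine (Category.comp_id _).trans (Eq.trans ?_ (Category.id_comp _).symm)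
    exact whiskerR_basis Z f
  μIso_hom_natural_right Z f := by
    refine (Category.comp_id _).trans (Eq.trans ?_ (Category.id_comp _).symm)
    exact whiskerL_basis Z f
  associativity X Y Z := by
    refine Eq.trans (b := whiskerR (k := k) Z (basis (𝟙 (X ⊗ Y))) ≫ basis (𝟙 _) ≫
      basis (α_ X Y Z).hom) rfl ?_
    refine Eq.trans ?_ (b := basis (α_ X Y Z).hom ≫ whiskerL (k := k) X (basis (𝟙 (Y ⊗ Z))) ≫
      basis (𝟙 _)) rfl
    simp [basis_comp]
  left_unitality X := by
    refine Eq.trans ?_ (b := whiskerR (k := k) X (basis (𝟙 (𝟙_ C))) ≫ basis (𝟙 _) ≫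
      basis (λ_ X).hom) rfl
    simp only [whiskerR_basis, basis_comp, id_whiskerRight, Category.id_comp]
    rfl
  right_unitality X := by
    refine Eq.trans ?_ (b := whiskerL (k := k) X (basis (𝟙 (𝟙_ C))) ≫ basis (𝟙 _) ≫
      basis (ρ_ X).hom) rfl
    simp only [whiskerL_basis, basis_comp, MonoidalCategory.whiskerLeft_id, Category.id_comp]
    rfl

instance [SymmetricCategory C] : (Free.embedding k C).Braided :=
  Functor.Braided.ofCore (embCore k) fun _ _ =>
    (Category.id_comp _).trans (Category.comp_id _).symm

end FreeLinear

end

noncomputable section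

open Functor.LaxMonoidal Limits Idempotents

/-! ### Density of the powers of the generator, and full faithfulness of evaluation -/

theorem CauchyCompletion.isAdditivelyDense_embedding (C : Type u) [Category.{v} C]
    [Preadditive C] : IsAdditivelyDense (embedding C) := fun A => by
  let e := Mat_.isoBiproductEmbedding A.X
  let B : A.X.ι → Mat_ C := fun i => (Mat_.embedding C).obj (A.X.X i)
  -- The underlying matrix object is the sum of its entries; below, the idempotent object `A` is a
  -- retract of it by `Karoubi.decompId`.
  have h : ∑ i, (e.hom ≫ biproduct.π B i) ≫ biproduct.ι B i ≫ e.inv = 𝟙 A.X := by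
    have h2 := congrArg (fun t => e.hom ≫ t ≫ e.inv) (biproduct.total (f := B))
    have h3 : e.hom ≫ 𝟙 (⨁ B) ≫ e.inv = 𝟙 A.X :=
      (congrArg (fun t => e.hom ≫ t) (Category.id_comp _)).trans e.hom_inv_id
    simpa only [Category.assoc, Preadditive.sum_comp, Preadditive.comp_sum] using h2.trans h3
  have h' := congrArg (fun t => Karoubi.decompId_i A ≫ (toKaroubi (Mat_ C)).map t ≫
    Karoubi.decompId_p A) h
  have h'' : Karoubi.decompId_i A ≫ (toKaroubi (Mat_ C)).map (𝟙 A.X) ≫ Karoubi.decompId_p A =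
      𝟙 A := (congrArg (fun t => Karoubi.decompId_i A ≫ t) (Category.id_comp _)).trans
    (Karoubi.decompId A).symm
  refine ⟨A.X.ι, inferInstance, A.X.X, fun i => Karoubi.decompId_i A ≫ (toKaroubi _).map
      (e.hom ≫ biproduct.π B i),
    fun i => (toKaroubi _).map (biproduct.ι B i ≫ e.inv) ≫
      Karoubi.decompId_p A, ?_⟩
  simpa only [Functor.map_sum, Preadditive.sum_comp, Preadditive.comp_sum,
    CategoryTheory.Functor.map_comp, Category.assoc] using h'.trans h''

namespace FreeSubdim

variable (k : Type w) [Field k] (n : ℕ)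

/-- The projection to the quotient, on the free linear category. -/
abbrev proj : Free k FinBij ⥤ FreeSubdim k n :=
  CauchyCompletion.embedding _ ⋙ CategoryTheory.Quotient.functor (exteriorIdeal k n).rel

/-- The tensor powers of the generating object. -/
abbrev pow : FinBij ⥤ FreeSubdim k n := Free.embedding k FinBij ⋙ proj k n

theorem isAdditivelyDense_pow : IsAdditivelyDense (pow k n) := fun A => by
  obtain ⟨ι, _, c, a, b, hab⟩ := CauchyCompletion.isAdditivelyDense_embedding (Free k FinBij) A.as
  let Q := CategoryTheory.Quotient.functor (exteriorIdeal k n).rel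
  refine ⟨ι, inferInstance, c, fun i => Q.map (a i), fun i => Q.map (b i), ?_⟩
  refine Eq.trans (b := Q.map (∑ i, a i ≫ b i)) ?_ ?_
  · rw [Q.map_sum]
    exact Finset.sum_congr rfl fun i _ => (Q.map_comp _ _).symm
  · rw [hab]
    exact Q.map_id _

variable {k n}
variable {R : Type u} [Category.{v} R] [Preadditive R] [Linear k R]
  [MonoidalCategory R] [SymmetricCategory R]

/-- The morphism `f` extends over finite sets by tensor powers, then over the quotient by density.
-/
theorem exists_hom [MonoidalPreadditive R] (F G : TwoRigMap k (FreeSubdim k n) R)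
    (f : F.toFunctor.obj (gen k n) ⟶ G.toFunctor.obj (gen k n)) :
    ∃ α : F ⟶ G, α.toNatTrans.app (gen k n) = f := by
  let t := FinBij.extend (F := pow k n ⋙ F.toFunctor) (G := pow k n ⋙ G.toFunctor) f
  have hmon := FinBij.isMonoidal_extend (F := pow k n ⋙ F.toFunctor)
    (G := pow k n ⋙ G.toFunctor) f
  have ht : ∀ {c c' : FinBij} (h : (pow k n).obj c ⟶ (pow k n).obj c'),
      F.toFunctor.map h ≫ t.app c' = t.app c ≫ G.toFunctor.map h := fun {c c'} h => by
    -- The projection is full, so a morphism between powers in the quotient comes from a linear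
    -- combination of bijections, and naturality for bijections is enough.
    obtain ⟨h, rfl⟩ := (proj k n).map_surjective h
    exact FreeLinear.natural_of_natural_basis k (proj k n ⋙ F.toFunctor) (proj k n ⋙ G.toFunctor)
      (x := t.app c) (y := t.app c') (fun f => t.naturality f) h
  let α := (isAdditivelyDense_pow k n).extend (F := F.toFunctor) (G := G.toFunctor) t.app ht
  have hα : NatTrans.IsMonoidal α := by
    refine IsAdditivelyDense.isMonoidal_extend _ _ _ ?_ ?_
    · exact (Category.assoc _ _ _).symm.trans hmon.unit
    · intro c c'
      exact (Category.assoc _ _ _).symm.trans (hmon.tensor c c')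
  exact ⟨⟨α, hα⟩, (IsAdditivelyDense.extend_app t.app (isAdditivelyDense_pow k n) ht
    FinBij.point).trans
    (FinBij.extend_app_point (F := pow k n ⋙ F.toFunctor)
      (G := pow k n ⋙ G.toFunctor) f)⟩

/-- Monoidality determines the components at powers of the generator, and density determines all
others. -/
theorem hom_ext {F G : TwoRigMap k (FreeSubdim k n) R} {α β : F ⟶ G}
    (h : α.toNatTrans.app (gen k n) = β.toNatTrans.app (gen k n)) : α = β := by
  have := α.isMonoidal
  have := β.isMonoidal
  have h2 := FinBij.natTrans_ext (Functor.whiskerLeft (pow k n) α.toNatTrans)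
    (Functor.whiskerLeft (pow k n) β.toNatTrans) h
  exact TwoRigMap.Hom.ext ((isAdditivelyDense_pow k n).natTrans_ext fun c =>
    congrArg (fun t => t.app c) h2)

theorem isEquivalence_evalAt (hx : HasSubdimension k n (gen k n)) [IsTwoRig k R] :
    (Subdim.evalAt hx R : TwoRigMap k (FreeSubdim k n) R ⥤ Subdim k n R).IsEquivalence where
  faithful := ⟨fun h => hom_ext (congrArg (fun f => f.hom) h)⟩
  full := ⟨fun {F G} f => by
    have : MonoidalPreadditive R := IsTwoRig.monoidalPreadditive k
    obtain ⟨α, hα⟩ := exists_hom F G f.hom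
    exact ⟨α, ObjectProperty.hom_ext _ hα⟩⟩
  essSurj := ⟨fun r => by
    obtain ⟨F, hF⟩ := exists_map r.obj r.property
    -- The value of `F` at the generator equals `r`, so essential surjectivity even holds on the
    -- nose.
    exact ⟨F, ⟨ObjectProperty.isoMk _ (eqToIso hF)⟩⟩⟩

/-- A fully faithful functor lifts each isomorphism of values to a unique isomorphism. -/
theorem existsUnique_iso (hx : HasSubdimension k n (gen k n)) [IsTwoRig k R]
    {F G : TwoRigMap k (FreeSubdim k n) R}
    (e : F.toFunctor.obj (gen k n) ≅ G.toFunctor.obj (gen k n)) :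
    ∃! α : F ≅ G, α.hom.toNatTrans.app (gen k n) = e.hom := by
  have := isEquivalence_evalAt (R := R) hx
  let E : TwoRigMap k (FreeSubdim k n) R ⥤ Subdim k n R := Subdim.evalAt hx R
  let e' : E.obj F ≅ E.obj G := ObjectProperty.isoMk _ e
  refine ⟨E.preimageIso e', congrArg (fun f => f.hom) (E.map_preimage e'.hom), fun β hβ => ?_⟩
  exact Iso.ext (E.map_injective (ObjectProperty.hom_ext _
    (hβ.trans (congrArg (fun f => f.hom) (E.map_preimage e'.hom)).symm)))

end FreeSubdim

end

theorem mainTheorem4 (k : Type w) [Field k] [CharZero k] (n : ℕ) :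
    IsTwoRig k (FreeSubdim k n) ∧
    ∃ hx : HasSubdimension k n (FreeSubdim.gen k n),
      -- evaluation at the generating object is an equivalence
      (∀ (R : Type u) [Category.{v} R] [Preadditive R] [Linear k R] [MonoidalCategory R]
          [SymmetricCategory R] [IsTwoRig k R],
        (Subdim.evalAt hx R : TwoRigMap k (FreeSubdim k n) R ⥤ Subdim k n R).IsEquivalence) ∧
      -- which is 2-natural in the target
      (∀ (R : Type u) [Category.{v} R] [Preadditive R] [Linear k R] [MonoidalCategory R]
          [SymmetricCategory R] [IsTwoRig k R]
          (R' : Type u') [Category.{v'} R'] [Preadditive R'] [Linear k R'] [MonoidalCategory R']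
          [SymmetricCategory R'] [IsTwoRig k R'],
        (∀ A : TwoRigMap k R R',
          TwoRigMap.postcomp A ⋙ Subdim.evalAt hx R' = Subdim.evalAt hx R ⋙ Subdim.map n A) ∧
        (∀ (A A' : TwoRigMap k R R') (α : A ⟶ A') (F : TwoRigMap k (FreeSubdim k n) R),
          (Subdim.evalAt hx R').map ((TwoRigMap.postcompMap α).app F) =
            (Subdim.map₂ n α).app ((Subdim.evalAt hx R).obj F))) ∧
      -- the universal property for a single object of subdimension `n`
      (∀ (R : Type u) [Category.{v} R] [Preadditive R] [Linear k R] [MonoidalCategory R]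
          [SymmetricCategory R] [IsTwoRig k R] (r : R), HasSubdimension k n r →
        (∃ F : TwoRigMap k (FreeSubdim k n) R, F.toFunctor.obj (FreeSubdim.gen k n) = r) ∧
        ∀ (F G : TwoRigMap k (FreeSubdim k n) R)
          (hF : F.toFunctor.obj (FreeSubdim.gen k n) = r)
          (hG : G.toFunctor.obj (FreeSubdim.gen k n) = r),
          ∃! α : F ≅ G,
            α.hom.toNatTrans.app (FreeSubdim.gen k n) = eqToHom (hF.trans hG.symm)) := by
  refine ⟨inferInstance, FreeSubdim.hasSubdimension_gen k n, ?_, ?_, ?_⟩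
  · intro R _ _ _ _ _ _
    exact FreeSubdim.isEquivalence_evalAt _
  · intro R _ _ _ _ _ _ R' _ _ _ _ _ _
    -- Evaluating after composition with `A` and applying `A` to the evaluation are the same
    -- construction, so 2-naturality is strict.
    exact ⟨fun _ => rfl, fun _ _ _ _ => rfl⟩
  · intro R _ _ _ _ _ _ r hr
    exact ⟨FreeSubdim.exists_map r hr, fun F G hF hG =>
      FreeSubdim.existsUnique_iso (FreeSubdim.hasSubdimension_gen k n) (eqToIso (hF.trans hG.symm))⟩
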